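/- **Definitions.** A hypergraph has a set of vertices and a set of hyperedges, which are sets of at least two vertices. Two distinct vertices of a common hyperedge are neighbours; paths, connectedness and the distance $d$ refer to this relation ($d=\infty$ between different components). A finite hypertree is a finite connected hypergraph with $n$ vertices and $k$ hyperedges whose sizes add up to $n+k-1$. A connected infinite hypergraph is a hypertree if each connected subhypergraph induced by a finite set $S$ of vertices (its hyperedges are the intersections $e\cap S$ with at least two elements) is a finite hypertree. Two infinite geodesics $\gamma,\gamma'$ are equivalent if $d(\gamma(n),\gamma'(n))$ is finite and constant for large $n$; an end of a component is an equivalence class of infinite geodesics in it. An *ideally rooted hypertree* with vertex set $\mathcal V=\{1,2,\dots\}\cup\{\infty\}$ and root $\infty$ is a hypergraph on $\mathcal V$ whose connected components are all hypertrees, together with the choice of one end in every component not containing $\infty$ (the *ideal components*). The marked vertex $e_*$ of a hyperedge $e$ is its vertex closest to $\infty$ if $e$ is in the component of $\infty$; if $e$ is in an ideal component, it is the vertex of $e$ closest to $\gamma(n)$ for all large $n$, where $\gamma$ is a geodesic in the marked end. The reduced hyperedge is $e'=e\setminus\{e_*\}$; its elements are the unmarked vertices of $e$. **Prüfer code.**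 Let $T$ be an ideally rooted hypertree on $\mathcal V$ with infinitely many hyperedges. Its Prüfer partition $\mathcal P(T)$ is the set of all reduced hyperedges, and its Prüfer word $W^*(T)=w_1w_2\cdots$ is defined as follows. Initially no position of the word carries a letter. For $v=1,2,3,\dots$ successively, list the current hyperedges that do not contain $v$ as an unmarked vertex, in increasing order of their smallest unmarked vertices, and match them in order with the positions that do not yet carry a letter (the $j$-th hyperedge with the $j$-th such position); write the letter $v$ at the positions matched with hyperedges whose marked vertex is $v$. Then perform the star-reduction at $v$: replace all hyperedges containing $v$ by their union, with the marked vertex of the hyperedge which contained $v$ as an unmarked vertex. Positions which never receive a finite letter carry the letter $\infty$. **Theorem.** (a) The map $T\mapsto(\mathcal P(T),W^*(T))$ is a bijection from the set of ideally rooted hypertrees with vertices $\{1,2,\dots\}\cup\{\infty\}$, root $\infty$ and infinitely many hyperedges onto the set of all pairs $(\mathcal P,W)$ where $\mathcal P$ is a partition of $\{1,2,\dots\}$ into infinitely many non-empty parts and $W$ is an arbitrary infinite word with letters in $\{1,2,\dots\}\cup\{\infty\}$. (b) If such a $T$ is locally finite (all hyperedges are finite and every vertex, including $\infty$, lies in finitely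 many hyperedges), then all parts of $\mathcal P(T)$ are finite and every letter of $\{1,2,\dots\}\cup\{\infty\}$ has finite multiplicity in $W^*(T)$. (c) More precisely, all parts of $\mathcal P(T)$ are finite and every letter of $\{1,2,\dots\}\cup\{\infty\}$ has finite multiplicity in $W^*(T)$ if and only if all hyperedges of $T$ are finite, every vertex $v\neq\infty$ has finite degree, and either $\infty$ has finite degree or $T$ has an ideal component. (In particular, a $T$ whose root has finite degree, or which has no ideal component, is locally finite if and only if its code is of this form.) -/

import Mathlib

open scoped Hypergraph

namespace Hypergraph

variable {V : Type*}

/-- Every hyperedge contains at least two vertices. -/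
def Loopless (H : Hypergraph V) : Prop := ∀ e ∈ E(H), e.Nontrivial

/-- Two distinct vertices of a common hyperedge are neighbours. Paths, connectedness and
distances in a hypergraph are those of this graph; `edist` is `⊤` between different
connected components. -/
def primalGraph (H : Hypergraph V) : SimpleGraph V where
  Adj v w := v ≠ w ∧ ∃ e ∈ E(H), v ∈ e ∧ w ∈ e
  symm := ⟨fun _ _ h => ⟨h.1.symm, h.2.imp fun _ he => ⟨he.1, he.2.2, he.2.1⟩⟩⟩
  loopless := ⟨fun _ h => h.1 rfl⟩

/-- A non-empty hypergraph in which two vertices can always be joined by a path. -/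
def IsConnected (H : Hypergraph V) : Prop :=
  V(H).Nonempty ∧ ∀ v ∈ V(H), ∀ w ∈ V(H), H.primalGraph.Reachable v w

/-- The subhypergraph induced by a set `S` of vertices: its hyperedges are the intersections
with `S` of hyperedges, whenever they contain at least two vertices. -/
def induce (H : Hypergraph V) (S : Set V) : Hypergraph V where
  vertexSet := V(H) ∩ S
  edgeSet := {f | f.Nontrivial ∧ ∃ e ∈ E(H), f = e ∩ S}
  subset_vertexSet_of_mem_edgeSet' := by
    rintro f ⟨-, e, he, rfl⟩
    exact Set.inter_subset_inter_left S (H.subset_vertexSet_of_mem_edgeSet' he)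

/-- A finite connected hypergraph with `n` vertices and `k` hyperedges of total size `n + k - 1`. -/
def IsFiniteHypertree (H : Hypergraph V) : Prop :=
  V(H).Finite ∧ H.Loopless ∧ H.IsConnected ∧
    (∑ᶠ e ∈ E(H), e.ncard) + 1 = V(H).ncard + E(H).ncard

/-- Either a finite hypertree, or a connected infinite hypergraph all of whose connected
subhypergraphs induced by finitely many vertices are finite hypertrees. -/
def IsHypertree (H : Hypergraph V) : Prop :=
  H.IsFiniteHypertree ∨
    (V(H).Infinite ∧ H.Loopless ∧ H.IsConnected ∧
      ∀ S ⊆ V(H), S.Finite → (H.induce S).IsConnected → (H.induce S).IsFiniteHypertree)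

/-- An infinite geodesic `γ 0, γ 1, γ 2, …`. -/
def IsRay (H : Hypergraph V) (γ : ℕ → V) : Prop :=
  ∀ m k : ℕ, H.primalGraph.edist (γ m) (γ (m + k)) = k

/-- The distance between `γ n` and `γ' n` is ultimately constant (and finite). -/
def RayEquiv (H : Hypergraph V) (γ γ' : ℕ → V) : Prop :=
  ∃ c : ℕ, ∀ᶠ n in Filter.atTop, H.primalGraph.edist (γ n) (γ' n) = c

/-- `E` is an end of the connected component `C`: the class of all infinite geodesics which are
equivalent to some infinite geodesic of `C`. -/
def IsEndOf (H : Hypergraph V) (C : H.primalGraph.ConnectedComponent) (E : Set (ℕ → V)) : Prop :=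
  ∃ γ, H.IsRay γ ∧ (∀ n, γ n ∈ C.supp) ∧ E = {γ' | H.IsRay γ' ∧ H.RayEquiv γ γ'}

/-- The set of hyperedges containing `v`; its cardinality is the degree of `v`. -/
def edgesAt (H : Hypergraph V) (v : V) : Set (Set V) := {e ∈ E(H) | v ∈ e}

/-- All hyperedges have finite size and all vertices have finite degree. -/
def IsLocallyFinite (H : Hypergraph V) : Prop :=
  (∀ e ∈ E(H), e.Finite) ∧ ∀ v ∈ V(H), (H.edgesAt v).Finite

end Hypergraph

/-- An ideally rooted hypertree with set of vertices `V` and root `r`: a hyperforest together with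
the choice of an end in every connected component which does not contain the root. -/
structure IdeallyRootedHypertree (V : Type*) (r : V) where
  toHypergraph : Hypergraph V
  vertexSet_eq : V(toHypergraph) = Set.univ
  loopless : toHypergraph.Loopless
  /-- Every connected component is a hypertree. -/
  isHypertree : ∀ C : toHypergraph.primalGraph.ConnectedComponent,
    (toHypergraph.induce C.supp).IsHypertree
  /-- The marked end of a component without the root. -/
  markedEnd : ∀ C : toHypergraph.primalGraph.ConnectedComponent, r ∉ C.supp → Set (ℕ → V)
  isEndOf : ∀ C hC, toHypergraph.IsEndOf C (markedEnd C hC)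

namespace IdeallyRootedHypertree

section General

variable {V : Type*} {r : V}

/-- There is an ideal component, that is, a connected component not containing the root. -/
def HasIdealComponent (T : IdeallyRootedHypertree V r) : Prop :=
  ∃ C : T.toHypergraph.primalGraph.ConnectedComponent, r ∉ C.supp

/-- `w` is the marked vertex of the hyperedge `e`: the unique vertex of `e` closest to the root if
`e` lies in the root component, the unique vertex of `e` closest to `γ n` for all sufficiently large
`n`, with `γ` in the marked end, if `e` lies in an ideal component. -/
def IsMarkedVertex (T : IdeallyRootedHypertree V r) (e : Set V) (w : V) : Prop :=
  w ∈ e ∧ ∀ C : T.toHypergraph.primalGraph.ConnectedComponent, e ⊆ C.supp →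
    (r ∈ C.supp → ∀ u ∈ e, u ≠ w →
      T.toHypergraph.primalGraph.edist w r < T.toHypergraph.primalGraph.edist u r) ∧
    (∀ hC : r ∉ C.supp, ∀ γ ∈ T.markedEnd C hC, ∀ᶠ n in Filter.atTop, ∀ u ∈ e, u ≠ w →
      T.toHypergraph.primalGraph.edist w (γ n) < T.toHypergraph.primalGraph.edist u (γ n))

/-- The hyperedges of `T`, each one paired with its marked vertex. -/
def markedEdges (T : IdeallyRootedHypertree V r) : Set (Set V × V) :=
  {q | q.1 ∈ E(T.toHypergraph) ∧ T.IsMarkedVertex q.1 q.2}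

end General

end IdeallyRootedHypertree

/-! Star-reductions and Prüfer codes for the vertices `{1, 2, …} ∪ {∞}` with root `∞`. -/

namespace PrueferCode

/-- The set of vertices `{1, 2, …} ∪ {∞}`. -/
abbrev Vertex : Type := WithTop ℕ+

/-- A hyperedge `q.1` with marked vertex `q.2`. -/
abbrev MarkedEdge : Type := Set Vertex × Vertex

/-- The reduced hyperedge, consisting of all unmarked vertices. -/
def reduced (q : MarkedEdge) : Set Vertex := q.1 \ {q.2}

/-- The smallest unmarked vertex (as a natural number; unmarked vertices are never `∞`). -/
noncomputable def label (q : MarkedEdge) : ℕ :=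
  sInf {n : ℕ | ∃ v : ℕ+, (v : ℕ) = n ∧ (v : Vertex) ∈ reduced q}

/-- Star-reduction at `v`: all hyperedges containing `v` are replaced by their union. The marked
vertex of the union is that of the hyperedge containing `v` as an unmarked vertex. -/
def starReduction (v : ℕ+) (M : Set MarkedEdge) : Set MarkedEdge :=
  {q ∈ M | (v : Vertex) ∉ q.1} ∪
    {q | (∃ q₀ ∈ M, (v : Vertex) ∈ reduced q₀ ∧ q.2 = q₀.2) ∧
      q.1 = ⋃₀ {e | (v : Vertex) ∈ e ∧ ∃ m, (e, m) ∈ M}}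

/-- The set `ℰ_v` of all hyperedges not containing `v` as an unmarked vertex. -/
def edgesAvoiding (v : ℕ+) (M : Set MarkedEdge) : Set MarkedEdge :=
  {q ∈ M | (v : Vertex) ∉ reduced q}

/-- The position `i` of the Prüfer word receives the letter `v` when `M` is the current set of
marked hyperedges and `R` is the set of positions without a letter: `i` is in `R` and, if `i` is
the `j`-th element of `R`, then the `j`-th hyperedge of `ℰ_v`, with respect to the order given by
smallest unmarked vertices, has marked vertex `v`. -/
def Receives (v : ℕ+) (M : Set MarkedEdge) (R : Set ℕ) (i : ℕ) : Prop :=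
  i ∈ R ∧ ∃ q ∈ edgesAvoiding v M, q.2 = (v : Vertex) ∧
    {i' ∈ R | i' < i}.ncard = {q' ∈ edgesAvoiding v M | label q' < label q}.ncard

end PrueferCode

namespace IdeallyRootedHypertree

open PrueferCode

/-- The marked hyperedges of the star-reduction of `T` at `1, …, k`, and the set of positions of the
Prüfer word which have received none of the letters `1, …, k`. -/
def stage (T : IdeallyRootedHypertree Vertex ⊤) : ℕ → Set MarkedEdge × Set ℕ
  | 0 => (T.markedEdges, Set.univ)
  | k + 1 =>
    (starReduction k.succPNat (T.stage k).1,
      {i ∈ (T.stage k).2 | ¬ Receives k.succPNat (T.stage k).1 (T.stage k).2 i})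

/-- The parts of the Prüfer partition of `{1, 2, …}` are the reduced hyperedges. -/
def prueferPartition (T : IdeallyRootedHypertree Vertex ⊤) : Set (Set ℕ+) :=
  {s | ∃ q ∈ T.markedEdges, s = {v : ℕ+ | (v : Vertex) ∈ reduced q}}

open Classical in
/-- The Prüfer word `w₁w₂w₃…`, with `w_{i+1}` written `T.prueferWord i`. Positions
receiving no finite letter carry the letter `∞`. -/
noncomputable def prueferWord (T : IdeallyRootedHypertree Vertex ⊤) (i : ℕ) : Vertex :=
  if h : ∃ k : ℕ, Receives k.succPNat (T.stage k).1 (T.stage k).2 i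
  then ((Nat.find h).succPNat : Vertex) else ⊤

/-- The Prüfer code `(𝒫, W*)`. -/
noncomputable def prueferCode (T : IdeallyRootedHypertree Vertex ⊤) :
    Set (Set ℕ+) × (ℕ → Vertex) :=
  (T.prueferPartition, T.prueferWord)

end IdeallyRootedHypertree

namespace PrueferCode

/-- The partition has only finite parts and every letter of `{1, 2, …} ∪ {∞}` has finite
multiplicity in the word. -/
def IsFiniteType (c : Set (Set ℕ+) × (ℕ → Vertex)) : Prop :=
  (∀ s ∈ c.1, s.Finite) ∧ ∀ a : Vertex, {i | c.2 i = a}.Finite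

end PrueferCode

/-! An ideally rooted hypertree is the same thing as a parent map. Every vertex `v` other than the
root is unmarked in exactly one hyperedge; let `c v` be that reduced hyperedge and `p v` its marked
vertex. Then `p` is constant on the classes `c v` and has no cycles, and such data (`ParentSystem`)
determine the hypertree: climbing along `p` either reaches the root or gives an infinite geodesic,
and the marked end of an ideal component consists of its ascending rays. The two directions are
`exists_parentSystem` and `ParentSystem.toHypertree`; `markedEdges_injective` says that nothing else
is recorded.

In these terms the star-reduction at `v` merges the class of `v` with those of the children of `v`
and gives them the parent `p v`. The number of classes always exceeds the number of free positions
by one (`encard_labels_stage`), with infinity counted as infinity plus one at the beginning. So the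
classes other than that of `v` correspond bijectively, in increasing order, to the free positions,
and the positions carrying `v` reveal the children of `v` at that stage (`children_eq_received`). By
induction the partition and the word determine the classes at all stages, and the original parent of
`x` is the first letter which receives the class of `x`. This gives injectivity.

Conversely, any word matches classes with letters in this way. Take as parent the first receiving
letter, or the root if there is none. A cycle is impossible: when its largest letter is treated, the
rest of the cycle has already been merged with that letter (`decodeParent_acyclic`). The resulting
hypertree has the prescribed code.

For multiplicities, classes with a common parent are merged only when that parent is reduced, so a
finite letter has finite multiplicity exactly if its vertex has finite degree (`finite_letter_iff`).
If the letter for the root has infinite multiplicity, then for every `n` there is a stage at which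
the first `n` classes all have the root as parent; this excludes a root of finite degree and ideal
components. If the root has infinite degree and there is no ideal component, the first classes of
all late stages are attached to the root, and their positions are never filled (`infinite_top`). -/

namespace Hypergraph

/-! ### Counting in finite hypertrees and distances to a fixed vertex -/

variable {V : Type*}

/-- Given a level function decreasing along some hyperedge at every vertex but `t`, every hyperedge
of a finite hypertree has a unique lowest vertex, and it is the only descending hyperedge at all of
its other vertices. -/
theorem IsFiniteHypertree.exists_descent {K : Hypergraph V} (hK : K.IsFiniteHypertree) {t : V}
    (ht : t ∈ V(K)) (ℓ : V → ℕ)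
    (hdesc : ∀ v ∈ V(K), v ≠ t → ∃ e ∈ E(K), v ∈ e ∧ ∃ w ∈ e, ℓ w < ℓ v) :
    ∃ g : V → Set V, ∀ e ∈ E(K), ∃ w ∈ e, ∀ u ∈ e, u ≠ w → ℓ w < ℓ u ∧ g u = e := by
  classical
  obtain ⟨hfin, hloop, -, hsum⟩ := hK
  have hg : ∀ v, ∃ e, v ∈ V(K) → v ≠ t → e ∈ E(K) ∧ v ∈ e ∧ ∃ w ∈ e, ℓ w < ℓ v := by
    intro v
    by_cases hv : v ∈ V(K) ∧ v ≠ t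
    · obtain ⟨e, he⟩ := hdesc v hv.1 hv.2
      exact ⟨e, fun _ _ => he⟩
    · exact ⟨∅, fun h1 h2 => (hv ⟨h1, h2⟩).elim⟩
  choose g hg using hg
  have hsub : ∀ e ∈ E(K), e ⊆ V(K) := fun e he => K.subset_vertexSet_of_mem_edgeSet' he
  have hefin : ∀ e ∈ E(K), e.Finite := fun e he => hfin.subset (hsub e he)
  have hEfin : E(K).Finite := hfin.finite_subsets.subset hsub
  have hmin : ∀ e, ∃ w, e ∈ E(K) → w ∈ e ∧ ∀ u ∈ e, ℓ w ≤ ℓ u := by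
    intro e
    by_cases he : e ∈ E(K)
    · obtain ⟨w, hw, hw'⟩ := Set.exists_min_image e ℓ (hefin e he) (hloop e he).nonempty
      exact ⟨w, fun _ => ⟨hw, hw'⟩⟩
    · exact ⟨t, fun h => (he h).elim⟩
  choose w hw using hmin
  set Ef := hEfin.toFinset with hEf
  set Vf := hfin.toFinset with hVf
  -- Every vertex except `t` chooses a descending hyperedge. Those which choose `e` avoid the lowest
  -- vertex `w e`, so there are at most `e.ncard - 1` of them. By the size formula these bounds add
  -- up to the number of choosing vertices, hence all of them are equalities.
  let fib : Set V → Finset V := fun e => (Vf.erase t).filter (fun v => g v = e)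
  have hfib : ∀ e ∈ E(K), (fib e : Set V) ⊆ e \ {w e} := by
    intro e he v hv
    simp only [fib, Finset.coe_filter, Finset.mem_erase, hVf, Set.Finite.mem_toFinset] at hv
    obtain ⟨⟨hvt, hvV⟩, hge⟩ := hv
    obtain ⟨-, h2, u, hu, hul⟩ := hg v hvV hvt
    rw [hge] at h2 hu
    refine ⟨h2, fun h => ?_⟩
    have := (hw e he).2 u hu
    rw [Set.mem_singleton_iff] at h
    rw [h] at hul
    omega
  have hle : ∀ e ∈ Ef, (fib e).card + 1 ≤ e.ncard := by
    intro e he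
    rw [hEf, Set.Finite.mem_toFinset] at he
    have h1 := Set.ncard_le_ncard (hfib e he) ((hefin e he).subset Set.sdiff_subset)
    rw [Set.ncard_coe_finset] at h1
    have h2 := Set.ncard_sdiff_singleton_add_one (hw e he).1 (hefin e he)
    omega
  have hcard : (Vf.erase t).card = ∑ e ∈ Ef, (fib e).card := by
    apply Finset.card_eq_sum_card_fiberwise
    intro v hv
    simp only [Finset.coe_erase, hVf, Set.Finite.coe_toFinset] at hv
    simp only [hEf, Set.Finite.coe_toFinset]
    exact (hg v hv.1 hv.2).1
  have htot : ∑ e ∈ Ef, ((fib e).card + 1) = ∑ e ∈ Ef, e.ncard := by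
    rw [Finset.sum_add_distrib, ← hcard]
    rw [finsum_mem_eq_finite_toFinset_sum _ hEfin, Set.ncard_eq_toFinset_card _ hfin,
      Set.ncard_eq_toFinset_card _ hEfin, ← hVf, ← hEf] at hsum
    have : (Vf.erase t).card + 1 = Vf.card := Finset.card_erase_add_one (by simpa [hVf] using ht)
    simp only [Finset.sum_const, smul_eq_mul, mul_one]
    omega
  have heq := (Finset.sum_eq_sum_iff_of_le hle).1 htot
  refine ⟨g, fun e he => ⟨w e, (hw e he).1, fun u hu huw => ?_⟩⟩
  have h1 := heq e (by simpa [hEf] using he)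
  have h2 := Set.ncard_sdiff_singleton_add_one (hw e he).1 (hefin e he)
  have h3 : (fib e : Set V) = e \ {w e} := by
    apply Set.eq_of_subset_of_ncard_le (hfib e he) _ ((hefin e he).subset Set.sdiff_subset)
    rw [Set.ncard_coe_finset]
    omega
  have h4 : u ∈ (fib e : Set V) := by rw [h3]; exact ⟨hu, huw⟩
  simp only [fib, Finset.coe_filter, Finset.mem_erase, hVf, Set.Finite.mem_toFinset] at h4
  obtain ⟨⟨hut, huV⟩, hge⟩ := h4
  obtain ⟨-, -, x, hx, hxl⟩ := hg u huV hut
  rw [hge] at hx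
  exact ⟨((hw e he).2 x hx).trans_lt hxl, hge⟩

theorem _root_.SimpleGraph.Reachable.exists_adj_dist_lt {G : SimpleGraph V} {v t : V}
    (h : G.Reachable v t) (hne : v ≠ t) : ∃ w, G.Adj v w ∧ G.dist w t < G.dist v t := by
  obtain ⟨p, hp⟩ := h.exists_walk_length_eq_dist
  cases p with
  | nil => exact (hne rfl).elim
  | cons h q =>
    rename_i w
    refine ⟨w, h, ?_⟩
    have := G.dist_le q
    rw [SimpleGraph.Walk.length_cons] at hp
    omega

theorem induce_induce (H : Hypergraph V) {S C : Set V} (hS : S ⊆ C) :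
    (H.induce C).induce S = H.induce S := by
  apply Hypergraph.ext
  · change (V(H) ∩ C) ∩ S = V(H) ∩ S
    rw [Set.inter_assoc, Set.inter_eq_right.2 hS]
  · ext f
    constructor
    · rintro ⟨hf, e, ⟨-, e', he', rfl⟩, rfl⟩
      exact ⟨hf, e', he', by rw [Set.inter_assoc, Set.inter_eq_right.2 hS]⟩
    · rintro ⟨hf, e, he, rfl⟩
      exact ⟨hf, e ∩ C, ⟨hf.mono (Set.inter_subset_inter_right _ hS), e, he, rfl⟩,
        by rw [Set.inter_assoc, Set.inter_eq_right.2 hS]⟩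

theorem induce_adj {H : Hypergraph V} {S : Set V} {v w : V} :
    (H.induce S).primalGraph.Adj v w ↔ H.primalGraph.Adj v w ∧ v ∈ S ∧ w ∈ S := by
  constructor
  · rintro ⟨hne, f, ⟨-, e, he, rfl⟩, hv, hw⟩
    exact ⟨⟨hne, e, he, hv.1, hw.1⟩, hv.2, hw.2⟩
  · rintro ⟨⟨hne, e, he, hv, hw⟩, hvS, hwS⟩
    exact ⟨hne, e ∩ S, ⟨⟨v, ⟨hv, hvS⟩, w, ⟨hw, hwS⟩, hne⟩, e, he, rfl⟩, ⟨hv, hvS⟩, hw, hwS⟩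

section Component

variable {H : Hypergraph V} {C : H.primalGraph.ConnectedComponent} {t : V}

/-- The vertices of a shortest path to `t`. Such sets are stable under unions and induce connected
subhypergraphs, which makes the finitary definition of an infinite hypertree applicable around any
finite set. -/
theorem exists_finite_descending (ht : t ∈ C.supp) (n : ℕ) :
    ∀ v ∈ C.supp, H.primalGraph.dist v t = n → ∃ S ⊆ C.supp, S.Finite ∧ v ∈ S ∧ t ∈ S ∧
      ∀ v ∈ S, v ≠ t → ∃ w ∈ S, H.primalGraph.Adj v w ∧
        H.primalGraph.dist w t < H.primalGraph.dist v t := by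
  induction n using Nat.strong_induction_on with
  | _ n ih =>
    intro v hv hn
    by_cases hvt : v = t
    · subst hvt
      exact ⟨{v}, by simpa using hv, Set.finite_singleton _, rfl, rfl, fun w hw h => (h hw).elim⟩
    · obtain ⟨w, hw, hwd⟩ := (C.reachable_of_mem_supp hv ht).exists_adj_dist_lt hvt
      have hwC := (C.mem_supp_congr_adj hw).1 hv
      obtain ⟨S, hSC, hSf, hwS, htS, hS⟩ := ih _ (hn ▸ hwd) w hwC rfl
      refine ⟨insert v S, Set.insert_subset hv hSC, hSf.insert v, Set.mem_insert _ _,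
        Set.mem_insert_of_mem _ htS, ?_⟩
      rintro x (rfl | hx) hxt
      · exact ⟨w, Set.mem_insert_of_mem _ hwS, hw, hwd⟩
      · obtain ⟨y, hy, h⟩ := hS x hx hxt
        exact ⟨y, Set.mem_insert_of_mem _ hy, h⟩

theorem exists_finite_descending_superset (ht : t ∈ C.supp) {F : Set V} (hF : F.Finite)
    (hFC : F ⊆ C.supp) : ∃ S ⊆ C.supp, S.Finite ∧ F ⊆ S ∧ t ∈ S ∧
      ∀ v ∈ S, v ≠ t → ∃ w ∈ S, H.primalGraph.Adj v w ∧
        H.primalGraph.dist w t < H.primalGraph.dist v t := by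
  choose! S hSC hSf hvS htS hS using
    fun v (hv : v ∈ C.supp) => exists_finite_descending (H := H) ht _ v hv rfl
  refine ⟨⋃ v ∈ insert t F, S v, ?_, ?_, ?_, ?_, ?_⟩
  · exact Set.iUnion₂_subset fun v hv => hSC v (Set.insert_subset ht hFC hv)
  · exact (hF.insert t).biUnion fun v hv => hSf v (Set.insert_subset ht hFC hv)
  · exact fun v hv => Set.mem_biUnion (Set.mem_insert_of_mem _ hv) (hvS v (hFC hv))
  · exact Set.mem_biUnion (Set.mem_insert _ _) (hvS t ht)
  · intro v hv hvt
    obtain ⟨u, hu, hvu⟩ := Set.mem_iUnion₂.1 hv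
    obtain ⟨w, hw, h⟩ := hS u (Set.insert_subset ht hFC hu) v hvu hvt
    exact ⟨w, Set.mem_biUnion hu hw, h⟩

theorem isConnected_induce_of_descending (hV : V(H) = Set.univ) {S : Set V} (htS : t ∈ S)
    (hS : ∀ v ∈ S, v ≠ t → ∃ w ∈ S, H.primalGraph.Adj v w ∧
        H.primalGraph.dist w t < H.primalGraph.dist v t) : (H.induce S).IsConnected := by
  have key : ∀ n, ∀ v ∈ S, H.primalGraph.dist v t = n →
      (H.induce S).primalGraph.Reachable v t := by
    intro n
    induction n using Nat.strong_induction_on with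
    | _ n ih =>
      intro v hv hn
      by_cases hvt : v = t
      · rw [hvt]
      · obtain ⟨w, hw, hvw, hd⟩ := hS v hv hvt
        exact (SimpleGraph.Adj.reachable (induce_adj.2 ⟨hvw, hv, hw⟩)).trans
          (ih _ (hn ▸ hd) w hw rfl)
  refine ⟨⟨t, by rw [hV]; trivial, htS⟩, fun v hv w hw => ?_⟩
  exact (key _ v hv.2 rfl).trans (key _ w hw.2 rfl).symm

/-- A finite component serves as `S` itself; in an infinite one only finite connected induced pieces
are known to be hypertrees. The descent is measured by distances in `H`, not in the induced piece.
-/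
theorem exists_descending_isFiniteHypertree (hV : V(H) = Set.univ)
    (hC : (H.induce C.supp).IsHypertree) (ht : t ∈ C.supp) {F : Set V} (hF : F.Finite)
    (hFC : F ⊆ C.supp) : ∃ S ⊆ C.supp, F ⊆ S ∧ t ∈ S ∧
      (∀ v ∈ S, v ≠ t → ∃ w ∈ S, H.primalGraph.Adj v w ∧
        H.primalGraph.dist w t < H.primalGraph.dist v t) ∧ (H.induce S).IsFiniteHypertree := by
  have hVC : V(H.induce C.supp) = C.supp := by
    change V(H) ∩ C.supp = _
    rw [hV, Set.univ_inter]
  obtain hC | ⟨-, -, -, hC⟩ := hC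
  · refine ⟨C.supp, subset_rfl, hFC, ht, fun v hv hvt => ?_, hC⟩
    obtain ⟨w, hw, hwd⟩ := (C.reachable_of_mem_supp hv ht).exists_adj_dist_lt hvt
    exact ⟨w, (C.mem_supp_congr_adj hw).1 hv, hw, hwd⟩
  · obtain ⟨S, hSC, hSf, hFS, htS, hS⟩ := exists_finite_descending_superset ht hF hFC
    refine ⟨S, hSC, hFS, htS, hS, ?_⟩
    have := hC S (by rw [hVC]; exact hSC) hSf
    rw [induce_induce H hSC] at this
    exact this (isConnected_induce_of_descending hV htS hS)

theorem exists_induce_descent (hV : V(H) = Set.univ)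
    (hC : (H.induce C.supp).IsHypertree) (ht : t ∈ C.supp) {F : Set V} (hF : F.Finite)
    (hFC : F ⊆ C.supp) : ∃ S ⊆ C.supp, F ⊆ S ∧ ∃ g : V → Set V,
      ∀ e ∈ E(H.induce S), ∃ w ∈ e, ∀ u ∈ e, u ≠ w →
        H.primalGraph.dist w t < H.primalGraph.dist u t ∧ g u = e := by
  obtain ⟨S, hSC, hFS, htS, hS, hT⟩ := exists_descending_isFiniteHypertree hV hC ht hF hFC
  refine ⟨S, hSC, hFS, hT.exists_descent (t := t) ⟨hV ▸ trivial, htS⟩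
    (fun v => H.primalGraph.dist v t) ?_⟩
  intro v hv hvt
  obtain ⟨w, hw, hvw, hd⟩ := hS v hv.2 hvt
  obtain ⟨-, e, he, h1, h2⟩ := induce_adj.2 ⟨hvw, hv.2, hw⟩
  exact ⟨e, he, h1, w, h2, hd⟩

theorem subset_supp_of_mem {e : Set V} (he : e ∈ E(H)) {v : V} (hv : v ∈ e) (hvC : v ∈ C.supp) :
    e ⊆ C.supp := by
  intro u hu
  by_cases h : v = u
  · rwa [← h]
  · exact (C.mem_supp_congr_adj ⟨h, e, he, hv, hu⟩).1 hvC

/-- A hyperedge of a hypertree has a unique vertex closest to `t`. -/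
theorem exists_closest (hV : V(H) = Set.univ) (hloop : H.Loopless)
    (hC : (H.induce C.supp).IsHypertree) (ht : t ∈ C.supp) {e : Set V} (he : e ∈ E(H))
    (heC : e ⊆ C.supp) : ∃ w ∈ e, ∀ u ∈ e, u ≠ w →
      H.primalGraph.dist w t < H.primalGraph.dist u t := by
  have hwf := (measure fun v => H.primalGraph.dist v t).wf
  let w := hwf.min e (hloop e he).nonempty
  have hwe : w ∈ e := hwf.min_mem e _
  have hmin : ∀ u ∈ e, H.primalGraph.dist w t ≤ H.primalGraph.dist u t :=
    fun u hu => not_lt.1 (hwf.not_lt_min e hu)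
  refine ⟨w, hwe, fun u hu huw => ?_⟩
  -- So far `w` is only minimal. The trace of `e` on a finite piece containing `u` and `w` has a
  -- strict minimum, and minimality of `w` in all of `e` forces it to be `w`.
  obtain ⟨S, hSC, hFS, g, hg⟩ := exists_induce_descent hV hC ht (F := {u, w})
    ((Set.finite_singleton _).insert _) (by rintro x (rfl | rfl); exacts [heC hu, heC hwe])
  have huS : u ∈ e ∩ S := ⟨hu, hFS (by simp)⟩
  have hwS : w ∈ e ∩ S := ⟨hwe, hFS (by simp)⟩
  obtain ⟨x, hx, hmx⟩ := hg (e ∩ S) ⟨⟨u, huS, w, hwS, huw⟩, e, he, rfl⟩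
  by_cases hwx : w = x
  · subst hwx
    exact (hmx u huS huw).1
  · have h1 := (hmx w hwS hwx).1
    have h2 := hmin x hx.1
    omega

/-- A vertex of a hypertree has at most one hyperedge leading towards `t`. -/
theorem eq_of_closer (hV : V(H) = Set.univ)
    (hC : (H.induce C.supp).IsHypertree) (ht : t ∈ C.supp) {e₁ e₂ : Set V} (he₁ : e₁ ∈ E(H))
    (he₂ : e₂ ∈ E(H)) {v w₁ w₂ : V} (hvC : v ∈ C.supp) (hv₁ : v ∈ e₁) (hv₂ : v ∈ e₂)
    (hw₁ : w₁ ∈ e₁) (hw₂ : w₂ ∈ e₂) (h₁ : H.primalGraph.dist w₁ t < H.primalGraph.dist v t)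
    (h₂ : H.primalGraph.dist w₂ t < H.primalGraph.dist v t) : e₁ = e₂ := by
  ext x
  by_contra hx
  have hxC : x ∈ C.supp := by
    by_cases h : x ∈ e₁
    · exact subset_supp_of_mem he₁ hv₁ hvC h
    · exact subset_supp_of_mem he₂ hv₂ hvC (by tauto)
  obtain ⟨S, hSC, hFS, g, hg⟩ := exists_induce_descent hV hC ht (F := {v, w₁, w₂, x})
    (by simp) (by
      rintro y (rfl | rfl | rfl | rfl)
      exacts [hvC, subset_supp_of_mem he₁ hv₁ hvC hw₁, subset_supp_of_mem he₂ hv₂ hvC hw₂, hxC])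
  -- The trace on `S` of a hyperedge leading from `v` towards `t` is the value `g v`, so the two
  -- traces agree, although `x` lies in `S` and in only one of the two hyperedges.
  have key : ∀ e ∈ E(H), v ∈ e → ∀ w ∈ e, w ∈ S →
      H.primalGraph.dist w t < H.primalGraph.dist v t → g v = e ∩ S := by
    intro e he hv w hw hwS hd
    have hvS : v ∈ S := hFS (by simp)
    obtain ⟨m, hm, hmin⟩ := hg (e ∩ S) ⟨⟨v, ⟨hv, hvS⟩, w, ⟨hw, hwS⟩, by
      rintro rfl; exact lt_irrefl _ hd⟩, e, he, rfl⟩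
    refine (hmin v ⟨hv, hvS⟩ ?_).2
    rintro rfl
    by_cases hwv : w = v
    · subst hwv; exact lt_irrefl _ hd
    · exact lt_asymm hd (hmin w ⟨hw, hwS⟩ hwv).1
  have h := (key e₁ he₁ hv₁ w₁ hw₁ (hFS (by simp)) h₁).symm.trans
    (key e₂ he₂ hv₂ w₂ hw₂ (hFS (by simp)) h₂)
  have hxS : x ∈ S := hFS (by simp)
  have := Set.ext_iff.1 h x
  simp only [Set.mem_inter_iff, hxS, and_true] at this
  exact hx this

end Component

end Hypergraph

/-! ### Parent systems and the geodesics of their hypergraphs -/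

variable {V : Type*}

/-- A rooted forest of hyperedges, possibly with infinite ascending paths: `p v` is the parent of
`v`, and `c v` is the set of vertices of the hyperedge joining `v` to its parent, other than the
parent. -/
structure ParentSystem (r : V) (p : V → V) (c : V → Set V) : Prop where
  root : p r = r
  mem_self : ∀ {v}, v ≠ r → v ∈ c v
  of_mem : ∀ {v w}, v ≠ r → w ∈ c v → w ≠ r ∧ c w = c v ∧ p w = p v
  acyclic : ∀ {v n}, v ≠ r → 0 < n → p^[n] v ≠ v

namespace ParentSystem

/-- The hyperedges of a parent system, each one paired with the parent. -/
def markedEdges (r : V) (p : V → V) (c : V → Set V) : Set (Set V × V) :=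
  {q | ∃ v ≠ r, q = (insert (p v) (c v), p v)}

/-- The hyperedges of a parent system. -/
def edges (r : V) (p : V → V) (c : V → Set V) : Set (Set V) :=
  {e | ∃ v ≠ r, e = insert (p v) (c v)}

variable {r : V} {p : V → V} {c : V → Set V}

theorem image_fst_markedEdges : Prod.fst '' markedEdges r p c = edges r p c := by
  ext e
  constructor
  · rintro ⟨_, ⟨v, hv, rfl⟩, rfl⟩
    exact ⟨v, hv, rfl⟩
  · rintro ⟨v, hv, rfl⟩
    exact ⟨_, ⟨v, hv, rfl⟩, rfl⟩

theorem parent_ne (h : ParentSystem r p c) {v : V} (hv : v ≠ r) : p v ≠ v :=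
  h.acyclic (n := 1) hv one_pos

theorem iterate_root (h : ParentSystem r p c) (n : ℕ) : p^[n] r = r :=
  Function.iterate_fixed h.root n

theorem parent_notMem (h : ParentSystem r p c) {v : V} (hv : v ≠ r) : p v ∉ c v := by
  intro hm
  obtain ⟨h1, -, h3⟩ := h.of_mem hv hm
  exact h.parent_ne h1 h3

theorem iterate_succ_of_mem (h : ParentSystem r p c) {u v : V} (hv : v ≠ r) (hu : u ∈ c v) (n : ℕ) :
    p^[n + 1] u = p^[n + 1] v := by
  rw [Function.iterate_succ_apply, Function.iterate_succ_apply, (h.of_mem hv hu).2.2]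

section Graph

variable {H : Hypergraph V} (h : ParentSystem r p c) (hE : E(H) = edges r p c)
include h hE

local notation "G" => Hypergraph.primalGraph H

theorem adj_cases {x y : V} (hxy : (G).Adj x y) :
    (x ≠ r ∧ p x = y) ∨ (y ≠ r ∧ p y = x) ∨ (x ≠ r ∧ y ≠ r ∧ y ∈ c x) := by
  obtain ⟨hne, e, he, hx, hy⟩ := hxy
  rw [hE] at he
  obtain ⟨v, hv, rfl⟩ := he
  rcases hx with rfl | hx
  · rcases hy with rfl | hy
    · exact (hne rfl).elim
    · obtain ⟨h1, -, h3⟩ := h.of_mem hv hy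
      exact Or.inr (Or.inl ⟨h1, h3⟩)
  · obtain ⟨h1, h2, h3⟩ := h.of_mem hv hx
    rcases hy with rfl | hy
    · exact Or.inl ⟨h1, h3⟩
    · exact Or.inr (Or.inr ⟨h1, (h.of_mem hv hy).1, h2 ▸ hy⟩)

theorem adj_parent {x : V} (hx : x ≠ r) : (G).Adj x (p x) :=
  ⟨(h.parent_ne hx).symm, _, by rw [hE]; exact ⟨x, hx, rfl⟩, Set.mem_insert_of_mem _ (h.mem_self hx),
    Set.mem_insert _ _⟩

theorem adj_of_mem {x y : V} (hx : x ≠ r) (hy : y ∈ c x) (hne : x ≠ y) : (G).Adj x y :=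
  ⟨hne, _, by rw [hE]; exact ⟨x, hx, rfl⟩, Set.mem_insert_of_mem _ (h.mem_self hx),
    Set.mem_insert_of_mem _ hy⟩

theorem reachable_parent (x : V) : (G).Reachable x (p x) := by
  by_cases hx : x = r
  · rw [hx, h.root]
  · exact (h.adj_parent hE hx).reachable

theorem reachable_iterate (x : V) (n : ℕ) : (G).Reachable x (p^[n] x) := by
  induction n with
  | zero => rfl
  | succ n ih =>
    rw [Function.iterate_succ_apply']
    exact ih.trans (h.reachable_parent hE _)

theorem exists_iterate_eq {x y : V} (hxy : (G).Reachable x y) :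
    ∃ s t, p^[s] x = p^[t] y := by
  obtain ⟨w⟩ := hxy
  induction w with
  | nil => exact ⟨0, 0, rfl⟩
  | cons ha w ih =>
    rename_i a b d
    obtain ⟨s, t, hst⟩ := ih
    obtain ⟨s', t', h'⟩ : ∃ s t, p^[s] a = p^[t] b := by
      rcases h.adj_cases hE ha with h1 | h1 | h1
      · exact ⟨1, 0, h1.2⟩
      · exact ⟨0, 1, h1.2.symm⟩
      · exact ⟨1, 1, (h.of_mem h1.1 h1.2.2).2.2.symm⟩
    refine ⟨s + s', t' + t, ?_⟩
    rw [Function.iterate_add_apply, h', ← Function.iterate_add_apply, add_comm s t',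
      Function.iterate_add_apply, hst, ← Function.iterate_add_apply]

/-- Being at relative level `k` above `x` is unstable by at most one along a hyperedge. -/
theorem level_adj {x y z : V} {s t : ℕ} (hyz : (G).Adj y z) (hst : p^[s] y = p^[t] x) :
    ∃ s' t' : ℕ, p^[s'] z = p^[t'] x ∧ s' + t ≤ s + t' + 1 ∧ s + t' ≤ s' + t + 1 := by
  rcases h.adj_cases hE hyz with h1 | h1 | h1
  · refine ⟨s, t + 1, ?_, by omega, by omega⟩
    rw [← h1.2, ← Function.iterate_succ_apply, Function.iterate_succ_apply', hst,
      ← Function.iterate_succ_apply' p]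
  · refine ⟨s + 1, t, ?_, by omega, by omega⟩
    rw [Function.iterate_succ_apply, h1.2, hst]
  · refine ⟨s + 1, t + 1, ?_, by omega, by omega⟩
    rw [h.iterate_succ_of_mem h1.1 h1.2.2, Function.iterate_succ_apply', hst,
      ← Function.iterate_succ_apply' p]

/-- The equation `p^[s] y = p^[t] x` expresses that `y` lies `s - t` generations below `x`, without
subtraction. A step changes this level by at most one, which yields the lower bounds for distances.
-/
theorem level_walk {x y z : V} (w : (G).Walk y z) {s t : ℕ} (hst : p^[s] y = p^[t] x) :
    ∃ s' t' : ℕ, p^[s'] z = p^[t'] x ∧ s' + t ≤ s + t' + w.length ∧ s + t' ≤ s' + t + w.length := by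
  induction w generalizing s t with
  | nil => exact ⟨s, t, hst, by simp, by simp⟩
  | cons ha w ih =>
    obtain ⟨s₁, t₁, h1, h2, h3⟩ := h.level_adj hE ha hst
    obtain ⟨s', t', h4, h5, h6⟩ := ih h1
    refine ⟨s', t', h4, ?_, ?_⟩ <;> rw [SimpleGraph.Walk.length_cons] <;> omega

omit hE in
theorem iterate_injective {x : V} (hx : ∀ n, p^[n] x ≠ r) {m n : ℕ} (hmn : p^[m] x = p^[n] x) :
    m = n := by
  wlog hlt : m < n generalizing m n
  · rcases lt_trichotomy m n with h1 | h1 | h1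
    · exact this hmn h1
    · exact h1
    · exact (this hmn.symm h1).symm
  obtain ⟨k, rfl⟩ := Nat.exists_eq_add_of_lt hlt
  rw [add_assoc, add_comm, Function.iterate_add_apply] at hmn
  exact (h.acyclic (hx m) (Nat.succ_pos k) hmn.symm).elim

-- A chain of ancestors that misses the root never repeats, so relative levels are well defined
-- there. In the root component they are not, because `p r = r`; depths replace them.
omit hE in
theorem level_unique {x y : V} (hx : ∀ n, p^[n] x ≠ r) {s t s' t' : ℕ}
    (h1 : p^[s] y = p^[t] x) (h2 : p^[s'] y = p^[t'] x) : s + t' = s' + t := by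
  refine (h.iterate_injective hx (m := s' + t) (n := s + t') ?_).symm
  rw [Function.iterate_add_apply, Function.iterate_add_apply, ← h1, ← h2,
    ← Function.iterate_add_apply, ← Function.iterate_add_apply, add_comm]

theorem edist_iterate_le (x : V) (n : ℕ) : (G).edist x (p^[n] x) ≤ n := by
  induction n with
  | zero => simp
  | succ n ih =>
    refine (SimpleGraph.edist_triangle (v := p^[n] x)).trans ?_
    rw [Nat.cast_succ]
    refine add_le_add ih ?_
    rw [Function.iterate_succ_apply', SimpleGraph.edist_le_one_iff_adj_or_eq]
    by_cases hx : p^[n] x = r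
    · rw [hx, h.root]; exact Or.inr rfl
    · exact Or.inl (h.adj_parent hE hx)

theorem edist_iterate {x : V} (hx : ∀ n, p^[n] x ≠ r) (n : ℕ) : (G).edist x (p^[n] x) = n := by
  refine le_antisymm (h.edist_iterate_le hE x n) ?_
  by_contra hlt
  rw [not_le] at hlt
  obtain ⟨w, hw⟩ := SimpleGraph.exists_walk_of_edist_ne_top (ne_top_of_lt hlt)
  rw [← hw, Nat.cast_lt] at hlt
  obtain ⟨s, t, h1, h2, h3⟩ := h.level_walk hE w (x := x) (s := 0) (t := 0) rfl
  have := h.level_unique hx (y := p^[n] x) (s := 0) (t := n) rfl h1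
  omega

theorem isRay_iterate {x : V} (hx : ∀ n, p^[n] x ≠ r) : H.IsRay fun n => p^[n] x := by
  intro m k
  change (G).edist (p^[m] x) (p^[m + k] x) = k
  rw [add_comm, Function.iterate_add_apply]
  refine h.edist_iterate hE (fun n => ?_) k
  rw [← Function.iterate_add_apply]
  exact hx _

/-- The depth in the component of the root is `1`-Lipschitz. -/
theorem depth_adj {y z : V} {n : ℕ} (hyz : (G).Adj y z) (hn : p^[n] y = r) :
    ∃ n', p^[n'] z = r ∧ n' ≤ n + 1 := by
  rcases h.adj_cases hE hyz with h1 | h1 | h1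
  · refine ⟨n, ?_, by omega⟩
    rw [← h1.2, ← Function.iterate_succ_apply, Function.iterate_succ_apply', hn, h.root]
  · refine ⟨n + 1, ?_, le_rfl⟩
    rw [Function.iterate_succ_apply, h1.2, hn]
  · refine ⟨n + 1, ?_, le_rfl⟩
    rw [h.iterate_succ_of_mem h1.1 h1.2.2, Function.iterate_succ_apply', hn, h.root]

theorem depth_walk {y z : V} (w : (G).Walk y z) {n : ℕ} (hn : p^[n] y = r) :
    ∃ n', p^[n'] z = r ∧ n' ≤ n + w.length := by
  induction w generalizing n with
  | nil => exact ⟨n, hn, by simp⟩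
  | cons ha w ih =>
    obtain ⟨n₁, h1, h3⟩ := h.depth_adj hE ha hn
    obtain ⟨n', h4, h6⟩ := ih h1
    refine ⟨n', h4, ?_⟩
    rw [SimpleGraph.Walk.length_cons]
    omega

theorem edist_root {v : V} {n : ℕ} (hn : p^[n] v = r) (hmin : ∀ m < n, p^[m] v ≠ r) :
    (G).edist v r = n := by
  refine le_antisymm (hn ▸ h.edist_iterate_le hE v n) ?_
  by_contra hlt
  rw [not_le] at hlt
  obtain ⟨w, hw⟩ := SimpleGraph.exists_walk_of_edist_ne_top (ne_top_of_lt hlt)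
  rw [← hw, Nat.cast_lt] at hlt
  obtain ⟨n', h1, h3⟩ := h.depth_walk hE w.reverse (n := 0) rfl
  rw [SimpleGraph.Walk.length_reverse] at h3
  exact hmin n' (by omega) h1

theorem reachable_root_iff {v : V} : (G).Reachable v r ↔ ∃ n, p^[n] v = r := by
  constructor
  · intro hr
    obtain ⟨s, t, hst⟩ := h.exists_iterate_eq hE hr
    exact ⟨s, hst.trans (h.iterate_root t)⟩
  · rintro ⟨n, hn⟩
    exact hn ▸ h.reachable_iterate hE v n

/-- In the component of the root, the parent is closer to the root. -/
theorem edist_parent_lt {v u : V} (hv : v ≠ r) (hr : (G).Reachable v r) (hu : u ∈ c v) :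
    (G).edist (p v) r < (G).edist u r := by
  obtain ⟨h1, h2, h3⟩ := h.of_mem hv hu
  classical
  have hex := (h.reachable_root_iff hE).1 ((h.reachable_parent hE v).symm.trans hr)
  rw [← h3] at hex ⊢
  have e1 := h.edist_root hE (Nat.find_spec hex) (fun m hm => Nat.find_min hex hm)
  have e2 := h.edist_root hE (v := u) (n := Nat.find hex + 1)
    (by rw [Function.iterate_succ_apply]; exact Nat.find_spec hex) (by
      rintro (_ | m) hm
      · exact h1
      · rw [Function.iterate_succ_apply]; exact Nat.find_min hex (by omega))
  rw [e1, e2, Nat.cast_lt]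
  omega

omit h hE in
theorem eq_iterate {γ : ℕ → V} (hγ : ∀ n, γ (n + 1) = p (γ n)) (m n : ℕ) :
    γ (m + n) = p^[m] (γ n) := by
  induction m with
  | zero => simp
  | succ m ih => rw [Nat.succ_add, hγ, ih, Function.iterate_succ_apply']

/-- Outside the component of the root, the parent is eventually closer to the points of an
ascending ray. -/
theorem eventually_edist_parent_lt {v : V} (hv : ∀ n, p^[n] v ≠ r) {γ : ℕ → V}
    (hγ : ∀ n, γ (n + 1) = p (γ n)) (hr : (G).Reachable v (γ 0)) :
    ∀ᶠ n in Filter.atTop, ∀ u ∈ c v, (G).edist (p v) (γ n) < (G).edist u (γ n) := by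
  obtain ⟨s, t, hst⟩ := h.exists_iterate_eq hE hr
  -- From index `t + 1` on, the ray is at or above `p v` on the common chain of ancestors of `v` and
  -- `u`, so both distances count steps upwards.
  filter_upwards [Filter.eventually_ge_atTop (t + 1)] with n hn u hu
  obtain ⟨k, rfl⟩ := Nat.exists_eq_add_of_le hn
  have hv0 : v ≠ r := hv 0
  have e0 : γ (t + 1 + k) = p^[k + s] (p v) := by
    rw [show t + 1 + k = (k + 1) + t + 0 by omega, eq_iterate hγ, Function.iterate_add_apply, ← hst,
      ← Function.iterate_add_apply, ← Function.iterate_succ_apply]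
    congr 1; omega
  have e1 : (G).edist (p v) (γ (t + 1 + k)) = (k + s : ℕ) := by
    rw [e0]
    refine h.edist_iterate hE (fun n => ?_) _
    rw [← Function.iterate_succ_apply]
    exact hv _
  have hu' := h.of_mem hv0 hu
  have e2 : (G).edist u (γ (t + 1 + k)) = (k + s + 1 : ℕ) := by
    rw [e0, ← hu'.2.2, ← Function.iterate_succ_apply]
    refine h.edist_iterate hE (fun n => ?_) _
    rcases n with _ | n
    · exact hu'.1
    · rw [h.iterate_succ_of_mem hv0 hu]; exact hv _
  rw [e1, e2, Nat.cast_lt]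
  omega

/-- A geodesic ray which does not ascend at some time descends at all later times. -/
theorem ray_descends {γ : ℕ → V} (hγ : H.IsRay γ) {N : ℕ} (hN : γ (N + 1) ≠ p (γ N)) :
    ∀ k, γ (N + 1 + k + 1) ≠ r ∧ p (γ (N + 1 + k + 1)) = γ (N + 1 + k) := by
  have hadj : ∀ n, (G).Adj (γ n) (γ (n + 1)) := fun n =>
    SimpleGraph.edist_eq_one_iff_adj.1 (by simpa using hγ n 1)
  have htwo : ∀ n, ¬ ((G).Adj (γ n) (γ (n + 2)) ∨ γ n = γ (n + 2)) := by
    intro n hn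
    rw [← SimpleGraph.edist_le_one_iff_adj_or_eq, hγ n 2] at hn
    exact absurd (Nat.cast_le.1 (show ((2 : ℕ) : ℕ∞) ≤ (1 : ℕ) from hn)) (by norm_num)
  -- After a step that is not upwards, a step upwards or within a reduced hyperedge would create a
  -- shortcut, since siblings and their parent share a hyperedge. Only a step downwards remains.
  have step : ∀ n, γ (n + 1) ≠ p (γ n) →
      γ (n + 2) ≠ r ∧ p (γ (n + 2)) = γ (n + 1) := by
    intro n hn
    rcases h.adj_cases hE (hadj (n + 1)) with h2 | h2 | h2
    · exfalso
      rcases h.adj_cases hE (hadj n) with h1 | h1 | h1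
      · exact hn h1.2.symm
      · exact htwo n (Or.inr (h1.2.symm.trans h2.2))
      · refine htwo n (Or.inl ?_)
        rw [show γ (n + 2) = p (γ n) from h2.2.symm.trans (h.of_mem h1.1 h1.2.2).2.2]
        exact h.adj_parent hE h1.1
    · exact h2
    · exfalso
      rcases h.adj_cases hE (hadj n) with h1 | h1 | h1
      · exact hn h1.2.symm
      · refine htwo n (Or.inl ?_)
        have := h.adj_parent hE h2.2.1
        rw [(h.of_mem h2.1 h2.2.2).2.2, h1.2] at this
        exact this.symm
      · by_cases hne : γ n = γ (n + 2)
        · exact htwo n (Or.inr hne)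
        · refine htwo n (Or.inl (h.adj_of_mem hE h1.1 ?_ hne))
          rw [← (h.of_mem h1.1 h1.2.2).2.1]
          exact h2.2.2
  intro k
  induction k with
  | zero => exact step N hN
  | succ k ih =>
    -- Having just descended, the ray cannot have ascended on the same step: that would be a cycle
    -- of length two.
    refine step (N + 1 + k) fun h' => ?_
    apply h.acyclic (n := 2) ih.1 two_pos
    change p (p (γ (N + 1 + k + 1))) = _
    rw [ih.2]
    exact h'.symm.trans (by congr 1)

/-- A geodesic ray equivalent to an ascending ray ascends. -/
theorem ascends_of_rayEquiv {x : V} (hx : ∀ n, p^[n] x ≠ r) {γ : ℕ → V} (hγ : H.IsRay γ)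
    (heq : H.RayEquiv (fun n => p^[n] x) γ) (n : ℕ) : γ (n + 1) = p (γ n) := by
  by_contra hN
  have hdesc := h.ray_descends hE hγ hN
  obtain ⟨d, hd⟩ := heq
  rw [Filter.eventually_atTop] at hd
  obtain ⟨K, hK⟩ := hd
  have key : ∀ m ≥ K, ∃ s t : ℕ, p^[s] (γ m) = p^[t] x ∧ s + m ≤ t + d ∧ t ≤ s + m + d := by
    intro m hm
    obtain ⟨w, hw⟩ := SimpleGraph.exists_walk_of_edist_eq_coe (hK m hm)
    obtain ⟨s, t, h1, h2, h3⟩ := h.level_walk hE w (x := x) (s := 0) (t := m) rfl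
    exact ⟨s, t, h1, by omega, by omega⟩
  have hit : ∀ k, ∀ m, p^[k] (γ (n + 1 + m + k)) = γ (n + 1 + m) := by
    intro k
    induction k with
    | zero => exact fun m => rfl
    | succ k ih =>
      intro m
      rw [Function.iterate_succ_apply, ← ih m]
      congr 1
      have := (hdesc (m + k)).2
      rw [← add_assoc (n + 1)] at this
      exact this
  obtain ⟨s, t, h1, h2, h3⟩ := key (n + 1 + K) (by omega)
  -- During `2 * d + 1` further steps `γ` goes down and the ascending ray goes up by that amount, so
  -- their level difference changes by `4 * d + 2`; bounded by `d` at both times, it can change by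
  -- at most `2 * d`.
  obtain ⟨s', t', h4, h5, h6⟩ := key (n + 1 + K + (2 * d + 1)) (by omega)
  have h7 : p^[s + (2 * d + 1)] (γ (n + 1 + K + (2 * d + 1))) = p^[t] x := by
    rw [Function.iterate_add_apply, hit, h1]
  have := h.level_unique hx h7 h4
  omega

/-- The class of an ascending ray consists of the ascending rays in the same component. -/
theorem rayEquiv_iff {x : V} (hx : ∀ n, p^[n] x ≠ r) {γ : ℕ → V} :
    (H.IsRay γ ∧ H.RayEquiv (fun n => p^[n] x) γ) ↔
      (∀ n, γ (n + 1) = p (γ n)) ∧ (G).Reachable x (γ 0) := by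
  constructor
  · rintro ⟨h1, h2⟩
    have h3 := h.ascends_of_rayEquiv hE hx h1 h2
    refine ⟨h3, ?_⟩
    obtain ⟨d, hd⟩ := h2
    obtain ⟨n, hn⟩ := hd.exists
    have h4 : (G).Reachable (p^[n] x) (γ n) :=
      SimpleGraph.reachable_of_edist_ne_top (by rw [hn]; exact ENat.natCast_ne_top d)
    refine (h.reachable_iterate hE x n).trans (h4.trans ?_)
    have := eq_iterate h3 n 0
    rw [add_zero] at this
    rw [this]
    exact (h.reachable_iterate hE _ n).symm
  · rintro ⟨h1, h2⟩
    obtain ⟨s, t, hst⟩ := h.exists_iterate_eq hE h2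
    have hγ : ∀ n, γ n = p^[n] (γ 0) := fun n => by simpa using eq_iterate h1 n 0
    have hfree : ∀ n, p^[n] (γ 0) ≠ r := by
      intro n hn
      refine hx (n + s) ?_
      rw [Function.iterate_add_apply, hst, ← Function.iterate_add_apply, add_comm,
        Function.iterate_add_apply, hn, h.iterate_root]
    have hray : H.IsRay γ := by
      rw [show γ = fun n => p^[n] (γ 0) from funext hγ]
      exact h.isRay_iterate hE hfree
    refine ⟨hray, ?_⟩
    have hm : ∀ n, p^[n + s] x = γ (n + t) := by
      intro n
      rw [Function.iterate_add_apply, hst, ← Function.iterate_add_apply]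
      exact (hγ _).symm
    -- Beyond the meeting point both rays run through the same ancestors with indices shifted by the
    -- difference of `s` and `t`; this shift is the constant distance.
    rcases le_total s t with hle | hle
    · obtain ⟨d, rfl⟩ := Nat.exists_eq_add_of_le hle
      refine ⟨d, Filter.eventually_atTop.2 ⟨s + d, fun n hn => ?_⟩⟩
      obtain ⟨k, rfl⟩ := Nat.exists_eq_add_of_le hn
      have e1 : γ (s + d + k) = p^[k + s] x := by rw [hm]; congr 1; omega
      rw [e1, show s + d + k = k + s + d by omega, SimpleGraph.edist_comm]
      exact h.isRay_iterate hE hx (k + s) d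
    · obtain ⟨d, rfl⟩ := Nat.exists_eq_add_of_le hle
      refine ⟨d, Filter.eventually_atTop.2 ⟨t + d, fun n hn => ?_⟩⟩
      obtain ⟨k, rfl⟩ := Nat.exists_eq_add_of_le hn
      have e1 : p^[t + d + k] x = γ (k + t) := by rw [← hm]; congr 1; omega
      change (G).edist (p^[t + d + k] x) _ = _
      rw [e1, show t + d + k = k + t + d by omega]
      exact hray (k + t) d

end Graph

end ParentSystem

/-! ### Closest vertices as seen from the root or along a ray -/

namespace Hypergraph

/-- A sequence in `C` moving away from each of its points at speed `s`. -/
def IsTarget (H : Hypergraph V) (C : H.primalGraph.ConnectedComponent) (s : ℕ) (τ : ℕ → V) : Prop :=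
  (∀ n, τ n ∈ C.supp) ∧ ∀ m k, H.primalGraph.dist (τ m) (τ (m + k)) = s * k

section Target

variable {H : Hypergraph V} {C : H.primalGraph.ConnectedComponent} {s : ℕ} {τ : ℕ → V}

theorem IsTarget.dist_le (hτ : H.IsTarget C s τ) {v : V} (hv : v ∈ C.supp) (n k : ℕ) :
    H.primalGraph.dist v (τ (n + k)) ≤ H.primalGraph.dist v (τ n) + s * k := by
  rw [← hτ.2 n k]
  exact (C.reachable_of_mem_supp hv (hτ.1 n)).dist_triangle_left _

/-- The quantity `dist v (τ n) - s * n` (a Busemann function) is non-increasing in `n` and bounded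
below by `-dist v (τ 0)`, hence finally constant. Adding `dist v (τ 0)` keeps it a natural number.
-/
theorem IsTarget.exists_stable (hτ : H.IsTarget C s τ) {v : V} (hv : v ∈ C.supp) :
    ∃ N, ∀ k, H.primalGraph.dist v (τ (N + k)) = H.primalGraph.dist v (τ N) + s * k := by
  have hlow : ∀ n, s * n ≤ H.primalGraph.dist v (τ n) + H.primalGraph.dist v (τ 0) := by
    intro n
    have h1 := hτ.2 0 n
    rw [zero_add] at h1
    have h2 := (C.reachable_of_mem_supp (hτ.1 0) hv).dist_triangle_left (τ n)
    rw [h1, SimpleGraph.dist_comm] at h2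
    omega
  let f : ℕ → ℕ := fun n => H.primalGraph.dist v (τ n) + H.primalGraph.dist v (τ 0) - s * n
  have hwf := (measure f).wf
  let N := hwf.min Set.univ Set.univ_nonempty
  refine ⟨N, fun k => le_antisymm (hτ.dist_le hv N k) ?_⟩
  have h1 : f N ≤ f (N + k) := not_lt.1 (hwf.not_lt_min Set.univ (Set.mem_univ (N + k)))
  have h2 := hlow N
  have h3 := hlow (N + k)
  have h4 : s * (N + k) = s * N + s * k := mul_add _ _ _
  simp only [f] at h1
  omega

theorem dist_le_succ_of_mem {e : Set V} (he : e ∈ E(H)) {u w : V} (hu : u ∈ e)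
    (hw : w ∈ e) (t : V) : H.primalGraph.dist u t ≤ H.primalGraph.dist w t + 1 := by
  by_cases huw : u = w
  · subst huw; omega
  · have h1 : H.primalGraph.Adj u w := ⟨huw, e, he, hu, hw⟩
    have h2 := h1.reachable.dist_triangle_left t
    rw [SimpleGraph.dist_eq_one_iff_adj.2 h1] at h2
    omega

/-- The closest vertex stabilises even if `e` is infinite. Compare with a vertex `u` whose distance
to the target already grows at speed exactly `s`: a vertex that is once nearer than `u` stays
nearer, as it recedes at speed at most `s`, and no vertex of `e` is nearer than `u` by two. -/
theorem IsTarget.exists_eventually_closest (hτ : H.IsTarget C s τ) (hV : V(H) = Set.univ)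
    (hloop : H.Loopless) (hC : (H.induce C.supp).IsHypertree) {e : Set V} (he : e ∈ E(H))
    (heC : e ⊆ C.supp) : ∃ w ∈ e, ∀ᶠ n in Filter.atTop, ∀ u ∈ e, u ≠ w →
      H.primalGraph.dist w (τ n) < H.primalGraph.dist u (τ n) := by
  choose m hme hm using fun n => exists_closest hV hloop hC (hτ.1 n) he heC
  obtain ⟨u, hu⟩ := (hloop e he).nonempty
  obtain ⟨N, hN⟩ := hτ.exists_stable (heC hu)
  by_cases hex : ∃ n₀ ≥ N, m n₀ ≠ u
  · obtain ⟨n₀, hn₀, hne⟩ := hex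
    refine ⟨m n₀, hme n₀, Filter.eventually_atTop.2 ⟨n₀, fun n hn x hx hxm => ?_⟩⟩
    obtain ⟨k, rfl⟩ := Nat.exists_eq_add_of_le hn₀
    obtain ⟨l, rfl⟩ := Nat.exists_eq_add_of_le hn
    have h1 := hm _ u hu (Ne.symm hne)
    have h2 := hτ.dist_le (heC (hme (N + k))) (N + k) l
    have h3 := hN k
    have h4 := hN (k + l)
    rw [← add_assoc, mul_add] at h4
    suffices hml : m (N + k + l) = m (N + k) by
      have := hm (N + k + l) x hx (by rw [hml]; exact hxm)
      rwa [hml] at this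
    by_contra hml
    have h5 := hm (N + k + l) (m (N + k)) (hme _) (Ne.symm hml)
    have h6 := dist_le_succ_of_mem he hu (hme (N + k + l)) (τ (N + k + l))
    omega
  · push Not at hex
    refine ⟨u, hu, Filter.eventually_atTop.2 ⟨N, fun n hn x hx hxu => ?_⟩⟩
    have := hm n x hx (by rw [hex n hn]; exact hxu)
    rwa [hex n hn] at this

/-- Some hyperedge at `v` leads towards the target. -/
theorem IsTarget.exists_descending (hτ : H.IsTarget C s τ) {v : V} (hv : v ∈ C.supp)
    (hne : ∀ n, ∃ k, v ≠ τ (n + k)) : ∃ e ∈ E(H), v ∈ e ∧ ∃ w ∈ e, ∀ᶠ n in Filter.atTop,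
      H.primalGraph.dist w (τ n) < H.primalGraph.dist v (τ n) := by
  obtain ⟨N, hN⟩ := hτ.exists_stable hv
  obtain ⟨k, hk⟩ := hne N
  obtain ⟨w, hvw, hd⟩ := (C.reachable_of_mem_supp hv (hτ.1 (N + k))).exists_adj_dist_lt hk
  obtain ⟨-, e, he, h1, h2⟩ := id hvw
  refine ⟨e, he, h1, w, h2, Filter.eventually_atTop.2 ⟨N + k, fun n hn => ?_⟩⟩
  obtain ⟨l, rfl⟩ := Nat.exists_eq_add_of_le hn
  have h3 := hτ.dist_le ((C.mem_supp_congr_adj hvw).1 hv) (N + k) l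
  have h4 := hN k
  have h5 := hN (k + l)
  rw [← add_assoc, mul_add] at h5
  omega

end Target

end Hypergraph

/-! ### From ideally rooted hypertrees to parent systems -/

namespace IdeallyRootedHypertree

variable {r : V}

/-- The root or a ray of the marked end, as a target in each component. -/
theorem exists_target (T : IdeallyRootedHypertree V r)
    (C : T.toHypergraph.primalGraph.ConnectedComponent) :
    ∃ (s : ℕ) (τ : ℕ → V), T.toHypergraph.IsTarget C s τ ∧ (r ∈ C.supp → ∀ n, τ n = r) ∧
      ∀ hC : r ∉ C.supp, T.toHypergraph.IsRay τ ∧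
        T.markedEnd C hC = {γ | T.toHypergraph.IsRay γ ∧ T.toHypergraph.RayEquiv τ γ} := by
  by_cases hr : r ∈ C.supp
  -- Speed `0` describes the constant sequence at the root and speed `1` a geodesic ray, so both
  -- kinds of component are treated together.
  · exact ⟨0, fun _ => r, ⟨fun _ => hr, fun _ _ => by simp⟩, fun _ _ => rfl, fun h => (h hr).elim⟩
  · obtain ⟨γ, h1, h2, h3⟩ := T.isEndOf C hr
    refine ⟨1, γ, ⟨h2, fun m k => ?_⟩, fun h => (hr h).elim, fun _ => ⟨h1, h3⟩⟩
    have h4 := (C.reachable_of_mem_supp (h2 m) (h2 (m + k))).coe_dist_eq_edist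
    rw [h1 m k, Nat.cast_inj] at h4
    rw [h4, one_mul]

theorem rayEquiv_refl (H : Hypergraph V) (γ : ℕ → V) : H.RayEquiv γ γ :=
  ⟨0, Filter.Eventually.of_forall fun _ => by simp⟩

theorem markedVertex_unique (T : IdeallyRootedHypertree V r) {e : Set V}
    (he : e ∈ E(T.toHypergraph)) {w w' : V} (hw : T.IsMarkedVertex e w)
    (hw' : T.IsMarkedVertex e w') : w = w' := by
  by_contra hne
  let C := T.toHypergraph.primalGraph.connectedComponentMk w
  have heC : e ⊆ C.supp := Hypergraph.subset_supp_of_mem he hw.1 rfl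
  obtain ⟨h1, h2⟩ := hw.2 C heC
  obtain ⟨h1', h2'⟩ := hw'.2 C heC
  by_cases hr : r ∈ C.supp
  · exact lt_asymm (h1 hr w' hw'.1 (Ne.symm hne)) (h1' hr w hw.1 hne)
  · obtain ⟨s, τ, -, -, hτ⟩ := T.exists_target C
    obtain ⟨h3, h4⟩ := hτ hr
    have h5 : τ ∈ T.markedEnd C hr := by rw [h4]; exact ⟨h3, rayEquiv_refl _ _⟩
    obtain ⟨n, h6, h7⟩ := ((h2 hr τ h5).and (h2' hr τ h5)).exists
    exact lt_asymm (h6 w' hw'.1 (Ne.symm hne)) (h7 w hw.1 hne)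

/-- The marked hyperedges of an ideally rooted hypertree come from a parent system. -/
theorem exists_parentSystem (T : IdeallyRootedHypertree V r) :
    ∃ (p : V → V) (c : V → Set V), ParentSystem r p c ∧
      T.markedEdges = ParentSystem.markedEdges r p c ∧
      E(T.toHypergraph) = ParentSystem.edges r p c := by
  classical
  set H := T.toHypergraph with hH
  have hV : V(H) = Set.univ := T.vertexSet_eq
  choose s τ hτ hτr hτe using T.exists_target
  let K : V → H.primalGraph.ConnectedComponent := H.primalGraph.connectedComponentMk
  have hK : ∀ v, v ∈ (K v).supp := fun v => rfl
  have heK : ∀ e ∈ E(H), ∀ v ∈ e, e ⊆ (K v).supp := fun e he v hv =>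
    Hypergraph.subset_supp_of_mem he hv rfl
  have hmk : ∀ e, ∃ w, e ∈ E(H) → w ∈ e ∧ ∀ᶠ n in Filter.atTop, ∀ u ∈ e, u ≠ w →
      H.primalGraph.dist w (τ (K w) n) < H.primalGraph.dist u (τ (K w) n) := by
    intro e
    by_cases he : e ∈ E(H)
    · obtain ⟨v, hv⟩ := (T.loopless e he).nonempty
      obtain ⟨w, hw, hw'⟩ := (hτ (K v)).exists_eventually_closest hV T.loopless
        (T.isHypertree (K v)) he (heK e he v hv)
      refine ⟨w, fun _ => ⟨hw, ?_⟩⟩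
      rwa [show K w = K v from heK e he v hv hw]
    · exact ⟨r, fun h => (he h).elim⟩
  choose mk hmk using hmk
  have hroot : ∀ e ∈ E(H), r ∈ e → mk e = r := by
    intro e he hre
    by_contra hne
    obtain ⟨h1, h2⟩ := hmk e he
    obtain ⟨n, hn⟩ := h2.exists
    have h3 := hn r hre (Ne.symm hne)
    rw [hτr _ (heK e he _ h1 hre), SimpleGraph.dist_self] at h3
    omega
  have hclose : ∀ e ∈ E(H), ∀ u ∈ e, u ≠ mk e → K (mk e) = K u ∧
      ∀ᶠ n in Filter.atTop, H.primalGraph.dist (mk e) (τ (K u) n)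
        < H.primalGraph.dist u (τ (K u) n) := by
    intro e he u hu hne
    obtain ⟨h1, h2⟩ := hmk e he
    have h3 : K (mk e) = K u := heK e he u hu h1
    rw [h3] at h2
    exact ⟨h3, h2.mono fun n hn => hn u hu hne⟩
  have huniq : ∀ e₁ ∈ E(H), ∀ e₂ ∈ E(H), ∀ v, v ∈ e₁ → v ∈ e₂ → v ≠ mk e₁ → v ≠ mk e₂ →
      e₁ = e₂ := by
    intro e₁ he₁ e₂ he₂ v hv₁ hv₂ hn₁ hn₂
    obtain ⟨n, h1, h2⟩ := ((hclose e₁ he₁ v hv₁ hn₁).2.and (hclose e₂ he₂ v hv₂ hn₂).2).exists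
    exact Hypergraph.eq_of_closer hV (T.isHypertree (K v)) ((hτ (K v)).1 n) he₁ he₂ (hK v) hv₁ hv₂
      (hmk e₁ he₁).1 (hmk e₂ he₂).1 h1 h2
  have hex : ∀ v, ∃ e, v ≠ r → e ∈ E(H) ∧ v ∈ e ∧ v ≠ mk e := by
    intro v
    by_cases hv : v = r
    · exact ⟨∅, fun h => (h hv).elim⟩
    obtain ⟨e, he, hve, w, hwe, hw⟩ := (hτ (K v)).exists_descending (hK v) (by
      intro n
      by_cases hr : r ∈ (K v).supp
      · exact ⟨0, by rw [hτr _ hr]; exact hv⟩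
      · by_contra hall
        push Not at hall
        have h1 := (hτe (K v) hr).1 n 1
        have h2 := hall 0
        rw [add_zero] at h2
        rw [← hall 1, ← h2, SimpleGraph.edist_self] at h1
        simp at h1)
    refine ⟨e, fun _ => ⟨he, hve, ?_⟩⟩
    intro hvm
    obtain ⟨n, h1, h2⟩ := (hw.and (hvm ▸ (hmk e he).2)).exists
    by_cases hwv : w = v
    · subst hwv; exact lt_irrefl _ h1
    · exact lt_asymm h1 (h2 w hwe hwv)
  choose ed hed using hex
  let p : V → V := fun v => if v = r then r else mk (ed v)
  let c : V → Set V := fun v => ed v \ {mk (ed v)}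
  have hp : ∀ v, v ≠ r → p v = mk (ed v) := fun v hv => if_neg hv
  have hpr : p r = r := if_pos rfl
  have hpc : ∀ v, v ≠ r → insert (p v) (c v) = ed v := by
    intro v hv
    rw [hp v hv]
    exact Set.insert_sdiff_self_of_mem (hmk _ (hed v hv).1).1
  -- Each passage to a parent is finally a strict approach to the target of the component, so an
  -- iterate distinct from the root cannot return to its starting point.
  have hiter : ∀ v, v ≠ r → ∀ k, p^[k + 1] v = r ∨ K (p^[k + 1] v) = K v ∧
      ∀ᶠ n in Filter.atTop, H.primalGraph.dist (p^[k + 1] v) (τ (K v) n)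
        < H.primalGraph.dist v (τ (K v) n) := by
    intro v hv k
    have hstep : ∀ x, x ≠ r → K (p x) = K x ∧ ∀ᶠ n in Filter.atTop,
        H.primalGraph.dist (p x) (τ (K x) n) < H.primalGraph.dist x (τ (K x) n) := by
      intro x hx
      rw [hp x hx]
      exact hclose _ (hed x hx).1 x (hed x hx).2.1 (hed x hx).2.2
    induction k with
    | zero => exact Or.inr (hstep v hv)
    | succ k ih =>
      rw [Function.iterate_succ_apply']
      obtain ih | ⟨h1, h2⟩ := ih
      · exact Or.inl (by rw [ih, hpr])
      · by_cases hx : p^[k + 1] v = r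
        · exact Or.inl (by rw [hx, hpr])
        · obtain ⟨h3, h4⟩ := hstep _ hx
          rw [h1] at h3 h4
          refine Or.inr ⟨h3, ?_⟩
          filter_upwards [h2, h4] with n h5 h6 using h6.trans h5
  have hPS : ParentSystem r p c := by
    refine ⟨hpr, fun {v} hv => ⟨(hed v hv).2.1, (hed v hv).2.2⟩, fun {v w} hv hw => ?_,
      fun {v n} hv hn => ?_⟩
    · have hwr : w ≠ r := by
        rintro rfl
        exact hw.2 (hroot _ (hed v hv).1 hw.1).symm
      have hee : ed w = ed v := huniq _ (hed w hwr).1 _ (hed v hv).1 w (hed w hwr).2.1 hw.1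
        (hed w hwr).2.2 hw.2
      exact ⟨hwr, by simp only [c, hee], by rw [hp w hwr, hp v hv, hee]⟩
    · obtain ⟨k, rfl⟩ := Nat.exists_eq_succ_of_ne_zero hn.ne'
      intro heq
      obtain h1 | ⟨-, h1⟩ := hiter v hv k
      · exact hv (heq.symm.trans h1)
      · obtain ⟨n, h2⟩ := h1.exists
        rw [heq] at h2
        exact lt_irrefl _ h2
  have hedge : ∀ e, e ∈ E(H) ↔ ∃ v ≠ r, e = ed v := by
    intro e
    constructor
    · intro he
      obtain ⟨v, hv, hvm⟩ := (T.loopless e he).exists_ne (mk e)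
      have hvr : v ≠ r := by
        rintro rfl
        exact hvm (hroot e he hv).symm
      exact ⟨v, hvr, huniq _ he _ (hed v hvr).1 v hv (hed v hvr).2.1 hvm (hed v hvr).2.2⟩
    · rintro ⟨v, hv, rfl⟩
      exact (hed v hv).1
  have hEE : E(H) = ParentSystem.edges r p c := by
    ext e
    rw [hedge e]
    constructor
    · rintro ⟨v, hv, rfl⟩
      exact ⟨v, hv, (hpc v hv).symm⟩
    · rintro ⟨v, hv, rfl⟩
      exact ⟨v, hv, hpc v hv⟩
  -- Marked vertices were computed along the single ray `τ C`, while the definition asks for every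
  -- ray of the end. The parent system now at hand identifies these as the ascending rays.
  have hmark : ∀ v, v ≠ r → T.IsMarkedVertex (ed v) (p v) := by
    intro v hv
    rw [hp v hv]
    obtain ⟨h1, h2, h3⟩ := hed v hv
    obtain ⟨h4, h5⟩ := hmk _ h1
    refine ⟨h4, fun C hC => ?_⟩
    have hCK : K (mk (ed v)) = C := hC h4
    rw [hCK] at h5
    refine ⟨fun hr u hu hne => ?_, fun hr γ hγ => ?_⟩
    · obtain ⟨n, hn⟩ := h5.exists
      have h6 := hn u hu hne
      rw [hτr C hr] at h6
      rwa [← (C.reachable_of_mem_supp (hC h4) hr).coe_dist_eq_edist,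
        ← (C.reachable_of_mem_supp (hC hu) hr).coe_dist_eq_edist, Nat.cast_lt]
    · have hfree : ∀ x ∈ C.supp, ∀ n, p^[n] x ≠ r := by
        intro x hx n hn
        have := hPS.reachable_iterate hEE x n
        rw [hn] at this
        apply hr
        rw [SimpleGraph.ConnectedComponent.mem_supp_iff] at hx ⊢
        rw [← hx]
        exact SimpleGraph.ConnectedComponent.eq.2 this.symm
      obtain ⟨hray, hend⟩ := hτe C hr
      -- Otherwise the ray descends from `τ C (n + 1)` to the next vertex, whose parent is then `τ C
      -- (n + 1)`. This parent should finally be nearer to the ray, but the ray is moving away from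
      -- it.
      have hτasc : ∀ n, τ C (n + 1) = p (τ C n) := by
        intro n
        by_contra hn
        obtain ⟨h6, h7⟩ := hPS.ray_descends hEE hray hn 0
        obtain h8 | ⟨-, h8⟩ := hiter _ h6 0
        · rw [zero_add, Function.iterate_one, h7] at h8
          exact hfree _ ((hτ C).1 (n + 1)) 0 h8
        · rw [zero_add, Function.iterate_one, h7,
            show K (τ C (n + 1 + 0 + 1)) = C from (hτ C).1 _] at h8
          rw [Filter.eventually_atTop] at h8
          obtain ⟨N, hN⟩ := h8
          have h9 := hN (n + 1 + 1 + N) (by omega)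
          have h10 := (hτ C).2 (n + 1 + 1) N
          have h11 := (hτ C).2 (n + 1) (1 + N)
          rw [← add_assoc] at h11
          simp only [add_zero] at h9
          rw [h10, h11] at h9
          exact absurd (Nat.mul_le_mul_left (s C) (show N ≤ 1 + N by omega)) (by omega)
      have hτit : τ C = fun n => p^[n] (τ C 0) :=
        funext fun n => by simpa using ParentSystem.eq_iterate hτasc n 0
      rw [hend, hτit, Set.mem_ofPred_eq, hPS.rayEquiv_iff hEE (hfree _ ((hτ C).1 0))] at hγ
      have hvC : v ∈ C.supp := hC h2
      filter_upwards [hPS.eventually_edist_parent_lt hEE (hfree v hvC) hγ.1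
        ((C.reachable_of_mem_supp hvC ((hτ C).1 0)).trans hγ.2)] with n hn u hu hne
      rw [hp v hv] at hn
      exact hn u ⟨hu, hne⟩
  refine ⟨p, c, hPS, ?_, hEE⟩
  ext ⟨e, w⟩
  constructor
  · rintro ⟨h1, h2⟩
    obtain ⟨v, hv, rfl⟩ := (hedge e).1 h1
    exact ⟨v, hv, Prod.ext (hpc v hv).symm (T.markedVertex_unique h1 h2 (hmark v hv))⟩
  · rintro ⟨v, hv, hq⟩
    obtain ⟨rfl, rfl⟩ := Prod.mk.inj hq
    refine ⟨?_, ?_⟩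
    · change insert (p v) (c v) ∈ E(H)
      rw [hpc v hv]; exact (hed v hv).1
    · change T.IsMarkedVertex (insert (p v) (c v)) (p v)
      rw [hpc v hv]; exact hmark v hv

/-- Every hyperedge does have a marked vertex, by `exists_parentSystem`, so projecting the marked
pairs loses no hyperedge. -/
theorem edgeSet_eq_of_markedEdges_eq (T : IdeallyRootedHypertree V r) {p : V → V} {c : V → Set V}
    (hM : T.markedEdges = ParentSystem.markedEdges r p c) :
    E(T.toHypergraph) = ParentSystem.edges r p c := by
  obtain ⟨p', c', -, h1, h2⟩ := T.exists_parentSystem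
  rw [h2, ← ParentSystem.image_fst_markedEdges, ← h1, hM, ParentSystem.image_fst_markedEdges]

/-- The marked end of an ideal component consists of its ascending rays. -/
theorem markedEnd_eq (T : IdeallyRootedHypertree V r) {p : V → V} {c : V → Set V}
    (h : ParentSystem r p c) (hM : T.markedEdges = ParentSystem.markedEdges r p c)
    (C : T.toHypergraph.primalGraph.ConnectedComponent) (hC : r ∉ C.supp) :
    T.markedEnd C hC = {γ | (∀ n, γ (n + 1) = p (γ n)) ∧ γ 0 ∈ C.supp} := by
  have hE := T.edgeSet_eq_of_markedEdges_eq hM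
  obtain ⟨γ, h1, h2, h3⟩ := T.isEndOf C hC
  have hfree : ∀ x ∈ C.supp, ∀ n, p^[n] x ≠ r := by
    intro x hx n hn
    have := h.reachable_iterate hE x n
    rw [hn] at this
    apply hC
    rw [SimpleGraph.ConnectedComponent.mem_supp_iff] at hx ⊢
    rw [← hx]
    exact SimpleGraph.ConnectedComponent.eq.2 this.symm
  have hγ : γ ∈ T.markedEnd C hC := by rw [h3]; exact ⟨h1, rayEquiv_refl _ _⟩
  have hasc : ∀ n, γ (n + 1) = p (γ n) := by
    intro n
    by_contra hn
    obtain ⟨h6, h7⟩ := h.ray_descends hE h1 hn 0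
    set x := γ (n + 1 + 0 + 1) with hx
    have h8 : (insert (p x) (c x), p x) ∈ T.markedEdges := by rw [hM]; exact ⟨x, h6, rfl⟩
    have h9 := (h8.2.2 C (Hypergraph.subset_supp_of_mem h8.1
      (Set.mem_insert_of_mem _ (h.mem_self h6)) (h2 _))).2 hC γ hγ
    rw [Filter.eventually_atTop] at h9
    obtain ⟨N, hN⟩ := h9
    have h10 := hN (n + 1 + 1 + N) (by omega) x (Set.mem_insert_of_mem _ (h.mem_self h6))
      (h.parent_ne h6).symm
    change T.toHypergraph.primalGraph.edist (p x) _ < _ at h10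
    rw [h7, hx] at h10
    have h11 := h1 (n + 1 + 1) N
    have h12 := h1 (n + 1) (1 + N)
    rw [← add_assoc] at h12
    simp only [add_zero] at h10
    rw [h11, h12, Nat.cast_lt] at h10
    omega
  have hit : γ = fun n => p^[n] (γ 0) :=
    funext fun n => by simpa using ParentSystem.eq_iterate hasc n 0
  ext γ'
  rw [h3, hit, Set.mem_ofPred_eq, h.rayEquiv_iff hE (hfree _ (h2 0)), Set.mem_ofPred_eq]
  refine and_congr_right fun _ => ⟨fun h' => ?_, fun h' => C.reachable_of_mem_supp (h2 0) h'⟩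
  exact (SimpleGraph.ConnectedComponent.eq.2 h'.symm).trans (h2 0)

/-- An ideally rooted hypertree is determined by its marked hyperedges. -/
theorem markedEdges_injective : Function.Injective (markedEdges (V := V) (r := r)) := by
  intro T T' hTT
  obtain ⟨p, c, h, hM, hE⟩ := T.exists_parentSystem
  have hM' := hTT.symm.trans hM
  have hE' := T'.edgeSet_eq_of_markedEdges_eq hM'
  have hend := T.markedEnd_eq h hM
  have hend' := T'.markedEnd_eq h hM'
  have hH : T.toHypergraph = T'.toHypergraph :=
    Hypergraph.ext (T.vertexSet_eq.trans T'.vertexSet_eq.symm) (hE.trans hE'.symm)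
  obtain ⟨H, _, _, _, m, _⟩ := T
  obtain ⟨H', _, _, _, m', _⟩ := T'
  obtain rfl : H = H' := hH
  obtain rfl : m = m' := by
    funext C hC
    exact (hend C hC).trans (hend' C hC).symm
  rfl

end IdeallyRootedHypertree

/-! ### From parent systems to ideally rooted hypertrees -/

namespace ParentSystem

variable {r : V} {p : V → V} {c : V → Set V}

section Induce

variable {H : Hypergraph V} (h : ParentSystem r p c) (hE : E(H) = edges r p c)
include h hE

/-- The highest vertices of a connected set of vertices lie in one reduced hyperedge. -/
theorem eq_or_mem_of_connected {S : Set V} (hV : V(H) = Set.univ) (hS : (H.induce S).IsConnected)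
    {u w : V} (hu : u ∈ S) (hu' : u = r ∨ p u ∉ S) (hw : w ∈ S) (hw' : w = r ∨ p w ∉ S) :
    w = u ∨ (u ≠ r ∧ w ∈ c u) := by
  -- `Q v` says that climbing from `v` inside `S` gets stuck at `u` or at a sibling of `u`. It
  -- passes from a vertex to its neighbours in `S`.
  let Q : V → Prop := fun v => ∃ n, (∀ i ≤ n, p^[i] v ∈ S) ∧
    (p^[n] v = r ∨ p (p^[n] v) ∉ S) ∧ (p^[n] v = u ∨ (u ≠ r ∧ p^[n] v ∈ c u))
  have hstep : ∀ a b, (H.induce S).primalGraph.Adj a b → Q a → Q b := by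
    rintro a b hab ⟨n, h1, h2, h3⟩
    obtain ⟨hab, ha, hb⟩ := Hypergraph.induce_adj.1 hab
    rcases h.adj_cases hE hab with ⟨hr, rfl⟩ | ⟨hr, rfl⟩ | ⟨har, hbr, hba⟩
    · rcases n with _ | n
      · exact absurd hb (h2.resolve_left hr)
      · exact ⟨n, fun i hi => h1 (i + 1) (by omega), h2, h3⟩
    · refine ⟨n + 1, ?_, h2, h3⟩
      rintro (_ | i) hi
      · exact hb
      · exact h1 i (by omega)
    · obtain ⟨-, h5, h6⟩ := h.of_mem har hba
      rcases n with _ | n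
      · refine ⟨0, fun i hi => by rw [Nat.le_zero.1 hi]; exact hb, Or.inr ?_, Or.inr ?_⟩
        · change p b ∉ S
          rw [h6]
          exact h2.resolve_left har
        · change u ≠ r ∧ b ∈ c u
          rcases h3 with h3 | ⟨h3, h4⟩
          · exact ⟨h3 ▸ har, h3 ▸ hba⟩
          · exact ⟨h3, (h.of_mem h3 h4).2.1 ▸ hba⟩
      · have h7 := h.iterate_succ_of_mem har hba
        refine ⟨n + 1, ?_, by rw [h7]; exact h2, by rw [h7]; exact h3⟩
        rintro (_ | i) hi
        · exact hb
        · rw [h7]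
          exact h1 _ hi
  have hQ : Q w := by
    have hr := hS.2 u ⟨hV ▸ trivial, hu⟩ w ⟨hV ▸ trivial, hw⟩
    have hQu : Q u := ⟨0, fun i hi => by rw [Nat.le_zero.1 hi]; exact hu, hu', Or.inl rfl⟩
    obtain ⟨walk⟩ := hr
    clear hu hu' hw hw'
    revert hQu
    generalize hx : u = x at walk
    have : ∀ {x y : V} (_ : (H.induce S).primalGraph.Walk x y), Q x → Q y := by
      intro x y walk
      induction walk with
      | nil => exact id
      | cons ha _ ih => exact fun hq => ih (hstep _ _ ha hq)
    exact this walk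
  obtain ⟨n, h1, h2, h3⟩ := hQ
  rcases n with _ | n
  · exact h3
  · rcases hw' with rfl | hw'
    · rw [h.iterate_root] at h3
      rcases h3 with h3 | ⟨h3, h4⟩
      · exact Or.inl h3
      · exact ((h.of_mem h3 h4).1 rfl).elim
    · exact absurd (h1 1 (by omega)) hw'

omit hE in
theorem exists_highest {S : Set V} (hS : S.Finite) (hne : S.Nonempty) :
    ∃ u ∈ S, u = r ∨ p u ∉ S := by
  by_contra hall
  push Not at hall
  obtain ⟨v, hv⟩ := hne
  have hit : ∀ n, p^[n] v ∈ S := by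
    intro n
    induction n with
    | zero => exact hv
    | succ n ih => rw [Function.iterate_succ_apply']; exact (hall _ ih).2
  have hinj : Function.Injective fun n => p^[n] v := fun m n hmn =>
    h.iterate_injective (fun n => (hall _ (hit n)).1) hmn
  exact Set.infinite_of_injective_forall_mem hinj hit hS

/-- Fix a highest vertex `u` and send every other vertex of `S` to the trace of the hyperedge
joining it to its parent. A trace `f` is hit by all its vertices but one: the parent if that lies in
`S`, and `u` otherwise. Summing `f.ncard - 1` over the traces gives the number of vertices minus
one. -/
theorem isFiniteHypertree_induce {S : Set V} (hV : V(H) = Set.univ) (hfin : S.Finite)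
    (hS : (H.induce S).IsConnected) : (H.induce S).IsFiniteHypertree := by
  classical
  have hVS : V(H.induce S) = S := by
    change V(H) ∩ S = S
    rw [hV, Set.univ_inter]
  have hEfin : E(H.induce S).Finite := hfin.finite_subsets.subset fun f hf =>
    hVS ▸ (H.induce S).subset_vertexSet_of_mem_edgeSet' hf
  refine ⟨hVS.symm ▸ hfin, fun e he => he.1, hS, ?_⟩
  obtain ⟨u, hu, hu'⟩ := h.exists_highest hfin (hVS ▸ hS.1)
  have hU := fun w => h.eq_or_mem_of_connected hE hV hS (w := w) hu hu'
  have hnr : ∀ v ∈ S, v ≠ u → v ≠ r := by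
    rintro v hv hvu rfl
    rcases hU v hv (Or.inl rfl) with h1 | ⟨h1, h2⟩
    · exact hvu h1
    · exact (h.of_mem h1 h2).1 rfl
  let φ : V → Set V := fun v => insert (p v) (c v) ∩ S
  have hφ : ∀ v ∈ S, v ≠ u → v ∈ φ v := fun v hv hvu =>
    ⟨Set.mem_insert_of_mem _ (h.mem_self (hnr v hv hvu)), hv⟩
  have hφE : ∀ v ∈ S, v ≠ u → φ v ∈ E(H.induce S) := by
    intro v hv hvu
    have hvr := hnr v hv hvu
    refine ⟨?_, _, by rw [hE]; exact ⟨v, hvr, rfl⟩, rfl⟩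
    by_cases hpv : p v ∈ S
    · exact ⟨v, hφ v hv hvu, p v, ⟨Set.mem_insert _ _, hpv⟩, (h.parent_ne hvr).symm⟩
    · obtain h1 | ⟨h1, h2⟩ := hU v hv (Or.inr hpv)
      · exact (hvu h1).elim
      · refine ⟨v, hφ v hv hvu, u, ⟨Set.mem_insert_of_mem _ ?_, hu⟩, hvu⟩
        rw [(h.of_mem h1 h2).2.1]
        exact h.mem_self h1
  have hfib : ∀ f ∈ E(H.induce S), ∃ m ∈ f, ∀ v, (v ∈ S ∧ v ≠ u ∧ φ v = f) ↔ v ∈ f ∧ v ≠ m := by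
    rintro f ⟨hfn, e, he, rfl⟩
    rw [hE] at he
    obtain ⟨x, hx, rfl⟩ := he
    have hφx : ∀ v ∈ c x, φ v = insert (p x) (c x) ∩ S := by
      intro v hv
      obtain ⟨-, h2, h3⟩ := h.of_mem hx hv
      simp only [φ, h2, h3]
    by_cases hpx : p x ∈ S
    · refine ⟨p x, ⟨Set.mem_insert _ _, hpx⟩, fun v => ⟨?_, ?_⟩⟩
      · rintro ⟨hv, hvu, hvf⟩
        refine ⟨hvf ▸ hφ v hv hvu, ?_⟩
        rintro rfl
        have hpr := hnr _ hv hvu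
        obtain ⟨y, hy, hyx⟩ := hfn.exists_ne (p x)
        have hyc : y ∈ c x := hy.1.resolve_left hyx
        obtain ⟨hyr, -, hpy⟩ := h.of_mem hx hyc
        rw [← hvf] at hy
        rcases hy.1 with rfl | hy
        · exact h.acyclic (n := 2) hpr two_pos hpy
        · have := (h.of_mem hpr hy).2.2
          rw [hpy] at this
          exact h.parent_ne hpr this.symm
      · rintro ⟨⟨hv1, hv2⟩, hvp⟩
        have hvc : v ∈ c x := hv1.resolve_left hvp
        refine ⟨hv2, ?_, hφx v hvc⟩
        rintro rfl
        obtain ⟨h1, -, h3⟩ := h.of_mem hx hvc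
        rw [h3] at hu'
        exact hu'.elim h1 (fun h' => h' hpx)
    · have hsub : ∀ v, v ∈ insert (p x) (c x) ∩ S → v ∈ c x := by
        rintro v ⟨rfl | hv, hv'⟩
        · exact (hpx hv').elim
        · exact hv
      have hux : u ∈ c x := by
        obtain ⟨y, hy, hyu⟩ := hfn.exists_ne u
        obtain ⟨-, h2, h3⟩ := h.of_mem hx (hsub y hy)
        obtain h4 | ⟨h4, h5⟩ := hU y hy.2 (Or.inr (h3 ▸ hpx))
        · exact (hyu h4).elim
        · rw [← h2, (h.of_mem h4 h5).2.1]
          exact h.mem_self h4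
      refine ⟨u, ⟨Set.mem_insert_of_mem _ hux, hu⟩, fun v => ⟨?_, ?_⟩⟩
      · rintro ⟨hv, hvu, hvf⟩
        exact ⟨hvf ▸ hφ v hv hvu, hvu⟩
      · rintro ⟨hv, hvu⟩
        exact ⟨hv.2, hvu, hφx v (hsub v hv)⟩
  have hefin : ∀ f ∈ E(H.induce S), f.Finite := fun f hf =>
    hfin.subset (hVS ▸ (H.induce S).subset_vertexSet_of_mem_edgeSet' hf)
  rw [finsum_mem_eq_finite_toFinset_sum _ hEfin, hVS, Set.ncard_eq_toFinset_card _ hfin,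
    Set.ncard_eq_toFinset_card _ hEfin]
  have hcard : (hfin.toFinset.erase u).card = ∑ f ∈ hEfin.toFinset,
      ((hfin.toFinset.erase u).filter fun v => φ v = f).card := by
    apply Finset.card_eq_sum_card_fiberwise
    intro v hv
    simp only [Finset.coe_erase, Set.Finite.coe_toFinset] at hv
    simp only [Set.Finite.coe_toFinset]
    exact hφE v hv.1 hv.2
  have hsum : ∑ f ∈ hEfin.toFinset, f.ncard = ∑ f ∈ hEfin.toFinset,
      (((hfin.toFinset.erase u).filter fun v => φ v = f).card + 1) := by
    refine Finset.sum_congr rfl fun f hf => ?_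
    rw [Set.Finite.mem_toFinset] at hf
    obtain ⟨m, hm, hmf⟩ := hfib f hf
    rw [← Set.ncard_sdiff_singleton_add_one hm (hefin f hf), ← Set.ncard_coe_finset]
    congr 2
    ext v
    rw [Finset.coe_filter, Set.mem_ofPred_eq, Finset.mem_erase, Set.Finite.mem_toFinset]
    have := hmf v
    simp only [Set.mem_sdiff, Set.mem_singleton_iff]
    tauto
  have hone : (hfin.toFinset.erase u).card + 1 = hfin.toFinset.card :=
    Finset.card_erase_add_one (by simpa using hu)
  rw [hsum, Finset.sum_add_distrib, ← hcard]
  simp only [Finset.sum_const, smul_eq_mul, mul_one]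
  omega

end Induce

/-- The hypergraph of a parent system. -/
def hypergraph (r : V) (p : V → V) (c : V → Set V) : Hypergraph V where
  vertexSet := Set.univ
  edgeSet := edges r p c
  subset_vertexSet_of_mem_edgeSet' := fun _ _ => Set.subset_univ _

theorem isHypertree_induce (h : ParentSystem r p c)
    (C : (hypergraph r p c).primalGraph.ConnectedComponent) :
    ((hypergraph r p c).induce C.supp).IsHypertree := by
  have hconn : ((hypergraph r p c).induce C.supp).IsConnected := by
    obtain ⟨t, ht⟩ := C.nonempty_supp
    refine Hypergraph.isConnected_induce_of_descending rfl ht fun v hv hvt => ?_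
    obtain ⟨w, hw, hwd⟩ := (C.reachable_of_mem_supp hv ht).exists_adj_dist_lt hvt
    exact ⟨w, (C.mem_supp_congr_adj hw).1 hv, hw, hwd⟩
  have hVC : V((hypergraph r p c).induce C.supp) = C.supp := Set.univ_inter _
  by_cases hfin : C.supp.Finite
  · exact Or.inl (h.isFiniteHypertree_induce rfl rfl hfin hconn)
  · refine Or.inr ⟨by rw [hVC]; exact hfin, fun e he => he.1, hconn, fun S hS hSf hSc => ?_⟩
    rw [hVC] at hS
    rw [Hypergraph.induce_induce _ hS] at hSc ⊢
    exact h.isFiniteHypertree_induce rfl rfl hSf hSc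

theorem iterate_ne_root (h : ParentSystem r p c)
    {C : (hypergraph r p c).primalGraph.ConnectedComponent} (hC : r ∉ C.supp) {x : V}
    (hx : x ∈ C.supp) (n : ℕ) : p^[n] x ≠ r := by
  intro hn
  have := h.reachable_iterate (H := hypergraph r p c) rfl x n
  rw [hn] at this
  apply hC
  rw [SimpleGraph.ConnectedComponent.mem_supp_iff] at hx ⊢
  rw [← hx]
  exact SimpleGraph.ConnectedComponent.eq.2 this.symm

/-- The ideally rooted hypertree of a parent system. -/
def toHypertree (h : ParentSystem r p c) : IdeallyRootedHypertree V r where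
  toHypergraph := hypergraph r p c
  vertexSet_eq := rfl
  loopless := by
    rintro e ⟨v, hv, rfl⟩
    exact ⟨_, Set.mem_insert _ _, v, Set.mem_insert_of_mem _ (h.mem_self hv), h.parent_ne hv⟩
  isHypertree := h.isHypertree_induce
  markedEnd C _ := {γ | (∀ n, γ (n + 1) = p (γ n)) ∧ γ 0 ∈ C.supp}
  isEndOf C hC := by
    obtain ⟨x, hx⟩ := C.nonempty_supp
    have hfree := fun n => h.iterate_ne_root hC hx n
    refine ⟨fun n => p^[n] x, h.isRay_iterate rfl hfree, fun n => ?_, ?_⟩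
    · rw [SimpleGraph.ConnectedComponent.mem_supp_iff] at hx ⊢
      rw [← hx]
      exact SimpleGraph.ConnectedComponent.eq.2
        (h.reachable_iterate (H := hypergraph r p c) rfl x n).symm
    · ext γ
      rw [Set.mem_ofPred_eq, Set.mem_ofPred_eq, h.rayEquiv_iff rfl hfree]
      exact and_congr_right fun _ => ⟨fun h' => C.reachable_of_mem_supp hx h',
        fun h' => (SimpleGraph.ConnectedComponent.eq.2 h'.symm).trans hx⟩

theorem toHypertree_isMarkedVertex (h : ParentSystem r p c) {v : V} (hv : v ≠ r) :
    h.toHypertree.IsMarkedVertex (insert (p v) (c v)) (p v) := by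
  refine ⟨Set.mem_insert _ _, fun C hC => ⟨fun hr u hu hne => ?_, fun hr γ hγ => ?_⟩⟩
  · exact h.edist_parent_lt (H := hypergraph r p c) rfl hv
      (C.reachable_of_mem_supp (hC (Set.mem_insert_of_mem _ (h.mem_self hv))) hr)
      (hu.resolve_left hne)
  · have hvC := hC (Set.mem_insert_of_mem _ (h.mem_self hv))
    filter_upwards [h.eventually_edist_parent_lt (H := hypergraph r p c) rfl
      (fun n => h.iterate_ne_root hr hvC n) hγ.1 (C.reachable_of_mem_supp hvC hγ.2)]
      with n hn u hu hne using hn u (hu.resolve_left hne)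

theorem toHypertree_markedEdges (h : ParentSystem r p c) :
    h.toHypertree.markedEdges = markedEdges r p c := by
  ext ⟨e, w⟩
  constructor
  · rintro ⟨h1, h2⟩
    obtain ⟨v, hv, rfl⟩ := id h1
    exact ⟨v, hv, Prod.ext rfl
      (h.toHypertree.markedVertex_unique h1 h2 (h.toHypertree_isMarkedVertex hv))⟩
  · rintro ⟨v, hv, hq⟩
    obtain ⟨rfl, rfl⟩ := Prod.mk.inj hq
    exact ⟨⟨v, hv, rfl⟩, h.toHypertree_isMarkedVertex hv⟩

end ParentSystem

/-! ### Ranks, classes and their smallest elements -/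

namespace PrueferCode

/-- The number of elements of `A` below `i`. -/
noncomputable def rank (A : Set ℕ) (i : ℕ) : ℕ := {j ∈ A | j < i}.ncard

theorem finite_below (A : Set ℕ) (i : ℕ) : {j ∈ A | j < i}.Finite :=
  (Set.finite_Iio i).subset fun _ hj => hj.2

theorem rank_mono (A : Set ℕ) {i j : ℕ} (hij : i ≤ j) : rank A i ≤ rank A j :=
  Set.ncard_le_ncard (fun _ hl => ⟨hl.1, hl.2.trans_le hij⟩) (finite_below A j)

theorem rank_anti {A B : Set ℕ} (hAB : A ⊆ B) (i : ℕ) : rank A i ≤ rank B i :=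
  Set.ncard_le_ncard (fun _ hl => ⟨hAB hl.1, hl.2⟩) (finite_below B i)

theorem rank_le (A : Set ℕ) (i : ℕ) : rank A i ≤ i := by
  refine (Set.ncard_le_ncard (t := Set.Iio i) (fun _ hl => hl.2) (Set.finite_Iio i)).trans ?_
  rw [← Finset.coe_Iio, Set.ncard_coe_finset, Nat.card_Iio]

theorem rank_lt_of_subset {A B : Set ℕ} (hAB : A ⊆ B) {i j : ℕ} (hij : i < j) (hB : i ∈ B)
    (hA : i ∉ A) : rank A j < rank B j :=
  Set.ncard_lt_ncard ⟨fun _ hl => ⟨hAB hl.1, hl.2⟩, fun h => hA (h ⟨hB, hij⟩).1⟩ (finite_below B j)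

theorem rank_lt {A : Set ℕ} {i j : ℕ} (hi : i ∈ A) (hij : i < j) : rank A i < rank A j :=
  Set.ncard_lt_ncard ⟨fun _ hl => ⟨hl.1, hl.2.trans hij⟩, fun h => lt_irrefl _ (h ⟨hi, hij⟩).2⟩
    (finite_below A j)

theorem lt_of_rank_lt {A : Set ℕ} {i j : ℕ} (h : rank A i < rank A j) : i < j := by
  by_contra hij
  exact absurd (rank_mono A (not_lt.1 hij)) (not_le.2 h)

theorem rank_injOn (A : Set ℕ) : Set.InjOn (rank A) A := by
  intro i hi j hj hij
  rcases lt_trichotomy i j with h | h | h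
  · exact absurd hij (rank_lt hi h).ne
  · exact h
  · exact absurd hij (rank_lt hj h).ne'

theorem exists_rank_eq {A : Set ℕ} {n : ℕ} (hn : (n : ℕ∞) < A.encard) : ∃ i ∈ A, rank A i = n := by
  classical
  have key : ∀ m, rank A m = Nat.count (· ∈ A) m := by
    intro m
    rw [Nat.count_eq_card_filter_range, rank, ← Set.ncard_coe_finset]
    congr 1
    ext j
    simp [and_comm]
  have hcard : ∀ hf : (Set.ofPred (· ∈ A)).Finite, n < hf.toFinset.card := by
    intro hf
    have : A.encard = hf.toFinset.card := by
      rw [← Set.encard_coe_eq_coe_finsetCard, hf.coe_toFinset]; rfl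
    rwa [this, Nat.cast_lt] at hn
  exact ⟨Nat.nth (· ∈ A) n, Nat.nth_mem n hcard, by rw [key, Nat.count_nth hcard]⟩

theorem rank_lt_encard {A : Set ℕ} {i : ℕ} (hi : i ∈ A) : (rank A i : ℕ∞) < A.encard := by
  by_cases hA : A.Finite
  · rw [← hA.cast_ncard_eq, Nat.cast_lt]
    exact Set.ncard_lt_ncard ⟨fun _ hl => hl.1, fun h => lt_irrefl _ (h hi).2⟩ hA
  · rw [Set.encard_eq_top_iff.2 hA]
    exact ENat.natCast_lt_top _

/-- The ranks of a set fill an initial segment whose length is its cardinality. Thus matching the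
`j`-th elements of two equinumerous sets leaves nothing over on either side. -/
theorem image_rank_eq {A B : Set ℕ} (h : A.encard = B.encard) : rank A '' A = rank B '' B := by
  ext n
  constructor
  · rintro ⟨i, hi, rfl⟩
    exact exists_rank_eq (h ▸ rank_lt_encard hi)
  · rintro ⟨i, hi, rfl⟩
    exact exists_rank_eq (h ▸ rank_lt_encard hi)

/-- A family of classes, indexed by their elements, which partition the finite vertices. -/
structure IsClassSystem (c : Vertex → Set Vertex) : Prop where
  mem_self : ∀ {x}, x ≠ ⊤ → x ∈ c x
  of_mem : ∀ {x y}, x ≠ ⊤ → y ∈ c x → y ≠ ⊤ ∧ c y = c x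

theorem _root_.ParentSystem.isClassSystem {p : Vertex → Vertex} {c : Vertex → Set Vertex}
    (h : ParentSystem ⊤ p c) : IsClassSystem c :=
  ⟨h.mem_self, fun hx hy => ⟨(h.of_mem hx hy).1, (h.of_mem hx hy).2.1⟩⟩

/-- The smallest element of the class of `x`. -/
noncomputable def classLabel (c : Vertex → Set Vertex) (x : Vertex) : ℕ :=
  sInf {n : ℕ | ∃ u : ℕ+, (u : ℕ) = n ∧ (u : Vertex) ∈ c x}

/-- The smallest elements of all classes. -/
def labels (c : Vertex → Set Vertex) : Set ℕ := {l | ∃ x ≠ ⊤, l = classLabel c x}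

/-- The smallest elements of the classes not containing `v`. -/
def labelsAvoiding (c : Vertex → Set Vertex) (v : Vertex) : Set ℕ :=
  {l | ∃ x ≠ ⊤, x ∉ c v ∧ l = classLabel c x}

open Classical in
/-- Merge all classes in `G` with the class of `v`. -/
noncomputable def mergeClass (c : Vertex → Set Vertex) (v : Vertex) (G : Set Vertex) (x : Vertex) :
    Set Vertex :=
  if x ∈ c v ∪ G then c v ∪ G else c x

theorem mergeClass_of_mem {c : Vertex → Set Vertex} {v x : Vertex} {G : Set Vertex}
    (hx : x ∈ c v ∪ G) : mergeClass c v G x = c v ∪ G := if_pos hx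

theorem mergeClass_of_notMem {c : Vertex → Set Vertex} {v x : Vertex} {G : Set Vertex}
    (hx : x ∉ c v ∪ G) : mergeClass c v G x = c x := if_neg hx

theorem classLabel_le {c : Vertex → Set Vertex} {x : Vertex} {u : ℕ+} (hu : (u : Vertex) ∈ c x) :
    classLabel c x ≤ u := Nat.sInf_le ⟨u, rfl, hu⟩

namespace IsClassSystem

variable {c : Vertex → Set Vertex} (hc : IsClassSystem c)
include hc

theorem exists_classLabel {x : Vertex} (hx : x ≠ ⊤) :
    ∃ u : ℕ+, (u : ℕ) = classLabel c x ∧ (u : Vertex) ∈ c x := by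
  obtain ⟨u, hu⟩ := WithTop.ne_top_iff_exists.1 hx
  exact Nat.sInf_mem (s := {n : ℕ | ∃ u : ℕ+, (u : ℕ) = n ∧ (u : Vertex) ∈ c x})
    ⟨u, u, rfl, by rw [hu]; exact hc.mem_self hx⟩

theorem class_eq_of_mem {x y z : Vertex} (hx : x ≠ ⊤) (hy : y ≠ ⊤) (hzx : z ∈ c x) (hzy : z ∈ c y) :
    c x = c y :=
  (hc.of_mem hx hzx).2.symm.trans (hc.of_mem hy hzy).2

theorem classLabel_inj {x y : Vertex} (hx : x ≠ ⊤) (hy : y ≠ ⊤)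
    (h : classLabel c x = classLabel c y) : c x = c y := by
  obtain ⟨u, hu, hux⟩ := hc.exists_classLabel hx
  obtain ⟨w, hw, hwy⟩ := hc.exists_classLabel hy
  obtain rfl : u = w := PNat.coe_injective (by rw [hu, hw, h])
  exact hc.class_eq_of_mem hx hy hux hwy

theorem labels_eq {v : Vertex} (hv : v ≠ ⊤) :
    labels c = insert (classLabel c v) (labelsAvoiding c v) := by
  ext l
  constructor
  · rintro ⟨x, hx, rfl⟩
    by_cases h : x ∈ c v
    · left
      simp only [classLabel, (hc.of_mem hv h).2]
    · exact Or.inr ⟨x, hx, h, rfl⟩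
  · rintro (rfl | ⟨x, hx, -, rfl⟩)
    · exact ⟨v, hv, rfl⟩
    · exact ⟨x, hx, rfl⟩

theorem classLabel_notMem_labelsAvoiding {v : Vertex} (hv : v ≠ ⊤) :
    classLabel c v ∉ labelsAvoiding c v := by
  rintro ⟨x, hx, hxv, h⟩
  exact hxv (hc.classLabel_inj hv hx h ▸ hc.mem_self hx)

theorem encard_labels {v : Vertex} (hv : v ≠ ⊤) :
    (labels c).encard = (labelsAvoiding c v).encard + 1 := by
  rw [hc.labels_eq hv, Set.encard_insert_of_notMem (hc.classLabel_notMem_labelsAvoiding hv)]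

variable {v : Vertex} (hv : v ≠ ⊤) {G : Set Vertex}
  (hG : ∀ x ∈ G, x ≠ ⊤ ∧ x ∉ c v ∧ c x ⊆ G)
include hv hG

theorem mem_merge_iff {x y : Vertex} (hx : x ≠ ⊤) (hy : y ∈ c x) : y ∈ c v ∪ G ↔ x ∈ c v ∪ G := by
  obtain ⟨hy', hyx⟩ := hc.of_mem hx hy
  constructor
  · rintro (h | h)
    · exact Or.inl ((hc.of_mem hv h).2 ▸ hyx ▸ hc.mem_self hx)
    · exact Or.inr ((hG y h).2.2 (hyx ▸ hc.mem_self hx))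
  · rintro (h | h)
    · exact Or.inl ((hc.of_mem hv h).2 ▸ hy)
    · exact Or.inr ((hG x h).2.2 hy)

theorem merge : IsClassSystem (mergeClass c v G) := by
  constructor
  · intro x hx
    by_cases h : x ∈ c v ∪ G
    · rwa [mergeClass_of_mem h]
    · rw [mergeClass_of_notMem h]
      exact hc.mem_self hx
  · intro x y hx hy
    by_cases h : x ∈ c v ∪ G
    · rw [mergeClass_of_mem h] at hy ⊢
      exact ⟨hy.elim (fun h' => (hc.of_mem hv h').1) fun h' => (hG y h').1, mergeClass_of_mem hy⟩
    · rw [mergeClass_of_notMem h] at hy ⊢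
      rw [mergeClass_of_notMem (mt (hc.mem_merge_iff hv hG hx hy).1 h)]
      exact hc.of_mem hx hy

theorem class_subset_merge {x : Vertex} (hx : x ≠ ⊤) : c x ⊆ mergeClass c v G x := by
  intro y hy
  by_cases h : x ∈ c v ∪ G
  · rw [mergeClass_of_mem h]
    exact (hc.mem_merge_iff hv hG hx hy).2 h
  · rwa [mergeClass_of_notMem h]

/-- The class of `v` accounts for the summand `1`. The other labels and the positions `R` are
equinumerous, and merging removes the labels of the classes in `G` together with exactly the
positions of the same ranks; the remainders have the same set of ranks. -/
theorem encard_labels_merge {R : Set ℕ} (hR : (labels c).encard = R.encard + 1) :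
    (labels (mergeClass c v G)).encard = {i ∈ R | ¬ ∃ x ∈ G,
      rank R i = rank (labelsAvoiding c v) (classLabel c x)}.encard + 1 := by
  set A := labelsAvoiding c v with hA
  set R' := {i ∈ R | ¬ ∃ x ∈ G, rank R i = rank A (classLabel c x)} with hR'
  have hRA : R.encard = A.encard := by
    rw [hc.encard_labels hv] at hR
    exact (WithTop.add_right_cancel ENat.one_ne_top hR).symm
  let A' := A \ (classLabel c '' G)
  have hGA : classLabel c '' G ⊆ A := by
    rintro _ ⟨x, hx, rfl⟩
    exact ⟨x, (hG x hx).1, (hG x hx).2.1, rfl⟩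
  have h1 : rank R '' R' = rank A '' A' := by
    have himg := image_rank_eq hRA
    ext n
    constructor
    · rintro ⟨i, ⟨hi, hn⟩, rfl⟩
      obtain ⟨a, ha, hai⟩ : rank R i ∈ rank A '' A := himg ▸ ⟨i, hi, rfl⟩
      refine ⟨a, ⟨ha, ?_⟩, hai⟩
      rintro ⟨x, hx, rfl⟩
      exact hn ⟨x, hx, hai.symm⟩
    · rintro ⟨a, ⟨ha, han⟩, rfl⟩
      obtain ⟨i, hi, hai⟩ : rank A a ∈ rank R '' R := himg.symm ▸ ⟨a, ha, rfl⟩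
      refine ⟨i, ⟨hi, ?_⟩, hai⟩
      rintro ⟨x, hx, h⟩
      have := rank_injOn A ha (hGA ⟨x, hx, rfl⟩) (hai.symm.trans h)
      exact han ⟨x, hx, this.symm⟩
  have h2 : R'.encard = A'.encard := by
    rw [← ((rank_injOn R).mono fun _ h => h.1 : Set.InjOn (rank R) R').encard_image, h1,
      ((rank_injOn A).mono fun _ h => h.1 : Set.InjOn (rank A) A').encard_image]
  have hvD : v ∈ c v ∪ G := Or.inl (hc.mem_self hv)
  have hc' := hc.merge hv hG
  have hnot : ∀ x, x ≠ ⊤ → x ∉ c v ∪ G → classLabel (mergeClass c v G) x = classLabel c x := by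
    intro x hx h
    simp only [classLabel, mergeClass_of_notMem h]
  have h3 : labelsAvoiding (mergeClass c v G) v = A' := by
    ext l
    constructor
    · rintro ⟨x, hx, hxv, rfl⟩
      rw [mergeClass_of_mem hvD] at hxv
      rw [hnot x hx hxv]
      refine ⟨⟨x, hx, fun h => hxv (Or.inl h), rfl⟩, ?_⟩
      rintro ⟨y, hy, hyx⟩
      have := hc.classLabel_inj (hG y hy).1 hx hyx
      exact hxv (Or.inr ((hG y hy).2.2 (this ▸ hc.mem_self hx)))
    · rintro ⟨⟨x, hx, hxv, rfl⟩, h⟩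
      have hxD : x ∉ c v ∪ G := fun h' => h'.elim hxv fun h' => h ⟨x, h', rfl⟩
      exact ⟨x, hx, by rwa [mergeClass_of_mem hvD], (hnot x hx hxD).symm⟩
  rw [hc'.encard_labels hv, h3, h2]

end IsClassSystem

end PrueferCode

/-! ### Star-reduction of parent systems -/

namespace PrueferCode

open ParentSystem

open Classical in
/-- The parents after the star-reduction at `v`. -/
noncomputable def starParent (p : Vertex → Vertex) (v x : Vertex) : Vertex :=
  if p x = v then p v else p x

/-- The vertices with parent `v`. -/
def children (p : Vertex → Vertex) (v : Vertex) : Set Vertex := {x | x ≠ ⊤ ∧ p x = v}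

theorem starParent_of_eq {p : Vertex → Vertex} {v x : Vertex} (h : p x = v) :
    starParent p v x = p v := if_pos h

theorem starParent_of_ne {p : Vertex → Vertex} {v x : Vertex} (h : p x ≠ v) :
    starParent p v x = p x := if_neg h

section Star

variable {p : Vertex → Vertex} {c : Vertex → Set Vertex} (h : ParentSystem ⊤ p c)
include h

theorem children_spec {v : Vertex} (hv : v ≠ ⊤) :
    ∀ x ∈ children p v, x ≠ ⊤ ∧ x ∉ c v ∧ c x ⊆ children p v := by
  rintro x ⟨hx, hxv⟩
  refine ⟨hx, fun hxc => ?_, fun y hy => ?_⟩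
  · exact h.parent_ne hv ((h.of_mem hv hxc).2.2.symm.trans hxv)
  · obtain ⟨h1, -, h3⟩ := h.of_mem hx hy
    exact ⟨h1, h3.trans hxv⟩

theorem starParent_of_mem {v x : Vertex} (hv : v ≠ ⊤) (hx : x ∈ c v ∪ children p v) :
    starParent p v x = p v := by
  rcases hx with hx | hx
  · have := (h.of_mem hv hx).2.2
    rw [starParent_of_ne (this ▸ h.parent_ne hv), this]
  · exact starParent_of_eq hx.2

theorem parentSystem_star {v : Vertex} (hv : v ≠ ⊤) :
    ParentSystem ⊤ (starParent p v) (mergeClass c v (children p v)) := by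
  have hc := h.isClassSystem.merge hv (children_spec h hv)
  -- The new parent map skips ancestors: `n` of its steps are at least `n` steps of the old one, so
  -- it inherits the absence of cycles.
  have hiter : ∀ n x, ∃ m ≥ n, (starParent p v)^[n] x = p^[m] x := by
    intro n x
    induction n with
    | zero => exact ⟨0, le_rfl, rfl⟩
    | succ n ih =>
      obtain ⟨m, hm, he⟩ := ih
      rw [Function.iterate_succ_apply', he]
      by_cases hp : p (p^[m] x) = v
      · refine ⟨m + 2, by omega, ?_⟩
        rw [starParent_of_eq hp, Function.iterate_succ_apply', Function.iterate_succ_apply', hp]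
      · exact ⟨m + 1, by omega, by rw [starParent_of_ne hp, Function.iterate_succ_apply']⟩
  refine ⟨?_, hc.mem_self, fun {x y} hx hy => ?_, fun {x n} hx hn => ?_⟩
  · rw [starParent_of_ne (by rw [h.root]; exact hv.symm), h.root]
  · refine ⟨(hc.of_mem hx hy).1, (hc.of_mem hx hy).2, ?_⟩
    by_cases hxD : x ∈ c v ∪ children p v
    · rw [mergeClass_of_mem hxD] at hy
      rw [starParent_of_mem h hv hxD, starParent_of_mem h hv hy]
    · rw [mergeClass_of_notMem hxD] at hy
      simp only [starParent, (h.of_mem hx hy).2.2]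
  · obtain ⟨m, hm, he⟩ := hiter n x
    rw [he]
    exact h.acyclic hx (by omega)

theorem reduced_edge {x : Vertex} (hx : x ≠ ⊤) : reduced (insert (p x) (c x), p x) = c x :=
  Set.insert_sdiff_self_of_notMem (h.parent_notMem hx)

theorem mem_class_symm {x y : Vertex} (hx : x ≠ ⊤) (hy : y ∈ c x) : x ∈ c y :=
  (h.of_mem hx hy).2.1 ▸ h.mem_self hx

/-- Exactly one hyperedge has `u` unmarked, namely `insert (p u) (c u)`. Those with `u` marked have
reduced hyperedges that fill `children p u`, and `u` itself already lies in `c u`. -/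
theorem starReduction_markedEdges (u : ℕ+) :
    starReduction u (markedEdges ⊤ p c) =
      markedEdges ⊤ (starParent p u) (mergeClass c u (children p u)) := by
  have hv : (u : Vertex) ≠ ⊤ := WithTop.coe_ne_top
  have hvD : (u : Vertex) ∈ c u ∪ children p u := Or.inl (h.mem_self hv)
  have hU : ⋃₀ {e | (u : Vertex) ∈ e ∧ ∃ m, (e, m) ∈ markedEdges ⊤ p c} =
      insert (p u) (c u ∪ children p u) := by
    ext z
    constructor
    · rintro ⟨e, ⟨hve, m, y, hy, hq⟩, hz⟩
      obtain ⟨rfl, rfl⟩ := Prod.mk.inj hq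
      rcases hve with hve | hve
      · rcases hz with rfl | hz
        · rw [← hve]; exact Or.inr hvD
        · exact Or.inr (Or.inr ((children_spec h hv y ⟨hy, hve.symm⟩).2.2 hz))
      · obtain ⟨-, h2, h3⟩ := h.of_mem hy hve
        rw [← h2, ← h3] at hz
        exact hz.imp id Or.inl
    · have hsub : insert (p u) (c u) ⊆
          ⋃₀ {e | (u : Vertex) ∈ e ∧ ∃ m, (e, m) ∈ markedEdges ⊤ p c} := fun z hz =>
        ⟨_, ⟨Set.mem_insert_of_mem _ (h.mem_self hv), p u, u, hv, rfl⟩, hz⟩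
      rintro (hz | hz | hz)
      · exact hsub (Or.inl hz)
      · exact hsub (Or.inr hz)
      · exact ⟨insert (p z) (c z), ⟨Or.inl hz.2.symm, p z, z, hz.1, rfl⟩,
          Or.inr (h.mem_self hz.1)⟩
  ext q
  constructor
  · rintro (⟨⟨x, hx, rfl⟩, hvq⟩ | ⟨⟨q₀, ⟨x, hx, rfl⟩, hvx, hq2⟩, hq1⟩)
    · have hxD : x ∉ c u ∪ children p u := by
        rintro (h1 | h1)
        · exact hvq (Or.inr (mem_class_symm h hv h1))
        · exact hvq (Or.inl h1.2.symm)
      exact ⟨x, hx, by rw [mergeClass_of_notMem hxD, starParent_of_ne fun he => hxD (Or.inr ⟨hx, he⟩)]⟩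
    · rw [reduced_edge h hx] at hvx
      refine ⟨u, hv, Prod.ext ?_ ?_⟩
      · rw [hq1, hU, starParent_of_mem h hv hvD, mergeClass_of_mem hvD]
      · rw [hq2, starParent_of_mem h hv hvD]
        exact (h.of_mem hx hvx).2.2.symm
  · rintro ⟨x, hx, rfl⟩
    by_cases hxD : x ∈ c u ∪ children p u
    · refine Or.inr ⟨⟨_, ⟨u, hv, rfl⟩, ?_, ?_⟩, ?_⟩
      · rw [reduced_edge h hv]; exact h.mem_self hv
      · exact starParent_of_mem h hv hxD
      · rw [hU, starParent_of_mem h hv hxD, mergeClass_of_mem hxD]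
    · have hne : p x ≠ u := fun he => hxD (Or.inr ⟨hx, he⟩)
      rw [mergeClass_of_notMem hxD, starParent_of_ne hne]
      refine Or.inl ⟨⟨x, hx, rfl⟩, ?_⟩
      rintro (h1 | h1)
      · exact hne h1.symm
      · exact hxD (Or.inl (mem_class_symm h hx h1))

theorem label_edge {x : Vertex} (hx : x ≠ ⊤) :
    label (insert (p x) (c x), p x) = classLabel c x := by
  simp only [label, reduced_edge h hx, classLabel]

/-- Smallest unmarked vertices separate the hyperedges because classes are disjoint; counting
hyperedges with smaller labels is therefore a rank in `labelsAvoiding`. -/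
theorem receives_iff {u : ℕ+} {R : Set ℕ} {i : ℕ} :
    Receives u (markedEdges ⊤ p c) R i ↔ i ∈ R ∧ ∃ x ∈ children p u,
      rank R i = rank (labelsAvoiding c u) (classLabel c x) := by
  have hv : (u : Vertex) ≠ ⊤ := WithTop.coe_ne_top
  have hmem : ∀ q, q ∈ edgesAvoiding u (markedEdges ⊤ p c) ↔
      ∃ x ≠ ⊤, x ∉ c u ∧ q = (insert (p x) (c x), p x) := by
    intro q
    constructor
    · rintro ⟨⟨x, hx, rfl⟩, hq⟩
      rw [reduced_edge h hx] at hq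
      exact ⟨x, hx, fun hxu => hq (mem_class_symm h hv hxu), rfl⟩
    · rintro ⟨x, hx, hxu, rfl⟩
      refine ⟨⟨x, hx, rfl⟩, ?_⟩
      rw [reduced_edge h hx]
      exact fun hux => hxu (mem_class_symm h hx hux)
  have hcount : ∀ n, {q' ∈ edgesAvoiding u (markedEdges ⊤ p c) | label q' < n}.ncard =
      rank (labelsAvoiding c u) n := by
    intro n
    rw [rank, ← Set.InjOn.ncard_image (f := label)]
    · congr 1
      ext l
      constructor
      · rintro ⟨q, ⟨hq, hn⟩, rfl⟩
        obtain ⟨x, hx, hxu, rfl⟩ := (hmem q).1 hq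
        exact ⟨⟨x, hx, hxu, label_edge h hx⟩, hn⟩
      · rintro ⟨⟨x, hx, hxu, rfl⟩, hn⟩
        exact ⟨_, ⟨(hmem _).2 ⟨x, hx, hxu, rfl⟩, by rwa [label_edge h hx]⟩, label_edge h hx⟩
    · rintro q ⟨hq, -⟩ q' ⟨hq', -⟩ hqq
      obtain ⟨x, hx, hxu, rfl⟩ := (hmem q).1 hq
      obtain ⟨y, hy, hyu, rfl⟩ := (hmem q').1 hq'
      rw [label_edge h hx, label_edge h hy] at hqq
      have hcc := h.isClassSystem.classLabel_inj hx hy hqq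
      have := (h.of_mem hy (hcc ▸ h.mem_self hx)).2.2
      rw [hcc, this]
  constructor
  · rintro ⟨hi, q, hq, hqu, hr⟩
    obtain ⟨x, hx, hxu, rfl⟩ := (hmem q).1 hq
    rw [hcount, label_edge h hx] at hr
    exact ⟨hi, x, ⟨hx, hqu⟩, hr⟩
  · rintro ⟨hi, x, ⟨hx, hxu⟩, hr⟩
    refine ⟨hi, _, (hmem _).2 ⟨x, hx, (children_spec h hv x ⟨hx, hxu⟩).2.1, rfl⟩, hxu, ?_⟩
    rw [hcount, label_edge h hx]
    exact hr

end Star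

/-- The parents and classes after the star-reductions at `1, …, k`. -/
noncomputable def starStages (p : Vertex → Vertex) (c : Vertex → Set Vertex) :
    ℕ → (Vertex → Vertex) × (Vertex → Set Vertex)
  | 0 => (p, c)
  | k + 1 => (starParent (starStages p c k).1 k.succPNat,
      mergeClass (starStages p c k).2 k.succPNat (children (starStages p c k).1 k.succPNat))

theorem succPNat_ne_top (k : ℕ) : (k.succPNat : Vertex) ≠ ⊤ := WithTop.coe_ne_top

theorem succPNat_inj {j k : ℕ} : (j.succPNat : Vertex) = k.succPNat ↔ j = k := by
  rw [WithTop.coe_inj, Nat.succPNat_inj]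

theorem eq_top_or_eq_succPNat (x : Vertex) : x = ⊤ ∨ ∃ k : ℕ, x = k.succPNat := by
  induction x using WithTop.recTopCoe with
  | top => exact Or.inl rfl
  | coe u => exact Or.inr ⟨u.natPred, by rw [PNat.succPNat_natPred]⟩

section Stages

variable {p : Vertex → Vertex} {c : Vertex → Set Vertex} (h : ParentSystem ⊤ p c)
include h

theorem parentSystem_starStages (k : ℕ) :
    ParentSystem ⊤ (starStages p c k).1 (starStages p c k).2 := by
  induction k with
  | zero => exact h
  | succ k ih => exact parentSystem_star ih (succPNat_ne_top k)

-- A parent `a` is replaced only by the star-reduction at `a` itself.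
omit h in
theorem starStages_parent_mono {a : Vertex} {j k : ℕ} (hjk : j ≤ k) {x : Vertex}
    (hx : (starStages p c j).1 x = a)
    (ha : ∀ i < k, a ≠ i.succPNat) : (starStages p c k).1 x = a := by
  induction k, hjk using Nat.le_induction with
  | base => exact hx
  | succ k hjk ih =>
    have h1 := ih fun i hi => ha i (by omega)
    change starParent _ _ x = a
    rw [starParent_of_ne (h1 ▸ ha k (by omega)), h1]

theorem class_subset_succ {x : Vertex} (hx : x ≠ ⊤) (k : ℕ) :
    (starStages p c k).2 x ⊆ (starStages p c (k + 1)).2 x :=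
  have hk := parentSystem_starStages h k
  hk.isClassSystem.class_subset_merge (succPNat_ne_top k) (children_spec hk (succPNat_ne_top k)) hx

theorem class_mono {x : Vertex} (hx : x ≠ ⊤) {j k : ℕ} (hjk : j ≤ k) :
    (starStages p c j).2 x ⊆ (starStages p c k).2 x := by
  induction k, hjk using Nat.le_induction with
  | base => exact subset_rfl
  | succ k _ ih => exact ih.trans (class_subset_succ h hx k)

end Stages

end PrueferCode

/-! ### Stages of the construction of the word -/

namespace IdeallyRootedHypertree

open PrueferCode ParentSystem

section Stage

variable {T : IdeallyRootedHypertree Vertex ⊤} {p : Vertex → Vertex} {c : Vertex → Set Vertex}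
  (h : ParentSystem ⊤ p c) (hM : T.markedEdges = ParentSystem.markedEdges ⊤ p c)
include h hM

theorem stage_fst (k : ℕ) :
    (T.stage k).1 = ParentSystem.markedEdges ⊤ (starStages p c k).1 (starStages p c k).2 := by
  induction k with
  | zero => exact hM
  | succ k ih =>
    change starReduction _ _ = _
    rw [ih, starReduction_markedEdges (parentSystem_starStages h k)]
    rfl

theorem receives_stage_iff (k i : ℕ) :
    Receives k.succPNat (T.stage k).1 (T.stage k).2 i ↔ i ∈ (T.stage k).2 ∧
      ∃ x ∈ children (starStages p c k).1 k.succPNat, rank (T.stage k).2 i =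
        rank (labelsAvoiding (starStages p c k).2 k.succPNat)
          (classLabel (starStages p c k).2 x) := by
  rw [stage_fst h hM, receives_iff (parentSystem_starStages h k)]

/-- This invariant makes the matching of each stage a bijection, also when a vertex of infinite
degree has been reduced and only finitely many classes are left. It starts with infinity on both
sides, which is where infinitely many hyperedges are needed. -/
theorem encard_labels_stage (hinf : (labels c).Infinite) (k : ℕ) :
    (labels (starStages p c k).2).encard = (T.stage k).2.encard + 1 := by
  induction k with
  | zero =>
    change (labels c).encard = (Set.univ : Set ℕ).encard + 1
    rw [hinf.encard_eq, Set.infinite_univ.encard_eq]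
    rfl
  | succ k ih =>
    have hk := parentSystem_starStages h k
    refine (hk.isClassSystem.encard_labels_merge (succPNat_ne_top k)
      (children_spec hk (succPNat_ne_top k)) ih).trans ?_
    congr 2
    ext i
    refine and_congr_right fun hi => not_congr ?_
    rw [receives_stage_iff h hM]
    exact (and_iff_right hi).symm

end Stage

variable (T : IdeallyRootedHypertree Vertex ⊤)

theorem mem_stage_iff (k i : ℕ) : i ∈ (T.stage k).2 ↔
    ∀ j < k, ¬ Receives j.succPNat (T.stage j).1 (T.stage j).2 i := by
  induction k with
  | zero => simp [stage]
  | succ k ih =>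
    change (i ∈ (T.stage k).2 ∧ _) ↔ _
    rw [ih, Nat.forall_lt_succ_right]

theorem prueferWord_eq_iff (k i : ℕ) : T.prueferWord i = k.succPNat ↔
    Receives k.succPNat (T.stage k).1 (T.stage k).2 i := by
  classical
  constructor
  · intro hk
    unfold prueferWord at hk
    split at hk
    · rename_i hex
      rw [succPNat_inj] at hk
      have := Nat.find_spec hex
      rwa [hk] at this
    · exact (succPNat_ne_top k hk.symm).elim
  · intro hk
    have hex : ∃ k : ℕ, Receives k.succPNat (T.stage k).1 (T.stage k).2 i := ⟨k, hk⟩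
    unfold prueferWord
    rw [dif_pos hex, succPNat_inj, Nat.find_eq_iff]
    exact ⟨hk, (T.mem_stage_iff k i).1 hk.1⟩

theorem mem_stage_iff_word (k i : ℕ) : i ∈ (T.stage k).2 ↔
    ∀ j < k, T.prueferWord i ≠ j.succPNat := by
  rw [mem_stage_iff]
  exact forall₂_congr fun j _ => not_congr (T.prueferWord_eq_iff j i).symm

theorem prueferWord_eq_top_iff (i : ℕ) : T.prueferWord i = ⊤ ↔ ∀ k, i ∈ (T.stage k).2 := by
  constructor
  · intro hi k
    rw [mem_stage_iff_word, hi]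
    exact fun j _ => (succPNat_ne_top j).symm
  · intro hi
    obtain h | ⟨k, hk⟩ := eq_top_or_eq_succPNat (T.prueferWord i)
    · exact h
    · exact ((T.mem_stage_iff_word (k + 1) i).1 (hi _) k (Nat.lt_succ_self k) hk).elim

end IdeallyRootedHypertree

/-! ### Reading the classes off the word: injectivity -/

namespace PrueferCode

open ParentSystem

theorem finite_image_of_factor {α β γ : Type*} {D : Set α} {f : α → β} {g : α → γ}
    (hfg : ∀ x ∈ D, ∀ y ∈ D, g x = g y → f x = f y) (hg : (g '' D).Finite) : (f '' D).Finite := by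
  classical
  rcases D.eq_empty_or_nonempty with rfl | ⟨a, -⟩
  · simp
  have hex : ∀ b, ∃ x, b ∈ g '' D → x ∈ D ∧ g x = b := by
    intro b
    by_cases hb : b ∈ g '' D
    · obtain ⟨x, hx⟩ := hb
      exact ⟨x, fun _ => hx⟩
    · exact ⟨a, fun h => (hb h).elim⟩
  choose s hs using hex
  refine (hg.image fun b => f (s b)).subset ?_
  rintro _ ⟨x, hx, rfl⟩
  obtain ⟨h1, h2⟩ := hs (g x) ⟨x, hx, rfl⟩
  exact ⟨g x, ⟨x, hx, rfl⟩, hfg _ h1 _ hx h2⟩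

/-- The finite vertices of a set of vertices. -/
def finitePart (s : Set Vertex) : Set ℕ+ := {v | (v : Vertex) ∈ s}

/-- The parts of the partition of the finite vertices into classes. -/
def parts (c : Vertex → Set Vertex) : Set (Set ℕ+) := {s | ∃ x ≠ ⊤, s = finitePart (c x)}

theorem labels_eq_image (c : Vertex → Set Vertex) : labels c = classLabel c '' {⊤}ᶜ := by
  ext l
  exact exists_congr fun x => and_congr_right fun _ => eq_comm

theorem parts_eq_image (c : Vertex → Set Vertex) :
    parts c = (fun x => finitePart (c x)) '' {⊤}ᶜ := by
  ext l
  exact exists_congr fun x => and_congr_right fun _ => eq_comm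

theorem edges_eq_image (p : Vertex → Vertex) (c : Vertex → Set Vertex) :
    edges ⊤ p c = (fun x => insert (p x) (c x)) '' {⊤}ᶜ := by
  ext l
  exact exists_congr fun x => and_congr_right fun _ => eq_comm

namespace IsClassSystem

variable {c : Vertex → Set Vertex} (hc : IsClassSystem c)
include hc

theorem image_finitePart {x : Vertex} (hx : x ≠ ⊤) :
    (fun u : ℕ+ => (u : Vertex)) '' finitePart (c x) = c x := by
  ext y
  constructor
  · rintro ⟨u, hu, rfl⟩
    exact hu
  · intro hy
    obtain ⟨u, rfl⟩ := WithTop.ne_top_iff_exists.1 (hc.of_mem hx hy).1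
    exact ⟨u, hy, rfl⟩

theorem infinite_labels_iff : (labels c).Infinite ↔ (parts c).Infinite := by
  rw [labels_eq_image, parts_eq_image, Set.Infinite, Set.Infinite, not_iff_not]
  constructor
  · refine finite_image_of_factor fun x hx y hy hxy => ?_
    rw [hc.classLabel_inj hx hy hxy]
  · refine finite_image_of_factor fun x hx y hy hxy => ?_
    have hcc : c x = c y := by
      rw [← hc.image_finitePart hx, ← hc.image_finitePart hy]
      exact congrArg _ hxy
    simp only [classLabel, hcc]

end IsClassSystem

theorem infinite_edges_iff {p : Vertex → Vertex} {c : Vertex → Set Vertex}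
    (h : ParentSystem ⊤ p c) : (edges ⊤ p c).Infinite ↔ (parts c).Infinite := by
  rw [edges_eq_image, parts_eq_image, Set.Infinite, Set.Infinite, not_iff_not]
  constructor
  · refine finite_image_of_factor fun x hx y hy hxy => ?_
    have hxm : x ∈ insert (p y) (c y) := hxy ▸ Set.mem_insert_of_mem _ (h.mem_self hx)
    have hym : y ∈ insert (p x) (c x) := hxy ▸ Set.mem_insert_of_mem _ (h.mem_self hy)
    rcases hxm with hxm | hxm
    · rcases hym with hym | hym
      · exact (h.acyclic (n := 2) hx two_pos (by
          change p (p x) = x; rw [← hym, ← hxm])).elim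
      · rw [(h.of_mem hx hym).2.1]
    · rw [(h.of_mem hy hxm).2.1]
  · refine finite_image_of_factor fun x hx y hy hxy => ?_
    have hcc : c x = c y := by
      rw [← h.isClassSystem.image_finitePart hx, ← h.isClassSystem.image_finitePart hy]
      exact congrArg _ hxy
    change insert (p x) (c x) = insert (p y) (c y)
    rw [(h.of_mem hy (hcc ▸ h.mem_self hx)).2.2, hcc]

/-- The positions of the word which carry none of the letters `1, …, k`. -/
def remaining (W : ℕ → Vertex) (k : ℕ) : Set ℕ := {i | ∀ j < k, W i ≠ j.succPNat}

/-- The vertices of the classes matched with the positions carrying the letter `k + 1`. -/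
def received (c : Vertex → Set Vertex) (W : ℕ → Vertex) (k : ℕ) : Set Vertex :=
  {x | x ≠ ⊤ ∧ x ∉ c k.succPNat ∧ ∃ i ∈ remaining W k, W i = k.succPNat ∧
    rank (remaining W k) i = rank (labelsAvoiding c k.succPNat) (classLabel c x)}

/-- The classes after `k` steps, reconstructed from the word. -/
noncomputable def decodeClass (c : Vertex → Set Vertex) (W : ℕ → Vertex) :
    ℕ → Vertex → Set Vertex
  | 0 => c
  | k + 1 => mergeClass (decodeClass c W k) k.succPNat (received (decodeClass c W k) W k)

theorem mem_remaining_of_eq {W : ℕ → Vertex} {k i : ℕ} (h : W i = k.succPNat) :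
    i ∈ remaining W k := by
  intro j hj hij
  rw [h, succPNat_inj] at hij
  omega

theorem stage_snd_eq_remaining (T : IdeallyRootedHypertree Vertex ⊤) (k : ℕ) :
    (T.stage k).2 = remaining T.prueferWord k :=
  Set.ext fun i => T.mem_stage_iff_word k i

section Encode

variable {T : IdeallyRootedHypertree Vertex ⊤} {p : Vertex → Vertex} {c : Vertex → Set Vertex}
  (h : ParentSystem ⊤ p c) (hM : T.markedEdges = ParentSystem.markedEdges ⊤ p c)
include h hM

theorem prueferPartition_eq : T.prueferPartition = parts c := by
  ext s
  constructor
  · rintro ⟨q, hq, rfl⟩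
    rw [hM] at hq
    obtain ⟨x, hx, rfl⟩ := hq
    exact ⟨x, hx, by rw [reduced_edge h hx]; rfl⟩
  · rintro ⟨x, hx, rfl⟩
    refine ⟨(insert (p x) (c x), p x), by rw [hM]; exact ⟨x, hx, rfl⟩, ?_⟩
    rw [reduced_edge h hx]; rfl

theorem infinite_labels (hinf : E(T.toHypergraph).Infinite) : (labels c).Infinite := by
  rw [h.isClassSystem.infinite_labels_iff, ← infinite_edges_iff h,
    ← T.edgeSet_eq_of_markedEdges_eq hM]
  exact hinf

theorem encard_remaining (hinf : E(T.toHypergraph).Infinite) (k : ℕ) :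
    (T.stage k).2.encard = (labelsAvoiding (starStages p c k).2 k.succPNat).encard := by
  have h1 := T.encard_labels_stage h hM (infinite_labels h hM hinf) k
  rw [(parentSystem_starStages h k).isClassSystem.encard_labels (succPNat_ne_top k)] at h1
  exact (WithTop.add_right_cancel ENat.one_ne_top h1).symm

/-- Every class other than that of the vertex being reduced has a position, by equality of
cardinalities, and classes of equal rank coincide. Hence the word and the present classes determine
which classes are merged. -/
theorem children_eq_received (hinf : E(T.toHypergraph).Infinite) (k : ℕ) :
    children (starStages p c k).1 k.succPNat = received (starStages p c k).2 T.prueferWord k := by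
  have hk := parentSystem_starStages h k
  have hsp := children_spec hk (succPNat_ne_top k)
  have hR := stage_snd_eq_remaining T k
  ext x
  constructor
  · intro hx
    obtain ⟨h1, h2, h3⟩ := hsp x hx
    obtain ⟨i, hi, hix⟩ : rank (labelsAvoiding (starStages p c k).2 k.succPNat)
        (classLabel (starStages p c k).2 x) ∈ rank (T.stage k).2 '' (T.stage k).2 := by
      rw [image_rank_eq (encard_remaining h hM hinf k)]
      exact ⟨_, ⟨x, h1, h2, rfl⟩, rfl⟩
    refine ⟨h1, h2, i, hR ▸ hi, ?_, hR ▸ hix⟩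
    rw [T.prueferWord_eq_iff, T.receives_stage_iff h hM]
    exact ⟨hi, x, hx, hix⟩
  · rintro ⟨h1, h2, i, hi, hW, hr⟩
    rw [T.prueferWord_eq_iff, T.receives_stage_iff h hM, hR] at hW
    obtain ⟨-, y, hy, hyr⟩ := hW
    obtain ⟨h3, h4, h5⟩ := hsp y hy
    have := rank_injOn _ (show _ ∈ labelsAvoiding _ _ from ⟨x, h1, h2, rfl⟩)
      (show _ ∈ labelsAvoiding _ _ from ⟨y, h3, h4, rfl⟩) (hr.symm.trans hyr)
    exact h5 (hk.isClassSystem.classLabel_inj h1 h3 this ▸ hk.mem_self h1)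

theorem starStages_snd_eq_decodeClass (hinf : E(T.toHypergraph).Infinite) (k : ℕ) :
    (starStages p c k).2 = decodeClass c T.prueferWord k := by
  induction k with
  | zero => rfl
  | succ k ih =>
    change mergeClass _ _ _ = mergeClass _ _ _
    rw [children_eq_received h hM hinf, ih]

theorem eq_succPNat_of_mem_received (hinf : E(T.toHypergraph).Infinite) {x : Vertex} {k : ℕ}
    (hx : x ∈ received (decodeClass c T.prueferWord k) T.prueferWord k) :
    (starStages p c k).1 x = k.succPNat := by
  rw [← starStages_snd_eq_decodeClass h hM hinf, ← children_eq_received h hM hinf] at hx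
  exact hx.2

theorem mem_received_of_parent_eq (hinf : E(T.toHypergraph).Infinite) {x : Vertex} (hx : x ≠ ⊤)
    {k : ℕ} (hk : p x = k.succPNat) :
    x ∈ received (decodeClass c T.prueferWord k) T.prueferWord k := by
  rw [← starStages_snd_eq_decodeClass h hM hinf, ← children_eq_received h hM hinf]
  refine ⟨hx, starStages_parent_mono (Nat.zero_le k) hk fun i hi => ?_⟩
  rw [Ne, succPNat_inj]
  omega

end Encode

/-- The vertex `x` is received at step `k` in `T'` as well. If its original parent in `T'` had not
been reduced before that step, it would still be the parent then, hence equal to `k + 1`. Exchanging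
`T` and `T'` gives equality of parents. -/
theorem parent_le_of_word_eq {T T' : IdeallyRootedHypertree Vertex ⊤} {p p' : Vertex → Vertex}
    {c : Vertex → Set Vertex} (h : ParentSystem ⊤ p c)
    (hM : T.markedEdges = ParentSystem.markedEdges ⊤ p c) (h' : ParentSystem ⊤ p' c)
    (hM' : T'.markedEdges = ParentSystem.markedEdges ⊤ p' c)
    (hinf : E(T.toHypergraph).Infinite) (hinf' : E(T'.toHypergraph).Infinite)
    (hW : T.prueferWord = T'.prueferWord) {x : Vertex} (hx : x ≠ ⊤) {k : ℕ}
    (hk : p x = k.succPNat) : ∃ j ≤ k, p' x = j.succPNat := by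
  have h1 := mem_received_of_parent_eq h hM hinf hx hk
  rw [hW] at h1
  have h2 := eq_succPNat_of_mem_received h' hM' hinf' h1
  by_contra hj
  have h3 : (starStages p' c k).1 x = p' x := by
    refine starStages_parent_mono (Nat.zero_le k) rfl fun i hi hi' => ?_
    exact hj ⟨i, hi.le, hi'⟩
  exact hj ⟨k, le_rfl, h3.symm.trans h2⟩

theorem prueferCode_injOn : Set.InjOn IdeallyRootedHypertree.prueferCode
    {T : IdeallyRootedHypertree Vertex ⊤ | E(T.toHypergraph).Infinite} := by
  intro T hinf T' hinf' hcode
  obtain ⟨p, c, h, hM, -⟩ := T.exists_parentSystem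
  obtain ⟨p', c', h', hM', -⟩ := T'.exists_parentSystem
  have hP : parts c = parts c' := by
    rw [← prueferPartition_eq h hM, ← prueferPartition_eq h' hM']
    exact congrArg Prod.fst hcode
  have hW : T.prueferWord = T'.prueferWord := congrArg Prod.snd hcode
  -- The value of a class map at `⊤` is arbitrary, so `c` and `c'` can only be compared at finite
  -- vertices; afterwards `p'` is paired with `c`.
  have hcc : ∀ x ≠ ⊤, c' x = c x := by
    intro x hx
    obtain ⟨u, rfl⟩ := WithTop.ne_top_iff_exists.1 hx
    obtain ⟨y, hy, hyu⟩ : finitePart (c u) ∈ parts c' := hP ▸ ⟨u, hx, rfl⟩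
    have huy : (u : Vertex) ∈ c' y := by
      have : u ∈ finitePart (c u) := h.mem_self hx
      rw [hyu] at this
      exact this
    rw [(h'.of_mem hy huy).2.1, ← h'.isClassSystem.image_finitePart hy, ← hyu,
      h.isClassSystem.image_finitePart hx]
  have hPS : ParentSystem ⊤ p' c := by
    refine ⟨h'.root, h.mem_self, fun {x y} hx hy => ?_, h'.acyclic⟩
    obtain ⟨h1, h2, -⟩ := h.of_mem hx hy
    rw [← hcc x hx] at hy
    exact ⟨h1, h2, (h'.of_mem hx hy).2.2⟩
  have hM'' : T'.markedEdges = ParentSystem.markedEdges ⊤ p' c := by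
    rw [hM']
    ext q
    exact exists_congr fun x => and_congr_right fun hx => by rw [hcc x hx]
  have hpp : ∀ x ≠ ⊤, p x = p' x := by
    intro x hx
    rcases eq_top_or_eq_succPNat (p x) with h1 | ⟨k, hk⟩
    · rcases eq_top_or_eq_succPNat (p' x) with h2 | ⟨l, hl⟩
      · rw [h1, h2]
      · obtain ⟨j, -, hj⟩ := parent_le_of_word_eq hPS hM'' h hM hinf' hinf hW.symm hx hl
        exact (succPNat_ne_top j (hj.symm.trans h1)).elim
    · obtain ⟨j, hjk, hj⟩ := parent_le_of_word_eq h hM hPS hM'' hinf hinf' hW hx hk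
      obtain ⟨i, hij, hi⟩ := parent_le_of_word_eq hPS hM'' h hM hinf' hinf hW.symm hx hj
      rw [hk, succPNat_inj] at hi
      rw [hk, hj, succPNat_inj]
      omega
  apply IdeallyRootedHypertree.markedEdges_injective
  rw [hM, hM'']
  ext q
  exact exists_congr fun x => and_congr_right fun hx => by rw [hpp x hx]

theorem isPartition_parts {c : Vertex → Set Vertex} (hc : IsClassSystem c) :
    Setoid.IsPartition (parts c) := by
  constructor
  · rintro ⟨x, hx, he⟩
    obtain ⟨u, rfl⟩ := WithTop.ne_top_iff_exists.1 hx
    have : u ∈ finitePart (c u) := hc.mem_self hx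
    rw [← he] at this
    exact this
  · intro u
    have hu : (u : Vertex) ≠ ⊤ := WithTop.coe_ne_top
    refine ⟨finitePart (c u), ⟨⟨u, hu, rfl⟩, hc.mem_self hu⟩, ?_⟩
    rintro _ ⟨⟨x, hx, rfl⟩, hux⟩
    rw [(hc.of_mem hx hux).2]

theorem prueferCode_mapsTo : Set.MapsTo IdeallyRootedHypertree.prueferCode
    {T : IdeallyRootedHypertree Vertex ⊤ | E(T.toHypergraph).Infinite}
    {c : Set (Set ℕ+) × (ℕ → Vertex) | Setoid.IsPartition c.1 ∧ c.1.Infinite} := by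
  intro T hinf
  obtain ⟨p, c, h, hM, hE⟩ := T.exists_parentSystem
  change Setoid.IsPartition T.prueferPartition ∧ T.prueferPartition.Infinite
  rw [prueferPartition_eq h hM]
  refine ⟨isPartition_parts h.isClassSystem, (infinite_edges_iff h).1 ?_⟩
  rw [← hE]
  exact hinf

end PrueferCode

/-! ### Decoding an arbitrary word: surjectivity -/

namespace PrueferCode

open ParentSystem

/-- The vertex numbered by the smallest element of `S`. -/
noncomputable def firstIn (S : Set ℕ) : Vertex :=
  open Classical in if h : ∃ j, j ∈ S then ((Nat.find h).succPNat : Vertex) else ⊤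

theorem firstIn_eq_iff {S : Set ℕ} {k : ℕ} :
    firstIn S = k.succPNat ↔ k ∈ S ∧ ∀ j < k, j ∉ S := by
  classical
  unfold firstIn
  split
  · rename_i h
    rw [succPNat_inj, Nat.find_eq_iff]
  · rename_i h
    exact ⟨fun h' => (succPNat_ne_top k h'.symm).elim, fun h' => (h ⟨k, h'.1⟩).elim⟩

theorem received_spec {c : Vertex → Set Vertex} (hc : IsClassSystem c) (W : ℕ → Vertex) (k : ℕ) :
    ∀ x ∈ received c W k, x ≠ ⊤ ∧ x ∉ c k.succPNat ∧ c x ⊆ received c W k := by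
  rintro x ⟨hx, hxk, i, hi, hW, hr⟩
  refine ⟨hx, hxk, fun y hy => ?_⟩
  obtain ⟨hy', hyx⟩ := hc.of_mem hx hy
  refine ⟨hy', fun h => hxk ?_, i, hi, hW, ?_⟩
  · rw [← (hc.of_mem (succPNat_ne_top k) h).2, hyx]
    exact hc.mem_self hx
  · simpa only [classLabel, hyx] using hr

section Decode

variable {c : Vertex → Set Vertex} (hc : IsClassSystem c) (W : ℕ → Vertex)
include hc

theorem isClassSystem_decodeClass (k : ℕ) : IsClassSystem (decodeClass c W k) := by
  induction k with
  | zero => exact hc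
  | succ k ih => exact ih.merge (succPNat_ne_top k) (received_spec ih W k)

theorem decodeClass_mono {x : Vertex} (hx : x ≠ ⊤) {j k : ℕ} (hjk : j ≤ k) :
    decodeClass c W j x ⊆ decodeClass c W k x := by
  induction k, hjk using Nat.le_induction with
  | base => exact subset_rfl
  | succ k _ ih =>
    have hk := isClassSystem_decodeClass hc W k
    exact ih.trans (hk.class_subset_merge (succPNat_ne_top k) (received_spec hk W k) hx)

/-- The vertices matched with the letter `k + 1`. -/
local notation "𝒢" => fun k : ℕ => received (decodeClass c W k) W k

theorem mem_decodeClass_of_mem_received {x : Vertex} {j k : ℕ} (hjk : j < k) (hx : x ∈ (𝒢) j) :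
    x ∈ decodeClass c W k j.succPNat := by
  refine decodeClass_mono hc W (succPNat_ne_top j) (Nat.succ_le_iff.2 hjk) ?_
  have hj := isClassSystem_decodeClass hc W j
  change x ∈ mergeClass _ _ _ _
  rw [mergeClass_of_mem (Or.inl (hj.mem_self (succPNat_ne_top j)))]
  exact Or.inr hx

theorem mem_received_congr {x y : Vertex} (hx : x ≠ ⊤) {k : ℕ} (hy : y ∈ decodeClass c W k x) :
    y ∈ (𝒢) k ↔ x ∈ (𝒢) k := by
  have hk := isClassSystem_decodeClass hc W k
  obtain ⟨hy', hyx⟩ := hk.of_mem hx hy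
  refine ⟨fun h => (received_spec hk W k y h).2.2 (hyx ▸ hk.mem_self hx),
    fun h => (received_spec hk W k x h).2.2 hy⟩

omit hc in
/-- The parents after `k` steps, reconstructed from the word. -/
noncomputable def decodeParent (c : Vertex → Set Vertex) (W : ℕ → Vertex) (k : ℕ) (x : Vertex) :
    Vertex :=
  firstIn {j | k ≤ j ∧ x ∈ received (decodeClass c W j) W j}

omit hc in
theorem decodeParent_eq_iff {k : ℕ} {x : Vertex} :
    decodeParent c W k x = k.succPNat ↔ x ∈ (𝒢) k := by
  rw [decodeParent, firstIn_eq_iff]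
  exact ⟨fun h => h.1.2, fun h => ⟨⟨le_rfl, h⟩, fun j hj hj' => absurd hj'.1 (not_le.2 hj)⟩⟩

omit hc in
theorem mem_received_of_decodeParent_eq {k : ℕ} {x : Vertex}
    (h : decodeParent c W 0 x = k.succPNat) : x ∈ (𝒢) k :=
  (firstIn_eq_iff.1 h).1.2

omit hc in
theorem decodeParent_top (k : ℕ) : decodeParent c W k ⊤ = ⊤ := by
  rcases eq_top_or_eq_succPNat (decodeParent c W k ⊤) with h | ⟨j, hj⟩
  · exact h
  · exact ((firstIn_eq_iff.1 hj).1.2.1 rfl).elim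

/-- A vertex received at step `k` shares its class with the vertex `k + 1` from then on, so both are
received at the same later steps. Nor is `k + 1` received at step `k`, since received classes avoid
its own. -/
theorem decodeParent_succ (k : ℕ) :
    decodeParent c W (k + 1) = starParent (decodeParent c W k) k.succPNat := by
  funext x
  have hk := isClassSystem_decodeClass hc W k
  by_cases hx : x ∈ (𝒢) k
  · rw [starParent_of_eq ((decodeParent_eq_iff W).2 hx), decodeParent, decodeParent]
    congr 1
    ext j
    constructor
    · rintro ⟨hj, hxj⟩
      refine ⟨by omega, ?_⟩
      exact (mem_received_congr hc W (succPNat_ne_top k)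
        (mem_decodeClass_of_mem_received hc W (by omega) hx)).1 hxj
    · rintro ⟨hj, hvj⟩
      have hne : j ≠ k := by
        rintro rfl
        exact hvj.2.1 (hk.mem_self (succPNat_ne_top j))
      refine ⟨by omega, (mem_received_congr hc W (succPNat_ne_top k)
        (mem_decodeClass_of_mem_received hc W (by omega) hx)).2 hvj⟩
  · rw [starParent_of_ne (mt (decodeParent_eq_iff W).1 hx), decodeParent, decodeParent]
    congr 1
    ext j
    refine ⟨fun hj => ⟨by have := hj.1; omega, hj.2⟩, fun hj => ⟨?_, hj.2⟩⟩
    refine Nat.succ_le_of_lt (lt_of_le_of_ne hj.1 ?_)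
    rintro rfl
    exact hx hj.2

/-- On a cycle consider the largest vertex and the first return to it. All letters in between are
smaller, so by its turn the vertices of this stretch have been merged into its class. The last of
them should be received by it, but received vertices lie outside that class. -/
theorem decodeParent_acyclic {x : Vertex} {n : ℕ} (hx : x ≠ ⊤) (hn : 0 < n) :
    (decodeParent c W 0)^[n] x ≠ x := by
  intro hper
  set p := decodeParent c W 0 with hp
  have hpt : p ⊤ = ⊤ := decodeParent_top W 0
  have hne : ∀ i, p^[i] x ≠ ⊤ := by
    intro i hi
    apply hx
    have h1 : p^[n * i] x = x := by
      rw [Function.iterate_mul]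
      exact Function.iterate_fixed hper i
    have h2 : n * i = (n * i - i) + i := by
      have := Nat.le_mul_of_pos_left i hn
      omega
    rw [h2, Function.iterate_add_apply, hi, Function.iterate_fixed hpt] at h1
    exact h1.symm
  choose f hf using fun i => (eq_top_or_eq_succPNat (p^[i] x)).resolve_left (hne i)
  have hmod : ∀ i, f (i % n) = f i := by
    intro i
    rw [← succPNat_inj, ← hf, ← hf]
    conv_rhs => rw [← Nat.mod_add_div i n, Function.iterate_add_apply, Function.iterate_mul,
      Function.iterate_fixed hper]
  obtain ⟨i, -, hmax⟩ := Finset.exists_max_image (Finset.range n) f ⟨0, by simpa using hn⟩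
  have hmax' : ∀ j, f j ≤ f i := fun j => by
    rw [← hmod j]
    exact hmax _ (Finset.mem_range.2 (Nat.mod_lt j hn))
  classical
  have hex : ∃ m, 0 < m ∧ f (i + m) = f i := ⟨n, hn, by rw [← hmod, Nat.add_mod_right, hmod]⟩
  obtain ⟨hm0, hm⟩ := Nat.find_spec hex
  have hmin : ∀ j < Nat.find hex, 0 < j → f (i + j) < f i := fun j hj hj0 =>
    lt_of_le_of_ne (hmax' _) fun h => Nat.find_min hex hj ⟨hj0, h⟩
  have hrec : ∀ j, p^[j] x ∈ (𝒢) (f (j + 1)) := by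
    intro j
    apply mem_received_of_decodeParent_eq W
    rw [← hf, Function.iterate_succ_apply']
  set K := f i with hK
  have hsys := isClassSystem_decodeClass hc W K
  have hcl : ∀ j < Nat.find hex, p^[i + j] x ∈ decodeClass c W K K.succPNat := by
    intro j
    induction j with
    | zero =>
      intro _
      rw [add_zero, hf]
      exact hsys.mem_self (succPNat_ne_top K)
    | succ j ih =>
      intro hj
      have h1 := ih (by omega)
      have h2 := mem_decodeClass_of_mem_received hc W (hmin (j + 1) hj (by omega)) (hrec (i + j))
      have h3 : p^[i + (j + 1)] x = (f (i + (j + 1))).succPNat := hf _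
      rw [← h3] at h2
      obtain ⟨h4, h5⟩ := hsys.of_mem (hne _) h2
      rw [← (hsys.of_mem (succPNat_ne_top K) h1).2, h5]
      exact hsys.mem_self (hne _)
  obtain ⟨m, hmm⟩ := Nat.exists_eq_succ_of_ne_zero hm0.ne'
  have h1 := hcl m (by omega)
  have h2 := hrec (i + m)
  rw [add_assoc, ← Nat.succ_eq_add_one, ← hmm, hm] at h2
  exact h2.2.1 h1

theorem parentSystem_decode : ParentSystem ⊤ (decodeParent c W 0) c := by
  refine ⟨decodeParent_top W 0, hc.mem_self, fun {x y} hx hy => ?_, decodeParent_acyclic hc W⟩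
  refine ⟨(hc.of_mem hx hy).1, (hc.of_mem hx hy).2, ?_⟩
  rw [decodeParent, decodeParent]
  congr 1
  ext j
  exact and_congr_right fun _ =>
    mem_received_congr hc W hx (decodeClass_mono hc W hx (Nat.zero_le j) hy)

theorem starStages_decode (k : ℕ) :
    starStages (decodeParent c W 0) c k = (decodeParent c W k, decodeClass c W k) := by
  induction k with
  | zero => rfl
  | succ k ih =>
    have hch : children (decodeParent c W k) k.succPNat = (𝒢) k := by
      ext x
      refine ⟨fun hx => (decodeParent_eq_iff W).1 hx.2, fun hx => ⟨hx.1, (decodeParent_eq_iff W).2 hx⟩⟩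
    rw [starStages, ih, hch, decodeParent_succ hc W]
    rfl

/-- The ideally rooted hypertree with given classes and given word. -/
noncomputable def decodeHypertree : IdeallyRootedHypertree Vertex ⊤ :=
  (parentSystem_decode hc W).toHypertree

theorem decodeHypertree_markedEdges : (decodeHypertree hc W).markedEdges =
    ParentSystem.markedEdges ⊤ (decodeParent c W 0) c :=
  (parentSystem_decode hc W).toHypertree_markedEdges

theorem decodeHypertree_prueferWord (hinf : (labels c).Infinite) :
    (decodeHypertree hc W).prueferWord = W := by
  set T := decodeHypertree hc W
  have h := parentSystem_decode hc W
  have hM : T.markedEdges = _ := decodeHypertree_markedEdges hc W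
  -- The equality of free positions is a hypothesis here because `key` also serves as the inductive
  -- step that proves it for all stages.
  have key : ∀ k, (T.stage k).2 = remaining W k →
      ∀ i, Receives k.succPNat (T.stage k).1 (T.stage k).2 i ↔ W i = k.succPNat := by
    intro k hR i
    have hch : children (decodeParent c W k) k.succPNat = (𝒢) k := by
      ext x
      refine ⟨fun hx => (decodeParent_eq_iff W).1 hx.2, fun hx => ⟨hx.1, (decodeParent_eq_iff W).2 hx⟩⟩
    have hk := isClassSystem_decodeClass hc W k
    have henc := T.encard_labels_stage h hM hinf k
    rw [T.receives_stage_iff h hM, starStages_decode hc W k, hR]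
    rw [starStages_decode hc W k, hR, hk.encard_labels (succPNat_ne_top k)] at henc
    replace henc := WithTop.add_right_cancel ENat.one_ne_top henc
    constructor
    · rintro ⟨hi, x, hx, hr⟩
      rw [hch] at hx
      obtain ⟨-, -, i', hi', hW, hr'⟩ := hx
      rwa [rank_injOn _ hi hi' (hr.trans hr'.symm)]
    · intro hW
      have hi := mem_remaining_of_eq hW
      refine ⟨hi, ?_⟩
      obtain ⟨_, ⟨x, hx, hxk, rfl⟩, hr⟩ : rank (remaining W k) i ∈
          rank (labelsAvoiding (decodeClass c W k) k.succPNat) ''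
            labelsAvoiding (decodeClass c W k) k.succPNat := by
        rw [image_rank_eq henc]
        exact ⟨i, hi, rfl⟩
      refine ⟨x, ?_, hr.symm⟩
      rw [hch]
      exact ⟨hx, hxk, i, hi, hW, hr.symm⟩
  have hR : ∀ k, (T.stage k).2 = remaining W k := by
    intro k
    induction k with
    | zero =>
      ext i
      simp [IdeallyRootedHypertree.stage, remaining]
    | succ k ih =>
      ext i
      change (i ∈ (T.stage k).2 ∧ _) ↔ _
      rw [key k ih, ih]
      exact (Nat.forall_lt_succ_right (p := fun j => W i ≠ j.succPNat)).symm
  have heq : ∀ (k : ℕ) (i : ℕ), T.prueferWord i = k.succPNat ↔ W i = k.succPNat := fun k i => by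
    rw [T.prueferWord_eq_iff, key k (hR k)]
  funext i
  rcases eq_top_or_eq_succPNat (W i) with h1 | ⟨k, hk⟩
  · rcases eq_top_or_eq_succPNat (T.prueferWord i) with h2 | ⟨l, hl⟩
    · rw [h1, h2]
    · rw [hl, (heq l i).1 hl]
  · rw [hk, (heq k i).2 hk]

end Decode

/-- The classes of a partition of the finite vertices. -/
def classOf (P : Set (Set ℕ+)) (x : Vertex) : Set Vertex :=
  {y | ∃ u w : ℕ+, x = u ∧ y = w ∧ ∃ s ∈ P, u ∈ s ∧ w ∈ s}

theorem isClassSystem_classOf {P : Set (Set ℕ+)} (hP : Setoid.IsPartition P) :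
    IsClassSystem (classOf P) := by
  constructor
  · intro x hx
    obtain ⟨u, rfl⟩ := WithTop.ne_top_iff_exists.1 hx
    obtain ⟨s, hs, -⟩ := hP.2 u
    exact ⟨u, u, rfl, rfl, s, hs.1, hs.2, hs.2⟩
  · rintro _ _ - ⟨u, w, rfl, rfl, s, hs, hus, hws⟩
    refine ⟨WithTop.coe_ne_top, ?_⟩
    ext z
    constructor
    · rintro ⟨u', w', hu', rfl, s', hs', hus', hws'⟩
      obtain rfl := WithTop.coe_injective hu'
      obtain rfl := (hP.2 w).unique ⟨hs, hws⟩ ⟨hs', hus'⟩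
      exact ⟨u, w', rfl, rfl, s, hs, hus, hws'⟩
    · rintro ⟨u', w', hu', rfl, s', hs', hus', hws'⟩
      obtain rfl := WithTop.coe_injective hu'
      obtain rfl := (hP.2 u).unique ⟨hs, hus⟩ ⟨hs', hus'⟩
      exact ⟨w, w', rfl, rfl, s, hs, hws, hws'⟩

theorem parts_classOf {P : Set (Set ℕ+)} (hP : Setoid.IsPartition P) : parts (classOf P) = P := by
  have key : ∀ s ∈ P, ∀ u ∈ s, finitePart (classOf P u) = s := by
    intro s hs u hu
    ext w
    constructor
    · rintro ⟨u', w', hu', hw', s', hs', hus', hws'⟩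
      obtain rfl := WithTop.coe_injective hu'
      obtain rfl := WithTop.coe_injective hw'
      rwa [(hP.2 u).unique ⟨hs, hu⟩ ⟨hs', hus'⟩]
    · exact fun hw => ⟨u, w, rfl, rfl, s, hs, hu, hw⟩
  ext s
  constructor
  · rintro ⟨x, hx, rfl⟩
    obtain ⟨u, rfl⟩ := WithTop.ne_top_iff_exists.1 hx
    obtain ⟨s, hs, -⟩ := hP.2 u
    rw [key s hs.1 u hs.2]
    exact hs.1
  · intro hs
    obtain ⟨u, hu⟩ := Setoid.nonempty_of_mem_partition hP hs
    exact ⟨u, WithTop.coe_ne_top, (key s hs u hu).symm⟩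

theorem prueferCode_surjOn : Set.SurjOn IdeallyRootedHypertree.prueferCode
    {T : IdeallyRootedHypertree Vertex ⊤ | E(T.toHypergraph).Infinite}
    {c : Set (Set ℕ+) × (ℕ → Vertex) | Setoid.IsPartition c.1 ∧ c.1.Infinite} := by
  rintro ⟨P, W⟩ ⟨hP, hinf⟩
  have hc := isClassSystem_classOf hP
  have hparts : parts (classOf P) = P := parts_classOf hP
  have hinf' : (parts (classOf P)).Infinite := hparts.symm ▸ hinf
  have h := parentSystem_decode hc W
  have hM := decodeHypertree_markedEdges hc W
  refine ⟨decodeHypertree hc W, (infinite_edges_iff h).2 hinf', Prod.ext ?_ ?_⟩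
  · exact (prueferPartition_eq h hM).trans hparts
  · exact decodeHypertree_prueferWord hc W (hc.infinite_labels_iff.2 hinf')

theorem prueferCode_bijOn : Set.BijOn IdeallyRootedHypertree.prueferCode
    {T : IdeallyRootedHypertree Vertex ⊤ | E(T.toHypergraph).Infinite}
    {c : Set (Set ℕ+) × (ℕ → Vertex) | Setoid.IsPartition c.1 ∧ c.1.Infinite} :=
  ⟨prueferCode_mapsTo, prueferCode_injOn, prueferCode_surjOn⟩

end PrueferCode

/-! ### Multiplicities of letters and local finiteness -/

namespace PrueferCode

open ParentSystem

section Parents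

variable {p : Vertex → Vertex} {c : Vertex → Set Vertex} (h : ParentSystem ⊤ p c)
include h

theorem starStages_parent_ne {j k : ℕ} (hjk : j < k) (x : Vertex) :
    (starStages p c k).1 x ≠ j.succPNat := by
  induction k generalizing x with
  | zero => omega
  | succ k ih =>
    have hk := parentSystem_starStages h k
    change starParent _ _ x ≠ _
    rcases Nat.lt_succ_iff_lt_or_eq.1 hjk with hlt | rfl
    · unfold starParent
      split
      · exact ih hlt _
      · exact ih hlt _
    · by_cases hx : (starStages p c j).1 x = j.succPNat
      · rw [starParent_of_eq hx]
        exact hk.parent_ne (succPNat_ne_top j)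
      · rwa [starParent_of_ne hx]

omit h in
theorem exists_starStages_parent_eq_iterate (k : ℕ) (x : Vertex) :
    ∃ m, (starStages p c k).1 x = p^[m] x := by
  induction k generalizing x with
  | zero => exact ⟨1, rfl⟩
  | succ k ih =>
    obtain ⟨m, hm⟩ := ih x
    by_cases hx : (starStages p c k).1 x = k.succPNat
    · obtain ⟨m', hm'⟩ := ih (k.succPNat : Vertex)
      refine ⟨m' + m, (starParent_of_eq hx).trans ?_⟩
      rw [hm', Function.iterate_add_apply, ← hm, hx]
    · exact ⟨m, (starParent_of_ne hx).trans hm⟩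

/-- Reduction creates no new classes below `a`: whatever becomes attached to `a` has been merged
with an original child of `a`. -/
theorem exists_mem_parent_eq {a : Vertex} (k : ℕ) {x : Vertex} (hx : x ≠ ⊤)
    (hk : (starStages p c k).1 x = a) :
    ∃ y ∈ children p a, y ∈ (starStages p c k).2 x := by
  induction k generalizing x with
  | zero => exact ⟨x, ⟨hx, hk⟩, h.mem_self hx⟩
  | succ k ih =>
    by_cases hxk : (starStages p c k).1 x = k.succPNat
    · obtain ⟨y, hy, hyk⟩ := ih (succPNat_ne_top k) ((starParent_of_eq hxk).symm.trans hk)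
      refine ⟨y, hy, ?_⟩
      change y ∈ mergeClass _ _ _ x
      rw [mergeClass_of_mem (show x ∈ _ ∪ children _ _ from Or.inr ⟨hx, hxk⟩)]
      exact Or.inl hyk
    · obtain ⟨y, hy, hyk⟩ := ih hx ((starParent_of_ne hxk).symm.trans hk)
      exact ⟨y, hy, class_subset_succ h hx k hyk⟩

/-- Classes with the same parent `a` are merged only after the star-reduction at `a`. -/
theorem class_eq_of_starStages_class_eq {a : Vertex} {k : ℕ} (ha : ∀ i < k, a ≠ i.succPNat)
    {x y : Vertex} (hx : x ∈ children p a) (hy : y ∈ children p a)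
    (hxy : (starStages p c k).2 x = (starStages p c k).2 y) : c x = c y := by
  induction k with
  | zero => exact hxy
  | succ k ih =>
    have ha' : ∀ i < k, a ≠ i.succPNat := fun i hi => ha i (by omega)
    refine ih ha' ?_
    have hk := parentSystem_starStages h k
    have hc := hk.isClassSystem
    have hG : ∀ z ∈ children p a, z ∉ children (starStages p c k).1 k.succPNat := by
      rintro z hz ⟨-, hz'⟩
      rw [starStages_parent_mono (Nat.zero_le k) hz.2 ha'] at hz'
      exact ha k (Nat.lt_succ_self k) hz'
    change mergeClass _ _ _ x = mergeClass _ _ _ y at hxy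
    have hy' : y ∈ mergeClass (starStages p c k).2 k.succPNat
        (children (starStages p c k).1 k.succPNat) x := by
      rw [hxy]
      exact (hc.merge (succPNat_ne_top k) (children_spec hk (succPNat_ne_top k))).mem_self hy.1
    by_cases hxD : x ∈ (starStages p c k).2 k.succPNat ∪
        children (starStages p c k).1 k.succPNat
    · rw [mergeClass_of_mem hxD] at hy'
      rw [(hc.of_mem (succPNat_ne_top k) (hxD.resolve_right (hG x hx))).2,
        (hc.of_mem (succPNat_ne_top k) (hy'.resolve_right (hG y hy))).2]
    · rw [mergeClass_of_notMem hxD] at hy'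
      exact (hc.of_mem hx.1 hy').2.symm

/-- Until `a` is reduced, the classes of its children are neither merged with each other nor joined
by additional ones. -/
theorem finite_children_classes_iff {a : Vertex} {k : ℕ} (ha : ∀ i < k, a ≠ i.succPNat) :
    (classLabel (starStages p c k).2 '' children (starStages p c k).1 a).Finite ↔
      (c '' children p a).Finite := by
  have hk := parentSystem_starStages h k
  constructor
  · intro hfin
    refine finite_image_of_factor (g := classLabel (starStages p c k).2) (fun x hx y hy hxy =>
      class_eq_of_starStages_class_eq h ha hx hy
        (hk.isClassSystem.classLabel_inj hx.1 hy.1 hxy)) (hfin.subset (Set.image_mono ?_))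
    exact fun x hx => ⟨hx.1, starStages_parent_mono (Nat.zero_le k) hx.2 ha⟩
  · intro hfin
    have h1 : (classLabel (starStages p c k).2 '' children p a).Finite := by
      refine finite_image_of_factor (g := c) (fun x hx y hy hxy => ?_) hfin
      have h2 : y ∈ (starStages p c k).2 x :=
        class_mono h hx.1 (Nat.zero_le k) (show y ∈ c x from hxy ▸ h.mem_self hy.1)
      simp only [classLabel, (hk.of_mem hx.1 h2).2.1]
    refine h1.subset ?_
    rintro _ ⟨x, hx, rfl⟩
    obtain ⟨y, hy, hyx⟩ := exists_mem_parent_eq h k hx.1 hx.2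
    refine ⟨y, hy, ?_⟩
    simp only [classLabel, (hk.of_mem hx.1 hyx).2.1]

theorem finite_edgesAt_iff {H : Hypergraph Vertex} (hE : E(H) = edges ⊤ p c) (a : Vertex) :
    (H.edgesAt a).Finite ↔ (c '' children p a).Finite := by
  have hsub : (fun x => insert (p x) (c x)) '' children p a ⊆ H.edgesAt a := by
    rintro _ ⟨x, ⟨hx, rfl⟩, rfl⟩
    exact ⟨by rw [hE]; exact ⟨x, hx, rfl⟩, Set.mem_insert _ _⟩
  have hsup : H.edgesAt a ⊆
      insert (insert (p a) (c a)) ((fun x => insert (p x) (c x)) '' children p a) := by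
    rintro e ⟨he, hae⟩
    rw [hE] at he
    obtain ⟨x, hx, rfl⟩ := he
    rcases hae with rfl | hae
    · exact Or.inr ⟨x, ⟨hx, rfl⟩, rfl⟩
    · obtain ⟨-, h2, h3⟩ := h.of_mem hx hae
      exact Or.inl (by rw [h2, h3])
  constructor
  · intro hfin
    refine finite_image_of_factor (fun x hx y hy hxy => ?_) (hfin.subset hsub)
    rw [← reduced_edge h hx.1, ← reduced_edge h hy.1]
    simp only [reduced] at hxy ⊢
    rw [hxy, hx.2, hy.2]
  · intro hfin
    refine (Set.Finite.insert _ (finite_image_of_factor (g := c) (fun x hx y hy hxy => ?_)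
      hfin)).subset hsup
    simp only [hxy, hx.2, hy.2]

omit h in
theorem labels_anti_of_subset {c' : Vertex → Set Vertex} (hc : IsClassSystem c)
    (hc' : IsClassSystem c') (hsub : ∀ x ≠ ⊤, c x ⊆ c' x) : labels c' ⊆ labels c := by
  rintro _ ⟨x, hx, rfl⟩
  obtain ⟨u, hu, hux⟩ := hc'.exists_classLabel hx
  have hu' : (u : Vertex) ≠ ⊤ := WithTop.coe_ne_top
  refine ⟨u, hu', le_antisymm ?_ (hu ▸ classLabel_le (hc.mem_self hu'))⟩
  obtain ⟨w, hw, hwu⟩ := hc.exists_classLabel hu'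
  rw [← hw]
  refine classLabel_le ?_
  rw [← (hc'.of_mem hx hux).2]
  exact hsub _ hu' hwu

omit h in
theorem classLabel_anti {c' : Vertex → Set Vertex} (hc : IsClassSystem c) {x : Vertex} (hx : x ≠ ⊤)
    (hsub : c x ⊆ c' x) : classLabel c' x ≤ classLabel c x := by
  obtain ⟨u, hu, hux⟩ := hc.exists_classLabel hx
  rw [← hu]
  exact classLabel_le (hsub hux)

theorem labels_anti {j k : ℕ} (hjk : j ≤ k) :
    labels (starStages p c k).2 ⊆ labels (starStages p c j).2 :=
  labels_anti_of_subset (parentSystem_starStages h j).isClassSystem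
    (parentSystem_starStages h k).isClassSystem fun _ hx => class_mono h hx hjk

theorem classLabel_starStages_anti {j k : ℕ} (hjk : j ≤ k) {x : Vertex} (hx : x ≠ ⊤) :
    classLabel (starStages p c k).2 x ≤ classLabel (starStages p c j).2 x :=
  classLabel_anti (parentSystem_starStages h j).isClassSystem hx (class_mono h hx hjk)

/-- The vertices of the root component are eventually attached to the root. -/
theorem eventually_parent_eq_top {n : ℕ} {x : Vertex} (hn : p^[n] x = ⊤) :
    ∀ᶠ k in Filter.atTop, (starStages p c k).1 x = ⊤ := by
  induction n generalizing x with
  | zero =>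
    obtain rfl : x = ⊤ := hn
    exact Filter.Eventually.of_forall fun k => (parentSystem_starStages h k).root
  | succ n ih =>
    rw [Function.iterate_succ_apply] at hn
    rcases eq_top_or_eq_succPNat (p x) with hx | ⟨j, hj⟩
    · exact Filter.Eventually.of_forall fun k =>
        starStages_parent_mono (Nat.zero_le k) hx fun i _ => (succPNat_ne_top i).symm
    · have hxt : x ≠ ⊤ := by
        rintro rfl
        exact succPNat_ne_top j (hj.symm.trans h.root)
      filter_upwards [ih hn, Filter.eventually_ge_atTop (j + 1)] with k hk hjk
      have h1 : (starStages p c j).1 x = j.succPNat :=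
        starStages_parent_mono (Nat.zero_le j) hj fun i hi => by
          rw [Ne, succPNat_inj]; omega
      have h2 : x ∈ (starStages p c k).2 j.succPNat := by
        refine class_mono h (succPNat_ne_top j) hjk ?_
        change x ∈ mergeClass _ _ _ _
        rw [mergeClass_of_mem (Or.inl ((parentSystem_starStages h j).mem_self (succPNat_ne_top j)))]
        exact Or.inr ⟨hxt, h1⟩
      rw [((parentSystem_starStages h k).of_mem (succPNat_ne_top j) h2).2.2, ← hj, hk]

end Parents

section Multiplicity

variable {T : IdeallyRootedHypertree Vertex ⊤} {p : Vertex → Vertex} {c : Vertex → Set Vertex}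
  (h : ParentSystem ⊤ p c) (hM : T.markedEdges = ParentSystem.markedEdges ⊤ p c)
  (hinf : E(T.toHypergraph).Infinite)
include h hM hinf

theorem exists_position {k : ℕ} {x : Vertex}
    (hx : x ∈ children (starStages p c k).1 k.succPNat) :
    ∃ i ∈ (T.stage k).2, T.prueferWord i = k.succPNat ∧ rank (T.stage k).2 i =
      rank (labelsAvoiding (starStages p c k).2 k.succPNat)
        (classLabel (starStages p c k).2 x) := by
  have := hx
  rw [children_eq_received h hM hinf] at this
  obtain ⟨-, -, i, hi, hW, hr⟩ := this
  rw [← stage_snd_eq_remaining] at hi hr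
  exact ⟨i, hi, hW, hr⟩

/-- Ranks identify the positions carrying the letter with the classes of children at its own stage,
and these are as numerous as the classes of original children. The one hyperedge leading to the
parent does not affect finiteness. -/
theorem finite_letter_iff (k : ℕ) : {i | T.prueferWord i = k.succPNat}.Finite ↔
    (T.toHypergraph.edgesAt k.succPNat).Finite := by
  have hk := parentSystem_starStages h k
  have hch : classLabel (starStages p c k).2 '' children (starStages p c k).1 k.succPNat ⊆
      labelsAvoiding (starStages p c k).2 k.succPNat := by
    rintro _ ⟨x, hx, rfl⟩
    obtain ⟨h1, h2, -⟩ := children_spec hk (succPNat_ne_top k) x hx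
    exact ⟨x, h1, h2, rfl⟩
  have hsub : {i | T.prueferWord i = k.succPNat} ⊆ (T.stage k).2 := fun i hi =>
    ((T.prueferWord_eq_iff k i).1 hi).1
  rw [finite_edgesAt_iff h (T.edgeSet_eq_of_markedEdges_eq hM),
    ← finite_children_classes_iff h (k := k) fun i hi => by rw [Ne, succPNat_inj]; omega,
    ← Set.finite_image_iff ((rank_injOn _).mono hsub),
    ← Set.finite_image_iff ((rank_injOn _).mono hch)]
  refine iff_of_eq (congrArg Set.Finite (Set.ext fun n => ?_))
  constructor
  · rintro ⟨i, hi, rfl⟩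
    rw [Set.mem_ofPred_eq, T.prueferWord_eq_iff, T.receives_stage_iff h hM] at hi
    obtain ⟨-, x, hx, hr⟩ := hi
    exact ⟨_, ⟨x, hx, rfl⟩, hr.symm⟩
  · rintro ⟨_, ⟨x, hx, rfl⟩, rfl⟩
    obtain ⟨i, -, hW, hr⟩ := exists_position h hM hinf hx
    exact ⟨i, hW, hr⟩

/-- If `∞` has infinite multiplicity, then at some stage the first classes are attached to the
root. -/
theorem exists_stage_parent_eq_top (htop : {i | T.prueferWord i = ⊤}.Infinite) (n : ℕ) :
    ∃ K, ∀ x ≠ ⊤, rank (labels (starStages p c K).2) (classLabel (starStages p c K).2 x) ≤ n →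
      (starStages p c K).1 x = ⊤ := by
  obtain ⟨i, hi, hin⟩ := exists_rank_eq (A := {i | T.prueferWord i = ⊤}) (n := n)
    (by rw [htop.encard_eq]; exact ENat.natCast_lt_top n)
  have hiR := (T.prueferWord_eq_top_iff i).1 hi
  have hlow : ∀ k, n ≤ rank (T.stage k).2 i := fun k => by
    rw [← hin]
    exact rank_anti (fun j hj => (T.prueferWord_eq_top_iff j).1 hj k) i
  -- The position `i` carries `∞` and has `n` such positions before it. At the stage `K` minimising
  -- its rank among the free positions, no position before `i` will be filled any more.
  have hwf := (measure fun k => rank (T.stage k).2 i).wf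
  let K := hwf.min Set.univ Set.univ_nonempty
  have hK : ∀ k, rank (T.stage K).2 i ≤ rank (T.stage k).2 i := fun k =>
    not_lt.1 (hwf.not_lt_min Set.univ (Set.mem_univ k))
  have hanti : ∀ j k, j ≤ k → (T.stage k).2 ⊆ (T.stage j).2 := by
    intro j k hjk l
    rw [T.mem_stage_iff, T.mem_stage_iff]
    exact fun hl m hm => hl m (hm.trans_le hjk)
  refine ⟨K, fun x hx hr => ?_⟩
  rcases eq_top_or_eq_succPNat ((starStages p c K).1 x) with htop | ⟨u, hu⟩
  · exact htop
  exfalso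
  have hKu : K ≤ u := by
    by_contra hlt
    exact starStages_parent_ne h (not_le.1 hlt) x hu
  have hux : x ∈ children (starStages p c u).1 u.succPNat :=
    ⟨hx, starStages_parent_mono hKu hu fun i hi => by rw [Ne, succPNat_inj]; omega⟩
  obtain ⟨l, hl, hW, hlr⟩ := exists_position h hM hinf hux
  have h1 : rank (T.stage u).2 l ≤ n := by
    rw [hlr]
    refine (rank_anti ?_ _).trans (((rank_anti (labels_anti h hKu) _).trans
      (rank_mono _ (classLabel_starStages_anti h hKu hx))).trans hr)
    rintro _ ⟨y, hy, -, rfl⟩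
    exact ⟨y, hy, rfl⟩
  -- A finite parent would fill a position of rank at most `n`. It cannot lie beyond `i`, whose rank
  -- is at least `n`, nor equal `i`, which stays free; so a position before `i` would be lost after
  -- stage `K`.
  have hli : l < i := by
    refine lt_of_le_of_ne ?_ ?_
    · by_contra hil
      have h2 := rank_lt (hiR u) (not_le.1 hil)
      have h3 := hlow u
      omega
    · rintro rfl
      exact succPNat_ne_top u (hW.symm.trans hi)
  have hl' : l ∉ (T.stage (u + 1)).2 := by
    rw [T.mem_stage_iff_word]
    exact fun hall => hall u (Nat.lt_succ_self u) hW
  have h4 := rank_lt_of_subset (hanti u (u + 1) (Nat.le_succ u)) hli hl hl'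
  have h5 := hK (u + 1)
  have h6 := rank_anti (hanti K u hKu) i
  omega

/-- The labels of the classes attached to the root stay below a bound `B`, and the rank of a label
is at most the label. So a class of rank `B + 1` never has the root as parent. -/
theorem finite_top_of_finite_edgesAt (hfin : (T.toHypergraph.edgesAt ⊤).Finite) :
    {i | T.prueferWord i = ⊤}.Finite := by
  by_contra htop
  rw [finite_edgesAt_iff h (T.edgeSet_eq_of_markedEdges_eq hM),
    ← finite_children_classes_iff h (k := 0) fun i hi => (succPNat_ne_top i).symm] at hfin
  obtain ⟨B, hB⟩ := hfin.bddAbove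
  obtain ⟨K, hK⟩ := exists_stage_parent_eq_top h hM hinf htop (B + 1)
  have hlab : (labels (starStages p c K).2).encard = ⊤ := by
    rw [T.encard_labels_stage h hM (infinite_labels h hM hinf) K,
      (Set.Infinite.mono (fun i hi => (T.prueferWord_eq_top_iff i).1 hi K) htop).encard_eq]
    rfl
  obtain ⟨_, ⟨x, hx, rfl⟩, hr⟩ := exists_rank_eq (A := labels (starStages p c K).2) (n := B + 1)
    (by rw [hlab]; exact ENat.natCast_lt_top _)
  obtain ⟨y, hy, hyx⟩ := exists_mem_parent_eq h K hx (hK x hx hr.le)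
  have h1 : classLabel (starStages p c K).2 x ≤ B := by
    refine le_trans ?_ (hB ⟨y, hy, rfl⟩)
    have h2 := classLabel_starStages_anti h (Nat.zero_le K) hy.1
    simp only [classLabel, ((parentSystem_starStages h K).of_mem hx hyx).2.1] at h2 ⊢
    exact h2
  have h3 := rank_le (labels (starStages p c K).2) (classLabel (starStages p c K).2 x)
  omega

/-- Parents at all stages are iterated original parents, so `x` is never attached to the root. The
rank of its class, however, stays bounded by its initial label. -/
theorem finite_top_of_ideal {x : Vertex} (hx : ∀ n, p^[n] x ≠ ⊤) :
    {i | T.prueferWord i = ⊤}.Finite := by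
  by_contra htop
  obtain ⟨K, hK⟩ := exists_stage_parent_eq_top h hM hinf htop (classLabel c x)
  have hxt : x ≠ ⊤ := hx 0
  obtain ⟨m, hm⟩ := exists_starStages_parent_eq_iterate (p := p) (c := c) K x
  exact hx m (hm.symm.trans (hK x hxt ((rank_le _ _).trans
    (classLabel_starStages_anti h (Nat.zero_le K) hxt))))

omit hinf in
/-- If the root has infinite degree and there is no ideal component, then the first classes of all
late stages are attached to the root. -/
theorem eventually_parent_eq_top_of_rank_le (hdeg : ¬ (T.toHypergraph.edgesAt ⊤).Finite)
    (hroot : ∀ x, ∃ n, p^[n] x = ⊤) (n : ℕ) :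
    ∀ᶠ k in Filter.atTop, ∀ x ≠ ⊤, rank (labels (starStages p c k).2)
      (classLabel (starStages p c k).2 x) ≤ n → (starStages p c k).1 x = ⊤ := by
  rw [finite_edgesAt_iff h (T.edgeSet_eq_of_markedEdges_eq hM),
    ← finite_children_classes_iff h (k := 0) fun i hi => (succPNat_ne_top i).symm] at hdeg
  have hdeg' : (classLabel c '' children p ⊤).Infinite := hdeg
  -- Below `N` lie the labels of `n + 1` classes attached to the root. They stay distinct and their
  -- labels only decrease, so a class of rank at most `n` has its label below `N`; finally all
  -- vertices up to `N` have the root as parent.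
  obtain ⟨N, -, hN⟩ := exists_rank_eq (A := classLabel c '' children p ⊤) (n := n + 1)
    (by rw [hdeg'.encard_eq]; exact ENat.natCast_lt_top _)
  have hfin : {u : ℕ+ | (u : ℕ) ≤ N}.Finite :=
    (Set.finite_Iic N).preimage PNat.coe_injective.injOn
  have hev : ∀ᶠ k in Filter.atTop, ∀ u ∈ {u : ℕ+ | (u : ℕ) ≤ N},
      (starStages p c k).1 (u : Vertex) = ⊤ :=
    (Filter.eventually_all_finite hfin).2 fun u _ =>
      eventually_parent_eq_top h (hroot u).choose_spec
  filter_upwards [hev] with k hk x hx hr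
  have hkP := parentSystem_starStages h k
  have hge : n + 1 ≤ rank (labels (starStages p c k).2) N := by
    rw [← hN]
    choose! f hf hfl using fun l (hl : l ∈ classLabel c '' children p ⊤) => hl
    refine Set.ncard_le_ncard_of_injOn (fun l => classLabel (starStages p c k).2 (f l)) ?_ ?_
      (finite_below _ N)
    · rintro l ⟨hl, hlN⟩
      refine ⟨⟨f l, (hf l hl).1, rfl⟩, lt_of_le_of_lt ?_ hlN⟩
      exact (classLabel_starStages_anti h (Nat.zero_le k) (hf l hl).1).trans_eq (hfl l hl)
    · rintro l ⟨hl, -⟩ l' ⟨hl', -⟩ hll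
      have h1 := hkP.isClassSystem.classLabel_inj (hf l hl).1 (hf l' hl').1 hll
      have h2 := class_eq_of_starStages_class_eq h (fun i _ => (succPNat_ne_top i).symm)
        (hf l hl) (hf l' hl') h1
      rw [← hfl l hl, ← hfl l' hl', classLabel, classLabel, h2]
  have hlt := lt_of_rank_lt (lt_of_le_of_lt hr (Nat.lt_of_succ_le hge))
  obtain ⟨u, hu, hux⟩ := hkP.isClassSystem.exists_classLabel hx
  rw [← (hkP.of_mem hx hux).2.2]
  exact hk u (hu ▸ hlt.le)

/-- From some stage on, positions of rank at most `n` are matched with classes attached to the root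
and never receive a letter. With `n` the supposed multiplicity of `∞`, these are already `n + 1`
positions. -/
theorem infinite_top (hdeg : ¬ (T.toHypergraph.edgesAt ⊤).Finite)
    (hroot : ∀ x, ∃ n, p^[n] x = ⊤) : {i | T.prueferWord i = ⊤}.Infinite := by
  intro hfin
  set n := {i | T.prueferWord i = ⊤}.ncard with hn
  -- The bound is `n + 1` because positions are matched by ranks among the classes avoiding the
  -- current vertex; counting its class too may raise a rank by one.
  obtain ⟨K, hK⟩ := Filter.eventually_atTop.1
    (eventually_parent_eq_top_of_rank_le h hM hdeg hroot (n + 1))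
  have hstay : ∀ i ∈ (T.stage K).2, rank (T.stage K).2 i ≤ n → ∀ k ≥ K, i ∈ (T.stage k).2 ∧
      rank (T.stage k).2 i ≤ n := by
    intro i hi hr k hk
    induction k, hk using Nat.le_induction with
    | base => exact ⟨hi, hr⟩
    | succ k hk ih =>
      have hkP := parentSystem_starStages h k
      have hsub : (T.stage (k + 1)).2 ⊆ (T.stage k).2 := fun j hj => hj.1
      refine ⟨⟨ih.1, fun hrec => ?_⟩, (rank_anti hsub i).trans ih.2⟩
      rw [T.receives_stage_iff h hM] at hrec
      obtain ⟨-, x, hx, hxr⟩ := hrec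
      have h1 : rank (labels (starStages p c k).2) (classLabel (starStages p c k).2 x) ≤ n + 1 := by
        have h2 : rank (labels (starStages p c k).2) (classLabel (starStages p c k).2 x) ≤
            rank (labelsAvoiding (starStages p c k).2 k.succPNat)
              (classLabel (starStages p c k).2 x) + 1 := by
          rw [hkP.isClassSystem.labels_eq (succPNat_ne_top k)]
          refine (Set.ncard_le_ncard ?_ ((finite_below _ _).insert
            (classLabel (starStages p c k).2 k.succPNat))).trans (Set.ncard_insert_le _ _)
          rintro j ⟨rfl | hj, hjl⟩
          · exact Or.inl rfl
          · exact Or.inr ⟨hj, hjl⟩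
        have h3 := ih.2
        omega
      exact succPNat_ne_top k (hx.2.symm.trans (hK k hk x hx.1 h1))
  have htop : ∀ i ∈ (T.stage K).2, rank (T.stage K).2 i ≤ n → T.prueferWord i = ⊤ := by
    intro i hi hr
    rw [T.prueferWord_eq_top_iff]
    intro k
    rw [T.mem_stage_iff]
    intro j hj
    exact (T.mem_stage_iff (max K k) i).1 (hstay i hi hr _ (le_max_left _ _)).1 j
      (hj.trans_le (le_max_right _ _))
  have hRinf : (T.stage K).2.encard = ⊤ := by
    -- The root is never reduced, so it keeps infinitely many classes of children and infinitely
    -- many positions stay free.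
    have hlab : (labels (starStages p c K).2).Infinite := by
      intro hlf
      refine hdeg ?_
      rw [finite_edgesAt_iff h (T.edgeSet_eq_of_markedEdges_eq hM),
        ← finite_children_classes_iff h (k := K) fun i hi => (succPNat_ne_top i).symm]
      refine hlf.subset ?_
      rintro _ ⟨x, hx, rfl⟩
      exact ⟨x, hx.1, rfl⟩
    have := T.encard_labels_stage h hM (infinite_labels h hM hinf) K
    rw [hlab.encard_eq] at this
    exact (WithTop.add_eq_top.1 this.symm).resolve_right ENat.one_ne_top
  obtain ⟨i, hi, hr⟩ := exists_rank_eq (A := (T.stage K).2) (n := n)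
    (by rw [hRinf]; exact ENat.natCast_lt_top _)
  have h1 : rank (T.stage K).2 i ≤ rank {i | T.prueferWord i = ⊤} i :=
    Set.ncard_le_ncard (fun j hj => ⟨htop j hj.1 ((rank_mono _ hj.2.le).trans hr.le), hj.2⟩)
      (finite_below _ i)
  have h2 := rank_lt_encard (A := {i | T.prueferWord i = ⊤}) (htop i hi hr.le)
  rw [← hfin.cast_ncard_eq, Nat.cast_lt] at h2
  omega

theorem finite_top_iff : {i | T.prueferWord i = ⊤}.Finite ↔
    (T.toHypergraph.edgesAt ⊤).Finite ∨ T.HasIdealComponent := by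
  have hE := T.edgeSet_eq_of_markedEdges_eq hM
  constructor
  · intro hfin
    by_contra hno
    rw [not_or] at hno
    refine infinite_top h hM hinf hno.1 (fun x => ?_) hfin
    rw [← h.reachable_root_iff hE]
    by_contra hx
    exact hno.2 ⟨T.toHypergraph.primalGraph.connectedComponentMk x, fun hr =>
      hx (SimpleGraph.ConnectedComponent.eq.1 hr).symm⟩
  · rintro (hfin | ⟨C, hC⟩)
    · exact finite_top_of_finite_edgesAt h hM hinf hfin
    · obtain ⟨x, hx⟩ := C.nonempty_supp
      refine finite_top_of_ideal h hM hinf (x := x) fun n hn => hC ?_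
      have hr := (h.reachable_root_iff hE).2 ⟨n, hn⟩
      exact (SimpleGraph.ConnectedComponent.eq.2 hr.symm).trans hx

omit hinf in
theorem finite_parts_iff : (∀ s ∈ T.prueferPartition, s.Finite) ↔
    ∀ e ∈ E(T.toHypergraph), e.Finite := by
  rw [prueferPartition_eq h hM, T.edgeSet_eq_of_markedEdges_eq hM]
  constructor
  · rintro hs _ ⟨x, hx, rfl⟩
    refine Set.Finite.insert _ ?_
    rw [← h.isClassSystem.image_finitePart hx]
    exact (hs _ ⟨x, hx, rfl⟩).image _
  · rintro he _ ⟨x, hx, rfl⟩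
    exact ((he _ ⟨x, hx, rfl⟩).subset (Set.subset_insert _ _)).preimage
      WithTop.coe_injective.injOn

end Multiplicity

theorem isFiniteType_iff {T : IdeallyRootedHypertree Vertex ⊤}
    (hinf : E(T.toHypergraph).Infinite) : IsFiniteType T.prueferCode ↔
      (∀ e ∈ E(T.toHypergraph), e.Finite) ∧
      (∀ v : ℕ+, (T.toHypergraph.edgesAt (v : Vertex)).Finite) ∧
      ((T.toHypergraph.edgesAt ⊤).Finite ∨ T.HasIdealComponent) := by
  obtain ⟨p, c, h, hM, -⟩ := T.exists_parentSystem
  have hletter := finite_letter_iff h hM hinf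
  refine and_congr (finite_parts_iff h hM) ?_
  rw [← finite_top_iff h hM hinf]
  constructor
  · intro hW
    refine ⟨fun v => ?_, hW ⊤⟩
    have := (hletter v.natPred).1 (hW _)
    rwa [PNat.succPNat_natPred] at this
  · rintro ⟨hv, ht⟩ a
    rcases eq_top_or_eq_succPNat a with rfl | ⟨k, rfl⟩
    · exact ht
    · exact (hletter k).2 (hv _)

end PrueferCode

theorem mainTheorem3 :
    Set.BijOn IdeallyRootedHypertree.prueferCode
      {T : IdeallyRootedHypertree PrueferCode.Vertex ⊤ | E(T.toHypergraph).Infinite}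
      {c : Set (Set ℕ+) × (ℕ → PrueferCode.Vertex) | Setoid.IsPartition c.1 ∧ c.1.Infinite} ∧
    ∀ T : IdeallyRootedHypertree PrueferCode.Vertex ⊤, E(T.toHypergraph).Infinite →
      (T.toHypergraph.IsLocallyFinite → PrueferCode.IsFiniteType T.prueferCode) ∧
      (PrueferCode.IsFiniteType T.prueferCode ↔
        (∀ e ∈ E(T.toHypergraph), e.Finite) ∧
        (∀ v : ℕ+, (T.toHypergraph.edgesAt (v : PrueferCode.Vertex)).Finite) ∧
        ((T.toHypergraph.edgesAt ⊤).Finite ∨ T.HasIdealComponent)) := by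
  refine ⟨PrueferCode.prueferCode_bijOn, fun T hinf => ⟨fun hT => ?_,
    PrueferCode.isFiniteType_iff hinf⟩⟩
  have hV : ∀ v, v ∈ V(T.toHypergraph) := fun v => T.vertexSet_eq ▸ Set.mem_univ v
  exact (PrueferCode.isFiniteType_iff hinf).2
    ⟨hT.1, fun v => hT.2 _ (hV _), Or.inl (hT.2 _ (hV _))⟩
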